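/- Fix an integer $n\ge 2$. All variables $x_i$ have degree $2$, and $\{m\}$ denotes the shift of gradings up by $m$. For a polynomial ring $R$ over $\mathbb{Q}$ and a potential $w\in R$ that is homogeneous of degree $2(n+1)$, a graded factorization of $w$ consists of free graded $R$-modules $M^0,M^1$ and degree $n+1$ maps $d:M^0\to M^1$, $d:M^1\to M^0$ with $d^2=w$. Its cohomology is the cohomology of the 2-periodic complex $M/\mathfrak{m}M$, where $\mathfrak m$ is the ideal generated by the variables. The category $\mathrm{hmf}_w$ has as objects the graded factorizations of $w$ with finite-dimensional cohomology, and as morphisms the degree $0$ homomorphisms modulo homotopies of degree $-n-1$. Put $(M\langle 1\rangle)^i=M^{i+1}$, with differential $-d$. For homogeneous $a,b$ with $\deg a+\deg b=2(n+1)$ let $\{a,b\}$ be the factorization $R\xrightarrow{a}R\{n+1-\deg a\}\xrightarrow{b}R$ of $ab$. To an arc oriented from a mark $j$ to a mark $i$ assign $$L^i_j=\{\pi_{ij},\,x_i-x_j\},\qquad \pi_{ij}=\frac{x_i^{n+1}-x_j^{n+1}}{x_i-x_j}.$$ To a wide edge $t$ bounded by marks $i,j$ (towards which its two outgoing edges are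 oriented) and $k,l$ (from which its two incoming edges are oriented) assign $$C_t=\{u_1,\,x_i+x_j-x_k-x_l\}\otimes\{u_2,\,x_ix_j-x_kx_l\}\,\{-1\},$$ where $g$ is the polynomial with $g(x+y,xy)=x^{n+1}+y^{n+1}$ and $$u_1=\frac{g(x_i+x_j,x_ix_j)-g(x_k+x_l,x_ix_j)}{x_i+x_j-x_k-x_l},\qquad u_2=\frac{g(x_k+x_l,x_ix_j)-g(x_k+x_l,x_kx_l)}{x_ix_j-x_kx_l}.$$ The factorization $C(\Gamma)$ of a marked graph $\Gamma$ is the tensor product, over the polynomial ring in all marks, of the factorizations of its wide edges and arcs, considered over the polynomial ring in the boundary marks. Consider three graphs with boundary marks $1,2,3,4$. The graph $\Gamma$ has internal marks $5,6$ and two wide edges, one with outgoing marks $1,5$ and incoming marks $6,4$, the other with outgoing marks $3,6$ and incoming marks $5,2$. The graph $\Gamma_1$ consists of an arc from $4$ to $1$ and an arc from $2$ to $3$. The graph $\Gamma_2$ consists of an arc from $2$ to $1$ and an arc from $4$ to $3$. Let $w=x_1^{n+1}-x_2^{n+1}+x_3^{n+1}-x_4^{n+1}\in\mathbb{Q}[x_1,x_2,x_3,x_4]$.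 Then $C(\Gamma)$, $C(\Gamma_1)$, $C(\Gamma_2)$ are objects of $\mathrm{hmf}_w$, and there is a direct sum decomposition in $\mathrm{hmf}_w$ $$C(\Gamma)\;\cong\; C(\Gamma_2)\oplus\bigoplus_{i=0}^{n-3}C(\Gamma_1)\langle 1\rangle\{3-n+2i\},$$ where the sum over $i$ is empty if $n=2$. -/

import Mathlib

open CategoryTheory
open scoped TensorProduct

noncomputable section

namespace MatFact

/-! ### Polynomial rings with all variables in degree `2` -/

/-- `p` is homogeneous of degree `k` when every variable has degree `2`. -/
def IsHomog {σ : Type} (p : MvPolynomial σ ℚ) (k : ℤ) : Prop :=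
  MvPolynomial.IsWeightedHomogeneous (fun _ : σ => (2 : ℤ)) p k

section IsHomog
variable {σ : Type} {p q : MvPolynomial σ ℚ} {j k : ℤ}

theorem IsHomog.zero (k : ℤ) : IsHomog (0 : MvPolynomial σ ℚ) k :=
  MvPolynomial.isWeightedHomogeneous_zero _ _ _

theorem IsHomog.one : IsHomog (1 : MvPolynomial σ ℚ) 0 :=
  MvPolynomial.isWeightedHomogeneous_one _ _

theorem IsHomog.X (i : σ) : IsHomog (MvPolynomial.X i : MvPolynomial σ ℚ) 2 :=
  MvPolynomial.isWeightedHomogeneous_X _ _ _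

theorem IsHomog.add (hp : IsHomog p k) (hq : IsHomog q k) : IsHomog (p + q) k :=
  MvPolynomial.IsWeightedHomogeneous.add hp hq

theorem IsHomog.sub (hp : IsHomog p k) (hq : IsHomog q k) : IsHomog (p - q) k :=
  MvPolynomial.IsWeightedHomogeneous.sub hp hq

theorem IsHomog.neg (hp : IsHomog p k) : IsHomog (-p) k :=
  MvPolynomial.IsWeightedHomogeneous.neg hp

theorem IsHomog.mul (hp : IsHomog p j) (hq : IsHomog q k) : IsHomog (p * q) (j + k) :=
  MvPolynomial.IsWeightedHomogeneous.mul hp hq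

theorem IsHomog.pow (hp : IsHomog p k) (m : ℕ) : IsHomog (p ^ m) (m * k) := by
  have h := MvPolynomial.IsWeightedHomogeneous.pow hp m
  rwa [nsmul_eq_mul] at h

theorem IsHomog.sum {I : Type*} (s : Finset I) (f : I → MvPolynomial σ ℚ)
    (h : ∀ i ∈ s, IsHomog (f i) k) : IsHomog (∑ i ∈ s, f i) k :=
  MvPolynomial.IsWeightedHomogeneous.sum s f k h

theorem IsHomog.cast (hp : IsHomog p j) (h : j = k) : IsHomog p k := h ▸ hp

end IsHomog

/-! ### Free graded modules -/

/-- A free graded module over `ℚ[σ]`: a module with a `ℤ`-indexed family of subgroups which,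
in suitable coordinates, is the standard grading of a direct sum of shifted copies
`⨁ i, R{d i}`. The basis is not part of the data. -/
structure GrFree (σ : Type) : Type 1 where
  carrier : Type
  [acg : AddCommGroup carrier]
  [mod : Module (MvPolynomial σ ℚ) carrier]
  /-- the homogeneous elements of degree `k` -/
  piece : ℤ → AddSubgroup carrier
  free : ∃ (I : Type) (b : Module.Basis I (MvPolynomial σ ℚ) carrier) (d : I → ℤ),
    ∀ k x, x ∈ piece k ↔ ∀ i, IsHomog (b.repr x i) (k - d i)

attribute [instance] GrFree.acg GrFree.mod

namespace GrFree
variable {σ : Type}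

/-- `R{s}`: the generator `1` has degree `s`. -/
def base (σ : Type) (s : ℤ) : GrFree σ where
  carrier := MvPolynomial σ ℚ
  piece k :=
    { carrier := {p | IsHomog p (k - s)}
      zero_mem' := IsHomog.zero _
      add_mem' := fun ha hb => IsHomog.add ha hb
      neg_mem' := fun ha => IsHomog.neg ha }
  free := ⟨Unit, Module.Basis.singleton Unit _, fun _ => s, fun k x => by
    simp only [Module.Basis.singleton_repr, forall_const]; rfl⟩

/-- The zero module. -/
def zero (σ : Type) : GrFree σ where
  carrier := PUnit
  piece _ := ⊤
  free := ⟨PEmpty, Module.Basis.empty _, fun _ => 0, fun k x => by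
    constructor
    · rintro - ⟨⟩
    · intro; trivial⟩

/-- `M{s}`, the grading shifted up by `s`. -/
def shift (M : GrFree σ) (s : ℤ) : GrFree σ where
  carrier := M.carrier
  piece k := M.piece (k - s)
  free := by
    obtain ⟨I, b, d, h⟩ := M.free
    refine ⟨I, b, fun i => d i + s, fun k x => ?_⟩
    rw [h]
    have : ∀ i, k - s - d i = k - (d i + s) := fun i => by ring
    simp only [this]

/-- Direct sum of two graded modules. -/
def prod (M N : GrFree σ) : GrFree σ where
  carrier := M.carrier × N.carrier
  piece k := (M.piece k).prod (N.piece k)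
  free := by
    obtain ⟨I, b, d, h⟩ := M.free
    obtain ⟨J, c, e, h'⟩ := N.free
    refine ⟨I ⊕ J, b.prod c, Sum.elim d e, fun k x => ?_⟩
    rw [AddSubgroup.mem_prod, h, h', Sum.forall]
    simp

/-- Direct sum of a finite family of graded modules. -/
def pi {m : ℕ} (M : Fin m → GrFree σ) : GrFree σ where
  carrier := ∀ i, (M i).carrier
  piece k := AddSubgroup.pi Set.univ fun i => (M i).piece k
  free := by
    choose I b d h using fun i => (M i).free
    refine ⟨Σ i, I i, Pi.basis b, fun i => d i.1 i.2, fun k x => ?_⟩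
    simp only [AddSubgroup.mem_pi, Set.mem_univ, true_implies, h, Sigma.forall, Pi.basis_repr]

/-- Tensor product over `R`; its degree `k` part is spanned by the `x ⊗ y` with
`deg x + deg y = k`. -/
def tensor (M N : GrFree σ) : GrFree σ where
  carrier := M.carrier ⊗[MvPolynomial σ ℚ] N.carrier
  piece k := AddSubgroup.closure
    {t | ∃ i j x y, i + j = k ∧ x ∈ M.piece i ∧ y ∈ N.piece j ∧
      t = x ⊗ₜ[MvPolynomial σ ℚ] y}
  free := by
    obtain ⟨I, b, d, h⟩ := M.free
    obtain ⟨J, c, e, h'⟩ := N.free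
    refine ⟨I × J, b.tensorProduct c, fun ij => d ij.1 + e ij.2, fun k t => ⟨fun ht => ?_, fun ht => ?_⟩⟩
    · induction ht using AddSubgroup.closure_induction with
      | mem t ht =>
        obtain ⟨i, j, x, y, hk, hx, hy, rfl⟩ := ht
        rintro ⟨a, a'⟩
        rw [Module.Basis.tensorProduct_repr_tmul_apply, smul_eq_mul]
        exact (((h' _ _).1 hy a').mul ((h _ _).1 hx a)).cast (by simp only; omega)
      | zero => intro ij; simpa using IsHomog.zero _
      | add x y _ _ hx hy => intro ij; simpa using (hx ij).add (hy ij)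
      | neg x _ hx => intro ij; simpa using (hx ij).neg
    · rw [← (b.tensorProduct c).linearCombination_repr t, Finsupp.linearCombination_apply]
      refine AddSubgroup.sum_mem _ fun ij _ => AddSubgroup.subset_closure ?_
      refine ⟨k - e ij.2, e ij.2, (b.tensorProduct c).repr t ij • b ij.1, c ij.2, by ring, ?_, ?_, ?_⟩
      · classical
        rw [h]
        intro i
        rw [map_smul, Finsupp.smul_apply, Module.Basis.repr_self, smul_eq_mul, Finsupp.single_apply]
        split_ifs with hi
        · subst hi
          simpa using (ht ij).cast (by ring)
        · simpa using IsHomog.zero _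
      · classical
        rw [h']
        intro i
        rw [Module.Basis.repr_self, Finsupp.single_apply]
        split_ifs with hi
        · subst hi
          exact IsHomog.one.cast (by ring)
        · exact IsHomog.zero _
      · dsimp only
        rw [Module.Basis.tensorProduct_apply', TensorProduct.smul_tmul']

/-- The inclusion of `ℚ[β]` into `ℚ[ι ⊔ β]`. -/
def incl (ι β : Type) : MvPolynomial β ℚ →+* MvPolynomial (ι ⊕ β) ℚ :=
  (MvPolynomial.rename Sum.inr).toRingHom

theorem coeff_coeff_sumAlgEquiv {ι β : Type} (p : MvPolynomial (ι ⊕ β) ℚ) (a : ι →₀ ℕ)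
    (e : β →₀ ℕ) :
    ((MvPolynomial.sumAlgEquiv ℚ ι β p).coeff a).coeff e =
      p.coeff (Finsupp.sumElim a e) := by
  classical
  have hm (f : ι ⊕ β →₀ ℕ) (r : ℚ) : MvPolynomial.sumAlgEquiv ℚ ι β (MvPolynomial.monomial f r) =
      MvPolynomial.monomial (Finsupp.sumFinsuppAddEquivProdFinsupp f).1
        (MvPolynomial.monomial (Finsupp.sumFinsuppAddEquivProdFinsupp f).2 r) := by
    simp [MvPolynomial.sumAlgEquiv, MvPolynomial.monomial]
  induction p using MvPolynomial.induction_on' with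
  | monomial f r =>
    rw [hm, MvPolynomial.coeff_monomial, MvPolynomial.coeff_monomial]
    have key : f = Finsupp.sumElim a e ↔ (Finsupp.sumFinsuppAddEquivProdFinsupp f).1 = a ∧
        (Finsupp.sumFinsuppAddEquivProdFinsupp f).2 = e := by
      constructor
      · rintro rfl
        constructor <;> ext <;> simp
      · rintro ⟨rfl, rfl⟩
        ext (i | i) <;> simp
    by_cases h1 : (Finsupp.sumFinsuppAddEquivProdFinsupp f).1 = a
    · by_cases h2 : (Finsupp.sumFinsuppAddEquivProdFinsupp f).2 = e
      · rw [if_pos h1, if_pos (key.2 ⟨h1, h2⟩), MvPolynomial.coeff_monomial, if_pos h2]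
      · rw [if_pos h1, if_neg fun h => h2 (key.1 h).2, MvPolynomial.coeff_monomial, if_neg h2]
    · rw [if_neg h1, if_neg fun h => h1 (key.1 h).1, MvPolynomial.coeff_zero]
  | add p q hp hq => simp only [map_add, MvPolynomial.coeff_add, hp, hq]

theorem weight_two {σ : Type} (a : σ →₀ ℕ) :
    Finsupp.weight (fun _ : σ => (2 : ℤ)) a = 2 * (a.degree : ℤ) := by
  rw [Finsupp.weight_apply, Finsupp.sum, Finsupp.degree_apply, Nat.cast_sum, Finset.mul_sum]
  exact Finset.sum_congr rfl fun i _ => by rw [nsmul_eq_mul, mul_comm]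

theorem degree_sumElim {ι β : Type} (a : ι →₀ ℕ) (e : β →₀ ℕ) :
    (Finsupp.sumElim a e).degree = a.degree + e.degree := by
  have h : Finsupp.sumElim a e = a.mapDomain Sum.inl + e.mapDomain Sum.inr := by
    ext (i | i)
    · simp [Finsupp.mapDomain_apply Sum.inl_injective, Finsupp.mapDomain_of_notMem_range]
    · simp [Finsupp.mapDomain_apply Sum.inr_injective, Finsupp.mapDomain_of_notMem_range]
  rw [h, map_add, Finsupp.degree_mapDomain, Finsupp.degree_mapDomain]

theorem isHomog_iff_coeff {ι β : Type} (p : MvPolynomial (ι ⊕ β) ℚ) (k : ℤ) :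
    IsHomog p k ↔ ∀ a : ι →₀ ℕ,
      IsHomog ((MvPolynomial.sumAlgEquiv ℚ ι β p).coeff a) (k - 2 * (a.degree : ℤ)) := by
  simp only [IsHomog, MvPolynomial.IsWeightedHomogeneous, weight_two, coeff_coeff_sumAlgEquiv]
  constructor
  · intro h a e hc
    have := h hc
    rw [degree_sumElim] at this
    push_cast at this
    omega
  · intro h f hf
    have hfe : f = Finsupp.sumElim (Finsupp.sumFinsuppAddEquivProdFinsupp f).1
        (Finsupp.sumFinsuppAddEquivProdFinsupp f).2 := by
      ext (i | i) <;> simp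
    rw [hfe] at hf ⊢
    have := h _ hf
    rw [degree_sumElim]
    push_cast
    omega

/-- Restriction of scalars along `ℚ[β] ⊆ ℚ[ι ⊔ β]`. The grading is unchanged. -/
def restrict {ι β : Type} (M : GrFree (ι ⊕ β)) : GrFree β where
  carrier := M.carrier
  acg := M.acg
  mod := Module.compHom M.carrier (incl ι β)
  piece := M.piece
  free := by
    obtain ⟨J, c, d, h⟩ := M.free
    let _ : Algebra (MvPolynomial β ℚ) (MvPolynomial (ι ⊕ β) ℚ) := (incl ι β).toAlgebra
    let _ : Module (MvPolynomial β ℚ) M.carrier := Module.compHom M.carrier (incl ι β)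
    have : IsScalarTower (MvPolynomial β ℚ) (MvPolynomial (ι ⊕ β) ℚ) M.carrier :=
      ⟨fun r a x => by rw [Algebra.smul_def, mul_smul]; rfl⟩
    let φ : MvPolynomial (ι ⊕ β) ℚ ≃ₗ[MvPolynomial β ℚ] MvPolynomial ι (MvPolynomial β ℚ) :=
      { (MvPolynomial.sumAlgEquiv ℚ ι β).toRingEquiv.toAddEquiv with
        map_smul' := fun r a => by
          have hr : MvPolynomial.sumAlgEquiv ℚ ι β (MvPolynomial.rename Sum.inr r) =
              MvPolynomial.C r := by
            have := AlgHom.congr_fun (MvPolynomial.sumAlgEquiv_comp_rename_inr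
              (R := ℚ) (S₁ := ι) (S₂ := β)) r
            simpa using this
          change MvPolynomial.sumAlgEquiv ℚ ι β (MvPolynomial.rename Sum.inr r * a) =
            r • MvPolynomial.sumAlgEquiv ℚ ι β a
          rw [map_mul, hr, MvPolynomial.smul_eq_C_mul] }
    let b : Module.Basis (ι →₀ ℕ) (MvPolynomial β ℚ) (MvPolynomial (ι ⊕ β) ℚ) :=
      Module.Basis.ofRepr (φ ≪≫ₗ (MvPolynomial.basisMonomials ι (MvPolynomial β ℚ)).repr)
    refine ⟨(ι →₀ ℕ) × J, b.smulTower c, fun aj => 2 * (aj.1.degree : ℤ) + d aj.2, fun k x => ?_⟩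
    rw [h, Prod.forall, forall_comm]
    refine forall_congr' fun j => ?_
    rw [isHomog_iff_coeff]
    refine forall_congr' fun a => ?_
    rw [Module.Basis.smulTower_repr_mk]
    have : k - (2 * (a.degree : ℤ) + d j) = k - d j - 2 * (a.degree : ℤ) := by ring
    dsimp only
    rw [this]
    rfl

end GrFree

/-! ### Graded matrix factorizations and their homotopy category -/

/-- A graded matrix factorization `M⁰ → M¹ → M⁰` of the potential `w` over `ℚ[σ]`: free graded
modules and differentials of degree `n + 1` with `d² = w`. -/
structure GrFact (σ : Type) (n : ℕ) (w : MvPolynomial σ ℚ) : Type 1 where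
  M0 : GrFree σ
  M1 : GrFree σ
  d0 : M0.carrier →ₗ[MvPolynomial σ ℚ] M1.carrier
  d1 : M1.carrier →ₗ[MvPolynomial σ ℚ] M0.carrier
  d0_deg : ∀ k x, x ∈ M0.piece k → d0 x ∈ M1.piece (k + (n + 1))
  d1_deg : ∀ k x, x ∈ M1.piece k → d1 x ∈ M0.piece (k + (n + 1))
  d1_d0 : ∀ x, d1 (d0 x) = w • x
  d0_d1 : ∀ x, d0 (d1 x) = w • x

namespace GrFact
variable {σ : Type} {n : ℕ} {w : MvPolynomial σ ℚ}

/-- Homomorphisms of graded factorizations: pairs of degree `0` maps commuting with `d`. -/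
@[ext]
structure Hom (M N : GrFact σ n w) where
  f0 : M.M0.carrier →ₗ[MvPolynomial σ ℚ] N.M0.carrier
  f1 : M.M1.carrier →ₗ[MvPolynomial σ ℚ] N.M1.carrier
  f0_deg : ∀ k x, x ∈ M.M0.piece k → f0 x ∈ N.M0.piece k
  f1_deg : ∀ k x, x ∈ M.M1.piece k → f1 x ∈ N.M1.piece k
  comm0 : ∀ x, f1 (M.d0 x) = N.d0 (f0 x)
  comm1 : ∀ x, f0 (M.d1 x) = N.d1 (f1 x)

instance : Category (GrFact σ n w) where
  Hom := Hom
  id M := ⟨LinearMap.id, LinearMap.id, fun _ _ h => h, fun _ _ h => h, fun _ => rfl, fun _ => rfl⟩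
  comp f g :=
    { f0 := g.f0 ∘ₗ f.f0
      f1 := g.f1 ∘ₗ f.f1
      f0_deg := fun k x h => g.f0_deg k _ (f.f0_deg k x h)
      f1_deg := fun k x h => g.f1_deg k _ (f.f1_deg k x h)
      comm0 := fun x => by simp [f.comm0, g.comm0]
      comm1 := fun x => by simp [f.comm1, g.comm1] }

/-- `f - g = h d + d h` for a pair of maps `h` of degree `-n-1`. -/
def Homotopic : HomRel (GrFact σ n w) := fun M N f g =>
  ∃ (h0 : M.M0.carrier →ₗ[MvPolynomial σ ℚ] N.M1.carrier)
    (h1 : M.M1.carrier →ₗ[MvPolynomial σ ℚ] N.M0.carrier),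
    (∀ k x, x ∈ M.M0.piece k → h0 x ∈ N.M1.piece (k - n - 1)) ∧
    (∀ k x, x ∈ M.M1.piece k → h1 x ∈ N.M0.piece (k - n - 1)) ∧
    (∀ x, Hom.f0 f x - Hom.f0 g x = h1 (M.d0 x) + N.d1 (h0 x)) ∧
    (∀ x, Hom.f1 f x - Hom.f1 g x = h0 (M.d1 x) + N.d0 (h1 x))

/-- The ideal `(x_i)` of `ℚ[σ]`. -/
def maxIdeal (σ : Type) : Ideal (MvPolynomial σ ℚ) :=
  Ideal.span (Set.range MvPolynomial.X)

/-- `M / 𝔪 M`. -/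
abbrev Red {σ : Type} (M : GrFree σ) : Type :=
  M.carrier ⧸ (maxIdeal σ • ⊤ : Submodule (MvPolynomial σ ℚ) M.carrier)

/-- The map `M / 𝔪 M → N / 𝔪 N` induced by `f : M → N`. -/
def redMap {σ : Type} {M N : GrFree σ} (f : M.carrier →ₗ[MvPolynomial σ ℚ] N.carrier) :
    Red M →ₗ[MvPolynomial σ ℚ] Red N :=
  Submodule.mapQ _ _ f (by
    rw [← Submodule.map_le_iff_le_comap, Submodule.map_smul'']
    exact Submodule.smul_mono le_rfl le_top)

/-- `H⁰(M)`: the cohomology of `M / 𝔪 M` at `M⁰ / 𝔪 M⁰`. -/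
abbrev H0 (M : GrFact σ n w) : Type :=
  LinearMap.ker (redMap M.d0) ⧸
    (LinearMap.range (redMap M.d1)).submoduleOf (LinearMap.ker (redMap M.d0))

/-- `H¹(M)`: the cohomology of `M / 𝔪 M` at `M¹ / 𝔪 M¹`. -/
abbrev H1 (M : GrFact σ n w) : Type :=
  LinearMap.ker (redMap M.d1) ⧸
    (LinearMap.range (redMap M.d0)).submoduleOf (LinearMap.ker (redMap M.d1))

/-- The cohomology `H(M) = H⁰(M) ⊕ H¹(M)` is a finite-dimensional rational vector space. -/
def FinDimCohomology : ObjectProperty (GrFact σ n w) := fun M =>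
  Module.Finite ℚ (RestrictScalars ℚ (MvPolynomial σ ℚ) M.H0) ∧
    Module.Finite ℚ (RestrictScalars ℚ (MvPolynomial σ ℚ) M.H1)

end GrFact

/-- `mf_w`: graded factorizations of `w` with finite-dimensional cohomology. -/
abbrev Mf (σ : Type) (n : ℕ) (w : MvPolynomial σ ℚ) : Type 1 :=
  (GrFact.FinDimCohomology : ObjectProperty (GrFact σ n w)).FullSubcategory

/-- Homotopy of morphisms in `mf_w`. -/
def Mf.Homotopic (σ : Type) (n : ℕ) (w : MvPolynomial σ ℚ) : HomRel (Mf σ n w) :=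
  fun _ _ f g => GrFact.Homotopic f.hom g.hom

/-- `hmf_w`: the quotient of `mf_w` by homotopy. -/
abbrev Hmf (σ : Type) (n : ℕ) (w : MvPolynomial σ ℚ) : Type 1 :=
  CategoryTheory.Quotient (Mf.Homotopic σ n w)

/-- Homotopy is already a congruence, so that the morphisms of `hmf_w` are homotopy classes. -/
instance (σ : Type) (n : ℕ) (w : MvPolynomial σ ℚ) : Congruence (Mf.Homotopic σ n w) where
  equivalence := by
    intro M N
    refine ⟨fun f => ?_, fun {f g} => ?_, fun {f g k} => ?_⟩
    · exact ⟨0, 0, fun _ _ _ => AddSubgroup.zero_mem _, fun _ _ _ => AddSubgroup.zero_mem _,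
        fun x => by simp, fun x => by simp⟩
    · rintro ⟨h0, h1, hd0, hd1, e0, e1⟩
      refine ⟨-h0, -h1, fun k x hx => AddSubgroup.neg_mem _ (hd0 k x hx),
        fun k x hx => AddSubgroup.neg_mem _ (hd1 k x hx), fun x => ?_, fun x => ?_⟩
      · rw [← neg_sub, e0]; simp [add_comm]
      · rw [← neg_sub, e1]; simp [add_comm]
    · rintro ⟨h0, h1, hd0, hd1, e0, e1⟩ ⟨h0', h1', hd0', hd1', e0', e1'⟩
      refine ⟨h0 + h0', h1 + h1', fun k x hx => AddSubgroup.add_mem _ (hd0 k x hx) (hd0' k x hx),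
        fun k x hx => AddSubgroup.add_mem _ (hd1 k x hx) (hd1' k x hx), fun x => ?_, fun x => ?_⟩
      · rw [← sub_add_sub_cancel, e0, e0']; simp only [LinearMap.add_apply, map_add]; abel
      · rw [← sub_add_sub_cancel, e1, e1']; simp only [LinearMap.add_apply, map_add]; abel
  comp_left := by
    rintro M N P f g g' ⟨h0, h1, hd0, hd1, e0, e1⟩
    refine ⟨h0 ∘ₗ GrFact.Hom.f0 f.hom, h1 ∘ₗ GrFact.Hom.f1 f.hom,
      fun k x hx => hd0 k _ (GrFact.Hom.f0_deg f.hom k x hx),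
      fun k x hx => hd1 k _ (GrFact.Hom.f1_deg f.hom k x hx), fun x => ?_, fun x => ?_⟩
    · exact (e0 (GrFact.Hom.f0 f.hom x)).trans (by simp [GrFact.Hom.comm0 f.hom])
    · exact (e1 (GrFact.Hom.f1 f.hom x)).trans (by simp [GrFact.Hom.comm1 f.hom])
  comp_right := by
    rintro M N P f f' g ⟨h0, h1, hd0, hd1, e0, e1⟩
    refine ⟨GrFact.Hom.f1 g.hom ∘ₗ h0, GrFact.Hom.f0 g.hom ∘ₗ h1,
      fun k x hx => GrFact.Hom.f1_deg g.hom _ _ (hd0 k x hx),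
      fun k x hx => GrFact.Hom.f0_deg g.hom _ _ (hd1 k x hx), fun x => ?_, fun x => ?_⟩
    · exact (map_sub (GrFact.Hom.f0 g.hom) _ _).symm.trans
        (by rw [e0]; simp [GrFact.Hom.comm1 g.hom])
    · exact (map_sub (GrFact.Hom.f1 g.hom) _ _).symm.trans
        (by rw [e1]; simp [GrFact.Hom.comm0 g.hom])

/-- A factorization with finite-dimensional cohomology, as an object of `hmf_w`. -/
def Hmf.of {σ : Type} {n : ℕ} {w : MvPolynomial σ ℚ} (M : GrFact σ n w)
    (h : GrFact.FinDimCohomology M) : Hmf σ n w :=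
  (Quotient.functor (Mf.Homotopic σ n w)).obj ⟨M, h⟩

/-! ### Operations on factorizations -/

namespace GrFact
variable {σ : Type} {n : ℕ} {w v : MvPolynomial σ ℚ}

/-- Rewriting the potential along an equality. -/
def ofEq (M : GrFact σ n w) (h : w = v) : GrFact σ n v where
  M0 := M.M0
  M1 := M.M1
  d0 := M.d0
  d1 := M.d1
  d0_deg := M.d0_deg
  d1_deg := M.d1_deg
  d1_d0 := fun x => (M.d1_d0 x).trans (congrArg (· • x) h)
  d0_d1 := fun x => (M.d0_d1 x).trans (congrArg (· • x) h)

/-- The grading shift `M{s}`. -/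
def shift (M : GrFact σ n w) (s : ℤ) : GrFact σ n w where
  M0 := M.M0.shift s
  M1 := M.M1.shift s
  d0 := M.d0
  d1 := M.d1
  d0_deg := fun k x hx => by
    have := M.d0_deg (k - s) x hx
    rwa [show k - s + ((n : ℤ) + 1) = k + (n + 1) - s by ring] at this
  d1_deg := fun k x hx => by
    have := M.d1_deg (k - s) x hx
    rwa [show k - s + ((n : ℤ) + 1) = k + (n + 1) - s by ring] at this
  d1_d0 := M.d1_d0
  d0_d1 := M.d0_d1

/-- The cohomological shift `M⟨1⟩`. -/
def susp (M : GrFact σ n w) : GrFact σ n w where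
  M0 := M.M1
  M1 := M.M0
  d0 := -M.d1
  d1 := -M.d0
  d0_deg := fun k x hx => AddSubgroup.neg_mem _ (M.d1_deg k x hx)
  d1_deg := fun k x hx => AddSubgroup.neg_mem _ (M.d0_deg k x hx)
  d1_d0 := fun x => by simp [M.d0_d1]
  d0_d1 := fun x => by simp [M.d1_d0]

/-- The direct sum `M ⊕ N`. -/
def prod (M N : GrFact σ n w) : GrFact σ n w where
  M0 := M.M0.prod N.M0
  M1 := M.M1.prod N.M1
  d0 := M.d0.prodMap N.d0
  d1 := M.d1.prodMap N.d1
  d0_deg := fun k _ hx => ⟨M.d0_deg k _ hx.1, N.d0_deg k _ hx.2⟩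
  d1_deg := fun k _ hx => ⟨M.d1_deg k _ hx.1, N.d1_deg k _ hx.2⟩
  d1_d0 := fun _ => Prod.ext (M.d1_d0 _) (N.d1_d0 _)
  d0_d1 := fun _ => Prod.ext (M.d0_d1 _) (N.d0_d1 _)

/-- The direct sum of a finite family of factorizations; the zero factorization if `m = 0`. -/
def pi {m : ℕ} (M : Fin m → GrFact σ n w) : GrFact σ n w where
  M0 := GrFree.pi fun i => (M i).M0
  M1 := GrFree.pi fun i => (M i).M1
  d0 := LinearMap.pi fun i => (M i).d0 ∘ₗ LinearMap.proj i
  d1 := LinearMap.pi fun i => (M i).d1 ∘ₗ LinearMap.proj i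
  d0_deg := fun k _ hx i _ => (M i).d0_deg k _ (hx i trivial)
  d1_deg := fun k _ hx i _ => (M i).d1_deg k _ (hx i trivial)
  d1_d0 := fun _ => funext fun i => (M i).d1_d0 _
  d0_d1 := fun _ => funext fun i => (M i).d0_d1 _

/-- The factorization `R → 0 → R` of the potential `0`. -/
def unit (σ : Type) (n : ℕ) : GrFact σ n 0 where
  M0 := GrFree.base σ 0
  M1 := GrFree.zero σ
  d0 := 0
  d1 := 0
  d0_deg := fun _ _ _ => AddSubgroup.zero_mem _
  d1_deg := fun _ _ _ => AddSubgroup.zero_mem _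
  d1_d0 := fun x => by simp
  d0_d1 := fun x => by simp

/-- The factorization `{a, b}`, that is `R --a--> R{n + 1 - deg a} --b--> R`, for homogeneous
`a`, `b` with `deg a = p` and `deg a + deg b = 2(n + 1)`. -/
def koszul (n : ℕ) (a b : MvPolynomial σ ℚ) (p : ℤ) (ha : IsHomog a p)
    (hb : IsHomog b (2 * (n + 1) - p)) : GrFact σ n (a * b) where
  M0 := GrFree.base σ 0
  M1 := GrFree.base σ (n + 1 - p)
  d0 := LinearMap.mulLeft (MvPolynomial σ ℚ) a
  d1 := LinearMap.mulLeft (MvPolynomial σ ℚ) b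
  d0_deg := fun _ _ hx => (ha.mul hx).cast (by ring)
  d1_deg := fun _ _ hx => (hb.mul hx).cast (by ring)
  d1_d0 := fun (x : MvPolynomial σ ℚ) => show b * (a * x) = (a * b) * x by ring
  d0_d1 := fun (x : MvPolynomial σ ℚ) => show a * (b * x) = (a * b) * x by ring

/-- `x ⊗ y ↦ x ⊗ f y`. -/
def lmap (P : GrFree σ) {M N : GrFree σ} (f : M.carrier →ₗ[MvPolynomial σ ℚ] N.carrier) :
    (P.tensor M).carrier →ₗ[MvPolynomial σ ℚ] (P.tensor N).carrier :=
  LinearMap.lTensor P.carrier f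

/-- `x ⊗ y ↦ f x ⊗ y`. -/
def rmap (P : GrFree σ) {M N : GrFree σ} (f : M.carrier →ₗ[MvPolynomial σ ℚ] N.carrier) :
    (M.tensor P).carrier →ₗ[MvPolynomial σ ℚ] (N.tensor P).carrier :=
  LinearMap.rTensor P.carrier f

theorem lmap_deg (P : GrFree σ) {M N : GrFree σ}
    (f : M.carrier →ₗ[MvPolynomial σ ℚ] N.carrier) (e : ℤ)
    (hf : ∀ k x, x ∈ M.piece k → f x ∈ N.piece (k + e)) (k : ℤ) (x : (P.tensor M).carrier)
    (hx : x ∈ (P.tensor M).piece k) : lmap P f x ∈ (P.tensor N).piece (k + e) := by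
  refine AddSubgroup.closure_induction (p := fun x _ => lmap P f x ∈ (P.tensor N).piece (k + e))
    ?_ ?_ ?_ ?_ hx
  · rintro _ ⟨i, j, x, y, hk, hx, hy, rfl⟩
    exact AddSubgroup.subset_closure ⟨i, j + e, x, f y, by omega, hx, hf _ _ hy, rfl⟩
  · rw [map_zero]; exact AddSubgroup.zero_mem _
  · intro x y _ _ hx hy; rw [map_add]; exact AddSubgroup.add_mem _ hx hy
  · intro x _ hx; rw [map_neg]; exact AddSubgroup.neg_mem _ hx

theorem rmap_deg (P : GrFree σ) {M N : GrFree σ}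
    (f : M.carrier →ₗ[MvPolynomial σ ℚ] N.carrier) (e : ℤ)
    (hf : ∀ k x, x ∈ M.piece k → f x ∈ N.piece (k + e)) (k : ℤ) (x : (M.tensor P).carrier)
    (hx : x ∈ (M.tensor P).piece k) : rmap P f x ∈ (N.tensor P).piece (k + e) := by
  refine AddSubgroup.closure_induction (p := fun x _ => rmap P f x ∈ (N.tensor P).piece (k + e))
    ?_ ?_ ?_ ?_ hx
  · rintro _ ⟨i, j, x, y, hk, hx, hy, rfl⟩
    exact AddSubgroup.subset_closure ⟨i + e, j, f x, y, by omega, hf _ _ hx, hy, rfl⟩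
  · rw [map_zero]; exact AddSubgroup.zero_mem _
  · intro x y _ _ hx hy; rw [map_add]; exact AddSubgroup.add_mem _ hx hy
  · intro x _ hx; rw [map_neg]; exact AddSubgroup.neg_mem _ hx

theorem lmap_lmap (P : GrFree σ) {M N : GrFree σ}
    (f : M.carrier →ₗ[MvPolynomial σ ℚ] N.carrier) (g : N.carrier →ₗ[MvPolynomial σ ℚ] M.carrier)
    (h : ∀ x, g (f x) = w • x) (x : (P.tensor M).carrier) : lmap P g (lmap P f x) = w • x := by
  have : g ∘ₗ f = w • LinearMap.id := LinearMap.ext h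
  have e : LinearMap.lTensor P.carrier g ∘ₗ LinearMap.lTensor P.carrier f = w • LinearMap.id := by
    rw [← LinearMap.lTensor_comp, this, LinearMap.lTensor_smul, LinearMap.lTensor_id]
  exact LinearMap.congr_fun e x

theorem rmap_rmap (P : GrFree σ) {M N : GrFree σ}
    (f : M.carrier →ₗ[MvPolynomial σ ℚ] N.carrier) (g : N.carrier →ₗ[MvPolynomial σ ℚ] M.carrier)
    (h : ∀ x, g (f x) = w • x) (x : (M.tensor P).carrier) : rmap P g (rmap P f x) = w • x := by
  have : g ∘ₗ f = w • LinearMap.id := LinearMap.ext h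
  have e : LinearMap.rTensor P.carrier g ∘ₗ LinearMap.rTensor P.carrier f = w • LinearMap.id := by
    rw [← LinearMap.rTensor_comp, this, LinearMap.rTensor_smul, LinearMap.rTensor_id]
  exact LinearMap.congr_fun e x

theorem lmap_rmap {M N P Q : GrFree σ} (f : M.carrier →ₗ[MvPolynomial σ ℚ] N.carrier)
    (g : P.carrier →ₗ[MvPolynomial σ ℚ] Q.carrier) (x : (M.tensor P).carrier) :
    lmap N g (rmap P f x) = rmap Q f (lmap M g x) := by
  have e : LinearMap.lTensor N.carrier g ∘ₗ LinearMap.rTensor P.carrier f =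
      LinearMap.rTensor Q.carrier f ∘ₗ LinearMap.lTensor M.carrier g := by
    rw [LinearMap.lTensor_comp_rTensor, LinearMap.rTensor_comp_lTensor]
  exact LinearMap.congr_fun e x

/-- The tensor product over `R`:
`(M ⊗ N)⁰ = M⁰ ⊗ N⁰ ⊕ M¹ ⊗ N¹`, `(M ⊗ N)¹ = M⁰ ⊗ N¹ ⊕ M¹ ⊗ N⁰`, and
`d(x ⊗ y) = dx ⊗ y + (-1)^i x ⊗ dy` for `x ∈ Mⁱ`. -/
def tensor (M : GrFact σ n w) (N : GrFact σ n v) : GrFact σ n (w + v) where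
  M0 := (M.M0.tensor N.M0).prod (M.M1.tensor N.M1)
  M1 := (M.M0.tensor N.M1).prod (M.M1.tensor N.M0)
  d0 := LinearMap.prod (LinearMap.coprod (lmap M.M0 N.d0) (rmap N.M1 M.d1))
    (LinearMap.coprod (rmap N.M0 M.d0) (-lmap M.M1 N.d1))
  d1 := LinearMap.prod (LinearMap.coprod (lmap M.M0 N.d1) (rmap N.M0 M.d1))
    (LinearMap.coprod (rmap N.M1 M.d0) (-lmap M.M1 N.d0))
  d0_deg := fun k x hx =>
    ⟨AddSubgroup.add_mem _ (lmap_deg _ _ _ N.d0_deg k _ hx.1) (rmap_deg _ _ _ M.d1_deg k _ hx.2),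
      AddSubgroup.add_mem _ (rmap_deg _ _ _ M.d0_deg k _ hx.1)
        (AddSubgroup.neg_mem _ (lmap_deg _ _ _ N.d1_deg k _ hx.2))⟩
  d1_deg := fun k x hx =>
    ⟨AddSubgroup.add_mem _ (lmap_deg _ _ _ N.d1_deg k _ hx.1) (rmap_deg _ _ _ M.d1_deg k _ hx.2),
      AddSubgroup.add_mem _ (rmap_deg _ _ _ M.d0_deg k _ hx.1)
        (AddSubgroup.neg_mem _ (lmap_deg _ _ _ N.d0_deg k _ hx.2))⟩
  d1_d0 := fun (x : (M.M0.tensor N.M0).carrier × (M.M1.tensor N.M1).carrier) => by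
    refine Prod.ext
      (?_ : lmap M.M0 N.d1 (lmap M.M0 N.d0 x.1 + rmap N.M1 M.d1 x.2) +
        rmap N.M0 M.d1 (rmap N.M0 M.d0 x.1 + -lmap M.M1 N.d1 x.2) = (w + v) • x.1)
      (?_ : rmap N.M1 M.d0 (lmap M.M0 N.d0 x.1 + rmap N.M1 M.d1 x.2) +
        -lmap M.M1 N.d0 (rmap N.M0 M.d0 x.1 + -lmap M.M1 N.d1 x.2) = (w + v) • x.2)
    · simp only [map_add, map_neg, lmap_rmap, lmap_lmap _ _ _ N.d1_d0, rmap_rmap _ _ _ M.d1_d0,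
        add_smul]
      abel
    · simp only [map_add, map_neg, lmap_rmap, lmap_lmap _ _ _ N.d0_d1, rmap_rmap _ _ _ M.d0_d1,
        add_smul]
      abel
  d0_d1 := fun (x : (M.M0.tensor N.M1).carrier × (M.M1.tensor N.M0).carrier) => by
    refine Prod.ext
      (?_ : lmap M.M0 N.d0 (lmap M.M0 N.d1 x.1 + rmap N.M0 M.d1 x.2) +
        rmap N.M1 M.d1 (rmap N.M1 M.d0 x.1 + -lmap M.M1 N.d0 x.2) = (w + v) • x.1)
      (?_ : rmap N.M0 M.d0 (lmap M.M0 N.d1 x.1 + rmap N.M0 M.d1 x.2) +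
        -lmap M.M1 N.d1 (rmap N.M1 M.d0 x.1 + -lmap M.M1 N.d0 x.2) = (w + v) • x.2)
    · simp only [map_add, map_neg, lmap_rmap, lmap_lmap _ _ _ N.d0_d1, rmap_rmap _ _ _ M.d1_d0,
        add_smul]
      abel
    · simp only [map_add, map_neg, lmap_rmap, lmap_lmap _ _ _ N.d1_d0, rmap_rmap _ _ _ M.d0_d1,
        add_smul]
      abel

/-- Restriction of scalars to `ℚ[β] ⊆ ℚ[ι ⊔ β]`, for a potential that lies in `ℚ[β]`. -/
def restrict {ι β : Type} {w' : MvPolynomial β ℚ}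
    (M : GrFact (ι ⊕ β) n (GrFree.incl ι β w')) : GrFact β n w' where
  M0 := M.M0.restrict
  M1 := M.M1.restrict
  d0 :=
    { toFun := M.d0
      map_add' := M.d0.map_add
      map_smul' := fun r x => M.d0.map_smul (GrFree.incl ι β r) x }
  d1 :=
    { toFun := M.d1
      map_add' := M.d1.map_add
      map_smul' := fun r x => M.d1.map_smul (GrFree.incl ι β r) x }
  d0_deg := M.d0_deg
  d1_deg := M.d1_deg
  d1_d0 := M.d1_d0
  d0_d1 := M.d0_d1

end GrFact

/-! ### The polynomials `g`, `u₁`, `u₂`, `π` -/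

section Polynomials
variable {A : Type*} [CommRing A]

/-- `gPoly s t m` is the polynomial in `s`, `t` with `gPoly (x + y) (x y) m = x ^ m + y ^ m`. -/
def gPoly (s t : A) : ℕ → A
  | 0 => 2
  | 1 => s
  | m + 2 => s * gPoly s t (m + 1) - t * gPoly s t m

theorem gPoly_add_mul (x y : A) (m : ℕ) : gPoly (x + y) (x * y) m = x ^ m + y ^ m := by
  induction m using Nat.twoStepInduction with
  | zero => simp [gPoly]; norm_num
  | one => simp [gPoly]
  | more m h0 h1 => rw [gPoly, h0, h1]; ring

/-- The polynomial quotient `(gPoly a t m - gPoly b t m) / (a - b)`. -/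
def gDivFst (a b t : A) : ℕ → A
  | 0 => 0
  | 1 => 1
  | m + 2 => gPoly a t (m + 1) + b * gDivFst a b t (m + 1) - t * gDivFst a b t m

theorem gDivFst_mul (a b t : A) (m : ℕ) : gDivFst a b t m * (a - b) = gPoly a t m - gPoly b t m := by
  induction m using Nat.twoStepInduction with
  | zero => simp [gPoly, gDivFst]
  | one => simp [gPoly, gDivFst]
  | more m h0 h1 =>
    rw [gDivFst, gPoly, gPoly]
    linear_combination b * h1 - t * h0

/-- The polynomial quotient `(gPoly b t m - gPoly b t' m) / (t - t')`. -/
def gDivSnd (b t t' : A) : ℕ → A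
  | 0 => 0
  | 1 => 0
  | m + 2 => b * gDivSnd b t t' (m + 1) - gPoly b t m - t' * gDivSnd b t t' m

theorem gDivSnd_mul (b t t' : A) (m : ℕ) :
    gDivSnd b t t' m * (t - t') = gPoly b t m - gPoly b t' m := by
  induction m using Nat.twoStepInduction with
  | zero => simp [gPoly, gDivSnd]
  | one => simp [gPoly, gDivSnd]
  | more m h0 h1 =>
    rw [gDivSnd, gPoly, gPoly]
    linear_combination b * h1 - t' * h0

/-- `u₁ = (g(x₁+x₂, x₁x₂) - g(x₃+x₄, x₁x₂)) / (x₁+x₂-x₃-x₄)`, where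
`g(x+y, xy) = x^(n+1) + y^(n+1)`. -/
def u₁ (n : ℕ) (x₁ x₂ x₃ x₄ : A) : A := gDivFst (x₁ + x₂) (x₃ + x₄) (x₁ * x₂) (n + 1)

/-- `u₂ = (g(x₃+x₄, x₁x₂) - g(x₃+x₄, x₃x₄)) / (x₁x₂-x₃x₄)`. -/
def u₂ (n : ℕ) (x₁ x₂ x₃ x₄ : A) : A := gDivSnd (x₃ + x₄) (x₁ * x₂) (x₃ * x₄) (n + 1)

theorem u_spec (n : ℕ) (x₁ x₂ x₃ x₄ : A) :
    u₁ n x₁ x₂ x₃ x₄ * (x₁ + x₂ - x₃ - x₄) + u₂ n x₁ x₂ x₃ x₄ * (x₁ * x₂ - x₃ * x₄) =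
      x₁ ^ (n + 1) + x₂ ^ (n + 1) - x₃ ^ (n + 1) - x₄ ^ (n + 1) := by
  have h1 := gDivFst_mul (x₁ + x₂) (x₃ + x₄) (x₁ * x₂) (n + 1)
  have h2 := gDivSnd_mul (x₃ + x₄) (x₁ * x₂) (x₃ * x₄) (n + 1)
  rw [gPoly_add_mul] at h1 h2
  rw [u₁, u₂]
  linear_combination h1 + h2

/-- `π = (x^(n+1) - y^(n+1)) / (x - y)`. -/
def arcPoly (n : ℕ) (x y : A) : A := ∑ k ∈ Finset.range (n + 1), x ^ k * y ^ (n - k)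

theorem arcPoly_mul (n : ℕ) (x y : A) : arcPoly n x y * (x - y) = x ^ (n + 1) - y ^ (n + 1) :=
  geom_sum₂_mul x y (n + 1)

end Polynomials

section Degrees
variable {σ : Type}

theorem isHomog_gPoly {s t : MvPolynomial σ ℚ} (hs : IsHomog s 2) (ht : IsHomog t 4) (m : ℕ) :
    IsHomog (gPoly s t m) (2 * m) := by
  induction m using Nat.twoStepInduction with
  | zero =>
    have h : IsHomog (1 + 1 : MvPolynomial σ ℚ) 0 := IsHomog.one.add IsHomog.one
    rw [one_add_one_eq_two] at h
    exact h
  | one => exact hs.cast (by simp)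
  | more m h0 h1 =>
    exact ((hs.mul h1).cast (by push_cast; ring)).sub ((ht.mul h0).cast (by push_cast; ring))

theorem isHomog_gDivFst {a b t : MvPolynomial σ ℚ} (ha : IsHomog a 2) (hb : IsHomog b 2)
    (ht : IsHomog t 4) (m : ℕ) : IsHomog (gDivFst a b t m) (2 * m - 2) := by
  induction m using Nat.twoStepInduction with
  | zero => exact IsHomog.zero _
  | one => exact IsHomog.one.cast (by simp)
  | more m h0 h1 =>
    exact (((isHomog_gPoly ha ht (m + 1)).cast (by push_cast; ring)).add
      ((hb.mul h1).cast (by push_cast; ring))).sub ((ht.mul h0).cast (by push_cast; ring))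

theorem isHomog_gDivSnd {b t t' : MvPolynomial σ ℚ} (hb : IsHomog b 2)
    (ht : IsHomog t 4) (ht' : IsHomog t' 4) (m : ℕ) :
    IsHomog (gDivSnd b t t' m) (2 * m - 4) := by
  induction m using Nat.twoStepInduction with
  | zero => exact IsHomog.zero _
  | one => exact IsHomog.zero _
  | more m h0 h1 =>
    exact (((hb.mul h1).cast (by push_cast; ring)).sub
      ((isHomog_gPoly hb ht m).cast (by push_cast; ring))).sub
        ((ht'.mul h0).cast (by push_cast; ring))

theorem isHomog_arcPoly (n : ℕ) {x y : MvPolynomial σ ℚ} (hx : IsHomog x 2) (hy : IsHomog y 2) :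
    IsHomog (arcPoly n x y) (2 * n) := by
  refine IsHomog.sum _ _ fun k hk => ((hx.pow k).mul (hy.pow (n - k))).cast ?_
  have : k ≤ n := Nat.lt_succ_iff.1 (Finset.mem_range.1 hk)
  push_cast [this]
  ring

end Degrees

/-! ### Marked graphs and their factorizations -/

/-- The pieces into which the marks cut a graph: wide edges and arcs of oriented edges. -/
inductive GraphPiece (μ : Type) : Type
  /-- A wide edge; the oriented edges at one end leave it, towards the marks `i`, `j`, and those
  at the other end enter it, from the marks `k`, `l`. -/
  | wide (i j k l : μ)
  /-- An arc oriented from the mark `j` to the mark `i`. -/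
  | arc (i j : μ)

namespace GraphPiece
variable {μ : Type}

/-- The marks towards which the piece is oriented. -/
def heads : GraphPiece μ → Multiset μ
  | wide i j _ _ => {i, j}
  | arc i _ => {i}

/-- The marks from which the piece is oriented. -/
def tails : GraphPiece μ → Multiset μ
  | wide _ _ k l => {k, l}
  | arc _ j => {j}

/-- The sum of `x_i ^ (n+1)` over the heads minus the same sum over the tails. -/
def potential (n : ℕ) (P : GraphPiece μ) : MvPolynomial μ ℚ :=
  (P.heads.map fun i => MvPolynomial.X i ^ (n + 1)).sum -
    (P.tails.map fun i => MvPolynomial.X i ^ (n + 1)).sum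

open MvPolynomial in
/-- The factorization `C_t` of a wide edge `t`, the Koszul factorization
`{(u₁, u₂), (x_i + x_j - x_k - x_l, x_i x_j - x_k x_l)}{-1}`. -/
def wideFact (n : ℕ) (i j k l : μ) : GrFact μ n ((wide i j k l).potential n) :=
  (((GrFact.koszul n (u₁ n (X i) (X j) (X k) (X l)) (X i + X j - X k - X l) (2 * n)
        ((isHomog_gDivFst ((IsHomog.X i).add (IsHomog.X j)) ((IsHomog.X k).add (IsHomog.X l))
          ((IsHomog.X i).mul (IsHomog.X j)) (n + 1)).cast (by push_cast; ring))
        (((((IsHomog.X i).add (IsHomog.X j)).sub (IsHomog.X k)).sub (IsHomog.X l)).cast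
          (by ring))).tensor
      (GrFact.koszul n (u₂ n (X i) (X j) (X k) (X l)) (X i * X j - X k * X l) (2 * n - 2)
        ((isHomog_gDivSnd ((IsHomog.X k).add (IsHomog.X l))
          ((IsHomog.X i).mul (IsHomog.X j)) ((IsHomog.X k).mul (IsHomog.X l)) (n + 1)).cast
          (by push_cast; ring))
        ((((IsHomog.X i).mul (IsHomog.X j)).sub ((IsHomog.X k).mul (IsHomog.X l))).cast
          (by ring)))).shift (-1)).ofEq (by
    rw [u_spec]
    simp only [potential, heads, tails, Multiset.insert_eq_cons, Multiset.map_cons,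
      Multiset.map_singleton, Multiset.sum_cons, Multiset.sum_singleton]
    ring)

open MvPolynomial in
/-- The factorization `L^i_j = {π_ij, x_i - x_j}` of an arc. -/
def arcFact (n : ℕ) (i j : μ) : GrFact μ n ((arc i j).potential n) :=
  (GrFact.koszul n (arcPoly n (X i) (X j)) (X i - X j) (2 * n)
    (isHomog_arcPoly n (IsHomog.X i) (IsHomog.X j))
    (((IsHomog.X i).sub (IsHomog.X j)).cast (by ring))).ofEq (by
    rw [arcPoly_mul]
    simp only [potential, heads, tails, Multiset.map_singleton, Multiset.sum_singleton])

/-- The factorization of a piece. -/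
def fact (n : ℕ) : (P : GraphPiece μ) → GrFact μ n (P.potential n)
  | wide i j k l => wideFact n i j k l
  | arc i j => arcFact n i j

end GraphPiece

/-- The combinatorial data of a marked graph without markless loops, with internal marks `ι` and
boundary points `β`: its pieces, where at each internal mark exactly one piece
comes in and exactly one goes out, and each boundary point is an end of exactly one piece.
(The factorization depends on nothing else, in particular not on the embedding in the disk.) -/
structure MarkedGraph (ι β : Type) [DecidableEq ι] [DecidableEq β] where
  pieces : List (GraphPiece (ι ⊕ β))
  internal : ∀ i : ι, (pieces.map GraphPiece.heads).sum.count (Sum.inl i) = 1 ∧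
    (pieces.map GraphPiece.tails).sum.count (Sum.inl i) = 1
  boundary : ∀ b : β, (pieces.map GraphPiece.heads).sum.count (Sum.inr b) +
    (pieces.map GraphPiece.tails).sum.count (Sum.inr b) = 1

namespace MarkedGraph
variable {ι β : Type} [DecidableEq ι] [DecidableEq β]

/-- `1` if the edge at the boundary point `b` is oriented outward, so that `b` is a head, and
`-1` if it is oriented inward. -/
def sign (Γ : MarkedGraph ι β) (b : β) : ℤ :=
  (Γ.pieces.map GraphPiece.heads).sum.count (Sum.inr b) -
    (Γ.pieces.map GraphPiece.tails).sum.count (Sum.inr b)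

/-- The potential `w(Γ) = ∑ s(b) x_b ^ (n+1)`, the sum over all boundary points `b`. -/
def potential [Fintype β] (n : ℕ) (Γ : MarkedGraph ι β) : MvPolynomial β ℚ :=
  ∑ b, Γ.sign b • MvPolynomial.X b ^ (n + 1)

theorem sum_potential [Fintype ι] [Fintype β] (n : ℕ) (Γ : MarkedGraph ι β) :
    (Γ.pieces.map (GraphPiece.potential n)).sum = GrFree.incl ι β (Γ.potential n) := by
  have h1 : ∀ l : List (GraphPiece (ι ⊕ β)), (l.map (GraphPiece.potential n)).sum =
      (((l.map GraphPiece.heads).sum).map fun i => MvPolynomial.X i ^ (n + 1)).sum -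
        (((l.map GraphPiece.tails).sum).map fun i => MvPolynomial.X i ^ (n + 1)).sum := by
    intro l
    induction l with
    | nil => simp
    | cons P l ih =>
      simp only [List.map_cons, List.sum_cons, Multiset.map_add, Multiset.sum_add, ih]
      rw [GraphPiece.potential]
      ring
  have h2 : ∀ m : Multiset (ι ⊕ β),
      (m.map fun i => (MvPolynomial.X i : MvPolynomial (ι ⊕ β) ℚ) ^ (n + 1)).sum =
        ∑ i, m.count i • (MvPolynomial.X i : MvPolynomial (ι ⊕ β) ℚ) ^ (n + 1) := by
    intro m
    rw [Finset.sum_multiset_map_count]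
    refine Finset.sum_subset (Finset.subset_univ _) fun i _ hi => ?_
    rw [Multiset.count_eq_zero_of_notMem fun h => hi (Multiset.mem_toFinset.2 h), zero_smul]
  rw [h1, h2, h2, Fintype.sum_sum_type, Fintype.sum_sum_type, potential, map_sum]
  simp only [(Γ.internal _).1, (Γ.internal _).2]
  rw [add_sub_add_left_eq_sub, ← Finset.sum_sub_distrib]
  refine Finset.sum_congr rfl fun b _ => ?_
  rw [sign, map_zsmul, map_pow]
  have : GrFree.incl ι β (MvPolynomial.X b) = MvPolynomial.X (Sum.inr b) :=
    MvPolynomial.rename_X _ _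
  rw [this, sub_smul, natCast_zsmul, natCast_zsmul]

/-- The tensor product over `R` of two factorizations with arbitrary potentials. -/
def tensorPair {σ : Type} {n : ℕ} (M N : Σ w, GrFact σ n w) : Σ w, GrFact σ n w :=
  ⟨M.1 + N.1, M.2.tensor N.2⟩

/-- The tensor product over `R` of a list of factorizations. -/
def tensorAll {σ : Type} {n : ℕ} : List (Σ w, GrFact σ n w) → Σ w, GrFact σ n w
  | [] => ⟨0, GrFact.unit σ n⟩
  | M :: l => l.foldl tensorPair M

theorem tensorAll_fst {σ : Type} {n : ℕ} (l : List (Σ w, GrFact σ n w)) :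
    (tensorAll l).1 = (l.map Sigma.fst).sum := by
  cases l with
  | nil => rfl
  | cons M l =>
    have h : ∀ M : Σ w, GrFact σ n w,
        (l.foldl tensorPair M).1 = M.1 + (l.map Sigma.fst).sum := by
      induction l with
      | nil => intro M; simp
      | cons N l ih =>
        intro M
        rw [List.foldl_cons, ih, List.map_cons, List.sum_cons, ← add_assoc]
        rfl
    rw [List.map_cons, List.sum_cons]
    exact h M

/-- The graded factorization `C(Γ)` over `ℚ[β]` with potential `w(Γ)`: the tensor product, over
the polynomial ring in all marks, of the factorizations of the pieces, viewed over the polynomial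
ring in the boundary points. -/
def C [Fintype ι] [Fintype β] (n : ℕ) (Γ : MarkedGraph ι β) : GrFact β n (Γ.potential n) :=
  ((tensorAll (Γ.pieces.map fun P => ⟨P.potential n, P.fact n⟩)).2.ofEq (by
    rw [tensorAll_fst, List.map_map, ← sum_potential]
    rfl)).restrict

end MarkedGraph

/-! ### The square -/

/-- The graph `Γ` of the square: the boundary points `1, 2, 3, 4` are `inr 0, inr 1, inr 2, inr 3`
and the internal marks `5, 6` are `inl 0, inl 1`. One wide edge is bounded by the marks
`1, 5` (out) and `6, 4` (in), the other one by `3, 6` (out) and `5, 2` (in). -/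
def squareGraph : MarkedGraph (Fin 2) (Fin 4) where
  pieces := [.wide (.inr 0) (.inl 0) (.inl 1) (.inr 3), .wide (.inr 2) (.inl 1) (.inl 0) (.inr 1)]
  internal := by decide
  boundary := by decide

/-- The graph `Γ₁`: an arc from `4` to `1` and an arc from `2` to `3`. -/
def arcsGraph₁ : MarkedGraph (Fin 0) (Fin 4) where
  pieces := [.arc (.inr 0) (.inr 3), .arc (.inr 2) (.inr 1)]
  internal := by decide
  boundary := by decide

/-- The graph `Γ₂`: an arc from `2` to `1` and an arc from `4` to `3`. -/
def arcsGraph₂ : MarkedGraph (Fin 0) (Fin 4) where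
  pieces := [.arc (.inr 0) (.inr 1), .arc (.inr 2) (.inr 3)]
  internal := by decide
  boundary := by decide

open MvPolynomial in
/-- `w = x₁^(n+1) - x₂^(n+1) + x₃^(n+1) - x₄^(n+1)`. -/
def squareW (n : ℕ) : MvPolynomial (Fin 4) ℚ :=
  X 0 ^ (n + 1) - X 1 ^ (n + 1) + X 2 ^ (n + 1) - X 3 ^ (n + 1)

theorem potential_eq {ι : Type} [DecidableEq ι] (n : ℕ) (Γ : MarkedGraph ι (Fin 4))
    (h0 : Γ.sign 0 = 1) (h1 : Γ.sign 1 = -1) (h2 : Γ.sign 2 = 1) (h3 : Γ.sign 3 = -1) :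
    Γ.potential n = squareW n := by
  rw [MarkedGraph.potential, Fin.sum_univ_four, h0, h1, h2, h3, squareW]
  simp only [one_smul, neg_smul]
  ring

/-- `C(Γ)` as a factorization of `w`. -/
def CΓ (n : ℕ) : GrFact (Fin 4) n (squareW n) :=
  (squareGraph.C n).ofEq (potential_eq n _ (by decide) (by decide) (by decide) (by decide))

/-- `C(Γ₁)` as a factorization of `w`. -/
def CΓ₁ (n : ℕ) : GrFact (Fin 4) n (squareW n) :=
  (arcsGraph₁.C n).ofEq (potential_eq n _ (by decide) (by decide) (by decide) (by decide))

/-- `C(Γ₂)` as a factorization of `w`. -/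
def CΓ₂ (n : ℕ) : GrFact (Fin 4) n (squareW n) :=
  (arcsGraph₂.C n).ofEq (potential_eq n _ (by decide) (by decide) (by decide) (by decide))

end MatFact

end

open MatFact

/-! The decomposition is read off from quotient rings. Let `N` be a factorization and `{a, b}` one
more Koszul row, with `b` acting injectively on `N`. For maps out of free factorizations, `N ⊗ {a,
b}` may then be replaced by `N / bN` (`Pre.extProj_lifts`): a chain map to `N / bN` lifts linearly
to `N`, the lift commutes with `d` up to a multiple of `b`, and the quotient by `b` is the missing
component. Reading a row backwards kills `a` instead and changes the parity.

Killing one entry of each row along a regular sequence leaves a cyclic module `R/I` in one parity.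
The outcome is `GrFact.IsResolution`: suitable maps to `R/I` lift to chain maps, and a chain map
that becomes zero in `R/I` is null-homotopic. Two factorizations that resolve the same graded module
are homotopy equivalent (`GrFact.IsResolution.exists_equiv`), so an isomorphism of graded modules
over `ℚ[x₁, x₂, x₃, x₄]` remains to be found.

For `Γ` the entries killed are the two linear ones, the `u₂` of the second wide edge and the
quadratic entry of the first. The linear relations give `x₂ = x₁ + x₃ - x₄`, `x₅ = x₄ + t`, `x₆ = x₁
+ t`. The quadratic entry becomes `y t` with `y = x₁ - x₄`, and `u₂` becomes a polynomial `U(t)` of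
degree `n - 1` with leading coefficient `-(n + 1)`. With `B` the polynomials modulo the relation for
`x₂`, `B[t]/(U)` is free on `1, t, ..., t^(n-2)`, and (`remPoly_mem_span_iff`) `B[t]/(U, y t) = B/(y
U(0)) ⊕ ⨁ B/(y) t^(i+1)`, for `0 ≤ i ≤ n - 3`. Here `B/(y)` is the module of `Γ₁`, where `x₁ = x₄`
and `x₂ = x₃`. It sits in even parity, whence the `⟨1⟩`. After a row operation `Γ₂` gives `B/(π₃₄ -
π₁₂)`, and `π₃₄ - π₁₂ = y U(0)` in `B` (`substSum_arcPoly_sub`). The degrees agree: `Γ` and `Γ₂`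
carry the shift `1 - n`, and `t^(i+1)` raises it to `3 - n + 2i`.

The modules of `C(Γ₁)` and `C(Γ₂)` are finitely generated, so their cohomology is
finite-dimensional; for `C(Γ)` this is transported along the homotopy equivalence. -/

noncomputable section

namespace MatFact

/-! ### Graded modules that need not be free -/

/-- A module over `ℚ[σ]` with a compatible family of subgroups of homogeneous elements. -/
structure GrMod (σ : Type) : Type 1 where
  carrier : Type
  [acg : AddCommGroup carrier]
  [mod : Module (MvPolynomial σ ℚ) carrier]
  piece : ℤ → AddSubgroup carrier
  smul_mem : ∀ {j k : ℤ} {r : MvPolynomial σ ℚ} {x : carrier}, IsHomog r j → x ∈ piece k →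
    r • x ∈ piece (j + k)

attribute [instance] GrMod.acg GrMod.mod

/-- A free graded module as a graded module. -/
def GrFree.toGrMod {σ : Type} (M : GrFree σ) : GrMod σ where
  carrier := M.carrier
  piece := M.piece
  smul_mem := by
    intro j k r x hr hx
    obtain ⟨I, b, d, h⟩ := M.free
    rw [h] at hx ⊢
    intro i
    rw [map_smul, Finsupp.smul_apply, smul_eq_mul]
    exact (hr.mul (hx i)).cast (by ring)

namespace GrMod
variable {σ : Type}

theorem mem_cast {M : GrMod σ} {j k : ℤ} {x : M.carrier} (hx : x ∈ M.piece j) (h : j = k) :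
    x ∈ M.piece k := h ▸ hx

/-- The direct sum `M{s} ⊕ N{t}`. -/
def prodShift (M N : GrMod σ) (s t : ℤ) : GrMod σ where
  carrier := M.carrier × N.carrier
  piece k := (M.piece (k - s)).prod (N.piece (k - t))
  smul_mem := fun hr hx => ⟨mem_cast (M.smul_mem hr hx.1) (by ring),
    mem_cast (N.smul_mem hr hx.2) (by ring)⟩

/-- The zero module. -/
def zero (σ : Type) : GrMod σ where
  carrier := PUnit
  piece _ := ⊤
  smul_mem := fun _ _ => trivial

/-- Direct sum of a finite family of graded modules. -/
def pi {m : ℕ} (M : Fin m → GrMod σ) : GrMod σ where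
  carrier := ∀ i, (M i).carrier
  piece k := AddSubgroup.pi Set.univ fun i => (M i).piece k
  smul_mem := fun hr hx i _ => (M i).smul_mem hr (hx i trivial)

/-- The grading shift. -/
def shift (M : GrMod σ) (s : ℤ) : GrMod σ where
  carrier := M.carrier
  piece k := M.piece (k - s)
  smul_mem := fun hr hx => mem_cast (M.smul_mem hr hx) (by ring)

/-- Restriction of scalars along `ℚ[β] ⊆ ℚ[ι ⊔ β]`. -/
def restrict {ι β : Type} (M : GrMod (ι ⊕ β)) : GrMod β where
  carrier := M.carrier
  acg := M.acg
  mod := Module.compHom M.carrier (GrFree.incl ι β)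
  piece := M.piece
  smul_mem := fun {j k r x} hr hx => M.smul_mem (r := GrFree.incl ι β r) (by
    intro d hd
    obtain ⟨e, rfl, he⟩ := MvPolynomial.coeff_rename_ne_zero _ _ _ hd
    rw [← hr he, GrFree.weight_two, GrFree.weight_two, Finsupp.degree_mapDomain]) hx

/-- `q : M → N` is, up to a degree shift by `s`, the quotient of `M` by the image of a
homogeneous `b` of degree `p` that acts injectively on `M`. -/
structure RegQuot (M N : GrMod σ) (q : M.carrier →ₗ[MvPolynomial σ ℚ] N.carrier)
    (b : MvPolynomial σ ℚ) (s p : ℤ) : Prop where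
  deg : ∀ k x, x ∈ M.piece k → q x ∈ N.piece (k + s)
  surj : ∀ k y, y ∈ N.piece (k + s) → ∃ x ∈ M.piece k, q x = y
  map_smul : ∀ x, q (b • x) = 0
  ker : ∀ k x, x ∈ M.piece (k + p) → q x = 0 → ∃ y ∈ M.piece k, b • y = x
  inj : ∀ x : M.carrier, b • x = 0 → x = 0

theorem RegQuot.prodShift {M N M' N' : GrMod σ} {q : M.carrier →ₗ[MvPolynomial σ ℚ] N.carrier}
    {q' : M'.carrier →ₗ[MvPolynomial σ ℚ] N'.carrier}
    {b : MvPolynomial σ ℚ} {s p : ℤ} (h : RegQuot M N q b s p) (h' : RegQuot M' N' q' b s p)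
    (u v : ℤ) : RegQuot (M.prodShift M' u v) (N.prodShift N' u v) (q.prodMap q') b s p where
  deg k x hx := ⟨mem_cast (h.deg _ _ hx.1) (by ring), mem_cast (h'.deg _ _ hx.2) (by ring)⟩
  surj := by
    rintro k ⟨y, y'⟩ ⟨hy, hy'⟩
    obtain ⟨x, hx, rfl⟩ := h.surj (k - u) y (mem_cast hy (by ring))
    obtain ⟨x', hx', rfl⟩ := h'.surj (k - v) y' (mem_cast hy' (by ring))
    exact ⟨(x, x'), ⟨hx, hx'⟩, rfl⟩
  map_smul x := Prod.ext (h.map_smul x.1) (h'.map_smul x.2)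
  ker := by
    rintro k ⟨y, y'⟩ ⟨hy, hy'⟩ e
    obtain ⟨x, hx, rfl⟩ := h.ker (k - u) y (mem_cast hy (by ring)) (congrArg Prod.fst e)
    obtain ⟨x', hx', rfl⟩ := h'.ker (k - v) y' (mem_cast hy' (by ring)) (congrArg Prod.snd e)
    exact ⟨(x, x'), ⟨hx, hx'⟩, rfl⟩
  inj x hx := Prod.ext (h.inj _ (congrArg Prod.fst hx)) (h'.inj _ (congrArg Prod.snd hx))

theorem RegQuot.zero (b : MvPolynomial σ ℚ) (s p : ℤ) :
    RegQuot (zero σ) (zero σ) 0 b s p where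
  deg _ _ _ := trivial
  surj _ y _ := ⟨y, trivial, rfl⟩
  map_smul _ := rfl
  ker _ x _ _ := ⟨x, trivial, rfl⟩
  inj _ _ := rfl

end GrMod

/-- A graded map from a free graded module over `ℚ[β]` can be lifted through any map through which
the images of homogeneous elements can be lifted. -/
theorem GrFree.exists_lift {ι β : Type} (P : GrFree β) {X : Type} [AddCommGroup X]
    [Module (MvPolynomial (ι ⊕ β) ℚ) X] (Y : GrMod (ι ⊕ β))
    (π : Y.carrier →ₗ[MvPolynomial (ι ⊕ β) ℚ] X) (φ : P.carrier →ₛₗ[GrFree.incl ι β] X) (e : ℤ)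
    (h : ∀ k x, x ∈ P.piece k → ∃ y ∈ Y.piece (k + e), π y = φ x) :
    ∃ ψ : P.carrier →ₛₗ[GrFree.incl ι β] Y.carrier,
      (∀ k x, x ∈ P.piece k → ψ x ∈ Y.piece (k + e)) ∧ ∀ x, π (ψ x) = φ x := by
  classical
  obtain ⟨I, b, d, hb⟩ := P.free
  have hbi : ∀ i, b i ∈ P.piece (d i) := by
    intro i
    rw [hb]
    intro j
    rw [Module.Basis.repr_self, Finsupp.single_apply]
    split_ifs with hij
    · subst hij; exact IsHomog.one.cast (by ring)
    · exact IsHomog.zero _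
  -- Freeness of `P` enters here: only the homogeneous basis vectors are lifted, and the rest
  -- follows by linearity over `ℚ[β]`.
  choose y hy hyπ using fun i => h _ _ (hbi i)
  let y' : I → Y.restrict.carrier := y
  let ψ : P.carrier →ₗ[MvPolynomial β ℚ] Y.restrict.carrier := b.constr ℕ y'
  let ψ' : P.carrier →ₛₗ[GrFree.incl ι β] Y.carrier :=
    { toFun := ψ
      map_add' := ψ.map_add
      map_smul' := fun r x => ψ.map_smul r x }
  refine ⟨ψ', fun k x hx => ?_, fun x => ?_⟩
  · have : ψ x ∈ Y.restrict.piece (k + e) := by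
      rw [show ψ x = _ from b.constr_apply ℕ y' x, Finsupp.sum]
      refine AddSubgroup.sum_mem _ fun i _ => ?_
      exact GrMod.mem_cast (Y.restrict.smul_mem ((hb k x).1 hx i) (hy i)) (by ring)
    exact this
  · have hb' : ∀ i, ψ' (b i) = y i := fun i => b.constr_basis ℕ y' i
    induction b.mem_span x using Submodule.span_induction with
    | zero => simp
    | add x x' _ _ hx hx' => simp only [map_add, hx, hx']
    | smul r x _ hx => simp only [map_smulₛₗ, hx, RingHom.id_apply]
    | mem x hx =>
      obtain ⟨i, rfl⟩ := hx
      rw [hb', hyπ]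

/-! ### Factorizations of non-free modules -/

/-- A pair of graded modules and maps of degree `n + 1`, without condition on the square. -/
structure Pre (σ : Type) (n : ℕ) : Type 1 where
  M0 : GrMod σ
  M1 : GrMod σ
  d0 : M0.carrier →ₗ[MvPolynomial σ ℚ] M1.carrier
  d1 : M1.carrier →ₗ[MvPolynomial σ ℚ] M0.carrier
  d0_deg : ∀ k x, x ∈ M0.piece k → d0 x ∈ M1.piece (k + (n + 1))
  d1_deg : ∀ k x, x ∈ M1.piece k → d1 x ∈ M0.piece (k + (n + 1))

/-- A graded factorization, forgetting freeness. -/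
def GrFact.toPre {σ : Type} {n : ℕ} {w : MvPolynomial σ ℚ} (M : GrFact σ n w) : Pre σ n where
  M0 := M.M0.toGrMod
  M1 := M.M1.toGrMod
  d0 := M.d0
  d1 := M.d1
  d0_deg := M.d0_deg
  d1_deg := M.d1_deg

namespace Pre
variable {σ ι β : Type} {n : ℕ}

/-- The square of the differential is `w`. -/
structure HasPot (T : Pre σ n) (w : MvPolynomial σ ℚ) : Prop where
  d1_d0 : ∀ x, T.d1 (T.d0 x) = w • x
  d0_d1 : ∀ x, T.d0 (T.d1 x) = w • x

/-- Linear maps commuting with the differentials. -/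
structure Mor (T T' : Pre σ n) where
  f0 : T.M0.carrier →ₗ[MvPolynomial σ ℚ] T'.M0.carrier
  f1 : T.M1.carrier →ₗ[MvPolynomial σ ℚ] T'.M1.carrier
  comm0 : ∀ x, f1 (T.d0 x) = T'.d0 (f0 x)
  comm1 : ∀ x, f0 (T.d1 x) = T'.d1 (f1 x)

/-- Composition. -/
def Mor.comp {T T' T'' : Pre σ n} (g : Mor T' T'') (f : Mor T T') : Mor T T'' where
  f0 := g.f0 ∘ₗ f.f0
  f1 := g.f1 ∘ₗ f.f1
  comm0 x := by simp [f.comm0, g.comm0]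
  comm1 x := by simp [f.comm1, g.comm1]

/-- `f0, f1` is a chain map of degree `0` from a free factorization over `ℚ[β]`. -/
structure IsMap {w : MvPolynomial β ℚ} (P : GrFact β n w) (T : Pre (ι ⊕ β) n)
    (f0 : P.M0.carrier →ₛₗ[GrFree.incl ι β] T.M0.carrier)
    (f1 : P.M1.carrier →ₛₗ[GrFree.incl ι β] T.M1.carrier) : Prop where
  deg0 : ∀ k x, x ∈ P.M0.piece k → f0 x ∈ T.M0.piece k
  deg1 : ∀ k x, x ∈ P.M1.piece k → f1 x ∈ T.M1.piece k
  comm0 : ∀ x, f1 (P.d0 x) = T.d0 (f0 x)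
  comm1 : ∀ x, f0 (P.d1 x) = T.d1 (f1 x)

/-- `h0, h1` is a homotopy from `f0, f1` to `0`. -/
structure IsNull {w : MvPolynomial β ℚ} (P : GrFact β n w) (T : Pre (ι ⊕ β) n)
    (f0 : P.M0.carrier →ₛₗ[GrFree.incl ι β] T.M0.carrier)
    (f1 : P.M1.carrier →ₛₗ[GrFree.incl ι β] T.M1.carrier)
    (h0 : P.M0.carrier →ₛₗ[GrFree.incl ι β] T.M1.carrier)
    (h1 : P.M1.carrier →ₛₗ[GrFree.incl ι β] T.M0.carrier) : Prop where
  deg0 : ∀ k x, x ∈ P.M0.piece k → h0 x ∈ T.M1.piece (k - n - 1)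
  deg1 : ∀ k x, x ∈ P.M1.piece k → h1 x ∈ T.M0.piece (k - n - 1)
  eq0 : ∀ x, f0 x = h1 (P.d0 x) + T.d1 (h0 x)
  eq1 : ∀ x, f1 x = h0 (P.d1 x) + T.d0 (h1 x)

/-- Chain maps out of free factorizations of `w` lift along `p`, uniquely up to homotopy. -/
structure Lifts (w : MvPolynomial β ℚ) {T T' : Pre (ι ⊕ β) n} (p : Mor T T') : Prop where
  lift : ∀ (P : GrFact β n w) (f0 : P.M0.carrier →ₛₗ[GrFree.incl ι β] T'.M0.carrier)
    (f1 : P.M1.carrier →ₛₗ[GrFree.incl ι β] T'.M1.carrier), IsMap P T' f0 f1 →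
    ∃ g0 g1, IsMap P T g0 g1 ∧ (∀ x, p.f0 (g0 x) = f0 x) ∧ ∀ x, p.f1 (g1 x) = f1 x
  null : ∀ (P : GrFact β n w) (f0 : P.M0.carrier →ₛₗ[GrFree.incl ι β] T.M0.carrier)
    (f1 : P.M1.carrier →ₛₗ[GrFree.incl ι β] T.M1.carrier) (h0 h1), IsMap P T f0 f1 →
    IsNull P T' (p.f0.comp f0) (p.f1.comp f1) h0 h1 → ∃ h0 h1, IsNull P T f0 f1 h0 h1
  deg0 : ∀ k x, x ∈ T.M0.piece k → p.f0 x ∈ T'.M0.piece k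
  deg1 : ∀ k x, x ∈ T.M1.piece k → p.f1 x ∈ T'.M1.piece k

theorem IsMap.comp {w : MvPolynomial β ℚ} {T T' : Pre (ι ⊕ β) n} {p : Mor T T'} {P : GrFact β n w}
    {f0 : P.M0.carrier →ₛₗ[GrFree.incl ι β] T.M0.carrier}
    {f1 : P.M1.carrier →ₛₗ[GrFree.incl ι β] T.M1.carrier} (hf : IsMap P T f0 f1)
    (h0 : ∀ k x, x ∈ T.M0.piece k → p.f0 x ∈ T'.M0.piece k)
    (h1 : ∀ k x, x ∈ T.M1.piece k → p.f1 x ∈ T'.M1.piece k) :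
    IsMap P T' (p.f0.comp f0) (p.f1.comp f1) where
  deg0 k x hx := h0 _ _ (hf.deg0 _ _ hx)
  deg1 k x hx := h1 _ _ (hf.deg1 _ _ hx)
  comm0 x := by simp [hf.comm0, p.comm0]
  comm1 x := by simp [hf.comm1, p.comm1]

theorem Lifts.comp {w : MvPolynomial β ℚ} {T T' T'' : Pre (ι ⊕ β) n} {q : Mor T' T''} {p : Mor T T'}
    (hq : Lifts w q) (hp : Lifts w p) : Lifts w (q.comp p) where
  lift P f0 f1 hf := by
    obtain ⟨g0, g1, hg, e0, e1⟩ := hq.lift P f0 f1 hf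
    obtain ⟨k0, k1, hk, e0', e1'⟩ := hp.lift P g0 g1 hg
    exact ⟨k0, k1, hk, fun x => (congrArg q.f0 (e0' x)).trans (e0 x),
      fun x => (congrArg q.f1 (e1' x)).trans (e1 x)⟩
  null P f0 f1 h0 h1 hf hh := by
    -- The null-homotopy is pulled back one stage at a time. The composite of `f` with `p` must be a
    -- graded chain map for this, which is why `Lifts` records the degrees of `p`.
    obtain ⟨k0, k1, hk⟩ := hq.null P (p.f0.comp f0) (p.f1.comp f1) h0 h1
      (hf.comp hp.deg0 hp.deg1) ⟨hh.deg0, hh.deg1, hh.eq0, hh.eq1⟩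
    exact hp.null P f0 f1 k0 k1 hf hk
  deg0 k x hx := hq.deg0 _ _ (hp.deg0 _ _ hx)
  deg1 k x hx := hq.deg1 _ _ (hp.deg1 _ _ hx)

/-- Interchange of the two parities. -/
def swap (T : Pre σ n) : Pre σ n where
  M0 := T.M1
  M1 := T.M0
  d0 := T.d1
  d1 := T.d0
  d0_deg := T.d1_deg
  d1_deg := T.d0_deg

/-- Interchange of the two parities. -/
def Mor.swap {T T' : Pre σ n} (p : Mor T T') : Mor T.swap T'.swap where
  f0 := p.f1
  f1 := p.f0
  comm0 := p.comm1
  comm1 := p.comm0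

/-- Interchange of the two parities. -/
def _root_.MatFact.GrFact.swap {w : MvPolynomial σ ℚ} (P : GrFact σ n w) : GrFact σ n w where
  M0 := P.M1
  M1 := P.M0
  d0 := P.d1
  d1 := P.d0
  d0_deg := P.d1_deg
  d1_deg := P.d0_deg
  d1_d0 := P.d0_d1
  d0_d1 := P.d1_d0

/-- The test objects are all free factorizations of `w`, a class closed under interchange of
parities. -/
theorem Lifts.swap {w : MvPolynomial β ℚ} {T T' : Pre (ι ⊕ β) n} {p : Mor T T'}
    (hp : Lifts w p) : Lifts w p.swap where
  lift P f0 f1 hf := by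
    obtain ⟨g0, g1, hg, e0, e1⟩ := hp.lift P.swap f1 f0 ⟨hf.2, hf.1, hf.4, hf.3⟩
    exact ⟨g1, g0, ⟨hg.2, hg.1, hg.4, hg.3⟩, e1, e0⟩
  null P f0 f1 h0 h1 hf hh := by
    obtain ⟨k0, k1, hk⟩ := hp.null P.swap f1 f0 h1 h0 ⟨hf.2, hf.1, hf.4, hf.3⟩
      ⟨hh.2, hh.1, hh.4, hh.3⟩
    exact ⟨k1, k0, hk.2, hk.1, hk.4, hk.3⟩
  deg0 := hp.deg1
  deg1 := hp.deg0

/-- Graded isomorphisms. -/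
structure Iso (T T' : Pre σ n) where
  e0 : T.M0.carrier ≃ₗ[MvPolynomial σ ℚ] T'.M0.carrier
  e1 : T.M1.carrier ≃ₗ[MvPolynomial σ ℚ] T'.M1.carrier
  mem0 : ∀ k x, x ∈ T.M0.piece k ↔ e0 x ∈ T'.M0.piece k
  mem1 : ∀ k x, x ∈ T.M1.piece k ↔ e1 x ∈ T'.M1.piece k
  comm0 : ∀ x, e1 (T.d0 x) = T'.d0 (e0 x)
  comm1 : ∀ x, e0 (T.d1 x) = T'.d1 (e1 x)

/-- The inverse isomorphism. -/
def Iso.symm {T T' : Pre σ n} (e : Iso T T') : Iso T' T where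
  e0 := e.e0.symm
  e1 := e.e1.symm
  mem0 k x := by rw [e.mem0, LinearEquiv.apply_symm_apply]
  mem1 k x := by rw [e.mem1, LinearEquiv.apply_symm_apply]
  comm0 x := by rw [LinearEquiv.symm_apply_eq, e.comm0, LinearEquiv.apply_symm_apply]
  comm1 x := by rw [LinearEquiv.symm_apply_eq, e.comm1, LinearEquiv.apply_symm_apply]

/-- Composition of isomorphisms. -/
def Iso.trans {T T' T'' : Pre σ n} (e : Iso T T') (f : Iso T' T'') : Iso T T'' where
  e0 := e.e0.trans f.e0
  e1 := e.e1.trans f.e1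
  mem0 k x := (e.mem0 k x).trans (f.mem0 k _)
  mem1 k x := (e.mem1 k x).trans (f.mem1 k _)
  comm0 x := by simp [e.comm0, f.comm0]
  comm1 x := by simp [e.comm1, f.comm1]

/-- The underlying morphism of an isomorphism. -/
def Iso.hom {T T' : Pre σ n} (e : Iso T T') : Mor T T' := ⟨e.e0, e.e1, e.comm0, e.comm1⟩

theorem Iso.lifts {T T' : Pre (ι ⊕ β) n} (e : Iso T T') (w : MvPolynomial β ℚ) :
    Lifts w e.hom where
  lift P f0 f1 hf := by
    refine ⟨e.e0.symm.toLinearMap.comp f0, e.e1.symm.toLinearMap.comp f1,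
      hf.comp (p := e.symm.hom) (fun k x hx => (e.symm.mem0 k x).1 hx)
        (fun k x hx => (e.symm.mem1 k x).1 hx), fun x => ?_, fun x => ?_⟩
    · exact e.e0.apply_symm_apply _
    · exact e.e1.apply_symm_apply _
  null P f0 f1 h0 h1 hf hh := by
    refine ⟨e.e1.symm.toLinearMap.comp h0, e.e0.symm.toLinearMap.comp h1,
      fun k x hx => (e.symm.mem1 _ _).1 (hh.deg0 _ _ hx),
      fun k x hx => (e.symm.mem0 _ _).1 (hh.deg1 _ _ hx), fun x => ?_, fun x => ?_⟩
    · apply e.e0.injective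
      have := hh.eq0 x
      simp only [LinearMap.comp_apply, LinearEquiv.coe_coe, map_add,
        LinearEquiv.apply_symm_apply, e.comm1]
      exact this
    · apply e.e1.injective
      have := hh.eq1 x
      simp only [LinearMap.comp_apply, LinearEquiv.coe_coe, map_add,
        LinearEquiv.apply_symm_apply, e.comm0]
      exact this
  deg0 k x := (e.mem0 k x).1
  deg1 k x := (e.mem1 k x).1

end Pre

/-- The semilinear map with components `f` and `g`. -/
def pairMap {R S M N N' : Type} [CommRing R] [CommRing S] {φ : R →+* S} [AddCommGroup M]
    [Module R M] [AddCommGroup N] [Module S N] [AddCommGroup N'] [Module S N']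
    (f : M →ₛₗ[φ] N) (g : M →ₛₗ[φ] N') : M →ₛₗ[φ] N × N' where
  toFun x := (f x, g x)
  map_add' x y := Prod.ext (f.map_add x y) (g.map_add x y)
  map_smul' r x := Prod.ext (f.map_smulₛₗ r x) (g.map_smulₛₗ r x)

namespace Pre
variable {σ ι β : Type} {n : ℕ}

/-! ### Tensoring with a rank one Koszul factorization -/

/-- The tensor product of `N` with the factorization `a : R{s} → R{t}`, `b : R{t} → R{s}`. -/
def ext (N : Pre σ n) (a b : MvPolynomial σ ℚ) (s t : ℤ) (ha : IsHomog a (n + 1 + s - t))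
    (hb : IsHomog b (n + 1 + t - s)) : Pre σ n where
  M0 := N.M0.prodShift N.M1 s t
  M1 := N.M0.prodShift N.M1 t s
  d0 := LinearMap.prod (LinearMap.coprod (a • LinearMap.id) N.d1)
    (LinearMap.coprod N.d0 (-(b • LinearMap.id)))
  d1 := LinearMap.prod (LinearMap.coprod (b • LinearMap.id) N.d1)
    (LinearMap.coprod N.d0 (-(a • LinearMap.id)))
  d0_deg k x hx :=
    ⟨AddSubgroup.add_mem _ (GrMod.mem_cast (N.M0.smul_mem ha hx.1) (by ring))
      (GrMod.mem_cast (N.d1_deg _ _ hx.2) (by ring)),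
    AddSubgroup.add_mem _ (GrMod.mem_cast (N.d0_deg _ _ hx.1) (by ring))
      (AddSubgroup.neg_mem _ (GrMod.mem_cast (N.M1.smul_mem hb hx.2) (by ring)))⟩
  d1_deg k x hx :=
    ⟨AddSubgroup.add_mem _ (GrMod.mem_cast (N.M0.smul_mem hb hx.1) (by ring))
      (GrMod.mem_cast (N.d1_deg _ _ hx.2) (by ring)),
    AddSubgroup.add_mem _ (GrMod.mem_cast (N.d0_deg _ _ hx.1) (by ring))
      (AddSubgroup.neg_mem _ (GrMod.mem_cast (N.M1.smul_mem ha hx.2) (by ring)))⟩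

section ext
variable {N N' : Pre σ n} {a b : MvPolynomial σ ℚ} {s t : ℤ} {ha : IsHomog a (n + 1 + s - t)}
  {hb : IsHomog b (n + 1 + t - s)}

theorem ext_d0 (x : N.M0.carrier) (y : N.M1.carrier) :
    (N.ext a b s t ha hb).d0 (x, y) = (a • x + N.d1 y, N.d0 x + -(b • y)) := rfl

theorem ext_d1 (x : N.M0.carrier) (y : N.M1.carrier) :
    (N.ext a b s t ha hb).d1 (x, y) = (b • x + N.d1 y, N.d0 x + -(a • y)) := rfl

theorem mem_ext0 {x : N.M0.carrier} {y : N.M1.carrier} {k : ℤ} (hx : x ∈ N.M0.piece (k - s))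
    (hy : y ∈ N.M1.piece (k - t)) : (x, y) ∈ (N.ext a b s t ha hb).M0.piece k := ⟨hx, hy⟩

theorem mem_ext1 {x : N.M0.carrier} {y : N.M1.carrier} {k : ℤ} (hx : x ∈ N.M0.piece (k - t))
    (hy : y ∈ N.M1.piece (k - s)) : (x, y) ∈ (N.ext a b s t ha hb).M1.piece k := ⟨hx, hy⟩

theorem HasPot.ext {w : MvPolynomial σ ℚ} (h : N.HasPot w) :
    (N.ext a b s t ha hb).HasPot (w + a * b) where
  d1_d0 := by
    rintro ⟨x, y⟩
    rw [ext_d0, ext_d1]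
    refine Prod.ext ?_ ?_
    · change b • (a • x + N.d1 y) + N.d1 (N.d0 x + -(b • y)) = (w + a * b) • x
      simp only [map_add, map_neg, map_smul, h.d1_d0]
      module
    · change N.d0 (a • x + N.d1 y) + -(a • (N.d0 x + -(b • y))) = (w + a * b) • y
      simp only [map_add, map_smul, h.d0_d1]
      module
  d0_d1 := by
    rintro ⟨x, y⟩
    rw [ext_d1, ext_d0]
    refine Prod.ext ?_ ?_
    · change a • (b • x + N.d1 y) + N.d1 (N.d0 x + -(a • y)) = (w + a * b) • x
      simp only [map_add, map_neg, map_smul, h.d1_d0]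
      module
    · change N.d0 (b • x + N.d1 y) + -(b • (N.d0 x + -(a • y))) = (w + a * b) • y
      simp only [map_add, map_smul, h.d0_d1]
      module

/-- Functoriality of the tensor product. -/
def Mor.ext (q : Mor N N') (ha : IsHomog a (n + 1 + s - t)) (hb : IsHomog b (n + 1 + t - s))
    (s' t' : ℤ) (ha' : IsHomog a (n + 1 + s' - t')) (hb' : IsHomog b (n + 1 + t' - s')) :
    Mor (N.ext a b s t ha hb) (N'.ext a b s' t' ha' hb') where
  f0 := q.f0.prodMap q.f1
  f1 := q.f0.prodMap q.f1
  comm0 := by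
    rintro ⟨x, y⟩
    refine Prod.ext ?_ ?_
    · change q.f0 (a • x + N.d1 y) = a • q.f0 x + N'.d1 (q.f1 y)
      simp only [map_add, map_smul, q.comm1]
    · change q.f1 (N.d0 x + -(b • y)) = N'.d0 (q.f0 x) + -(b • q.f1 y)
      simp only [map_add, map_smul, map_neg, q.comm0]
  comm1 := by
    rintro ⟨x, y⟩
    refine Prod.ext ?_ ?_
    · change q.f0 (b • x + N.d1 y) = b • q.f0 x + N'.d1 (q.f1 y)
      simp only [map_add, map_smul, q.comm1]
    · change q.f1 (N.d0 x + -(a • y)) = N'.d0 (q.f0 x) + -(a • q.f1 y)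
      simp only [map_add, map_smul, map_neg, q.comm0]

/-- Functoriality of the tensor product. -/
def Iso.ext (e : Iso N N') (a b : MvPolynomial σ ℚ) (s t : ℤ) (ha : IsHomog a (n + 1 + s - t))
    (hb : IsHomog b (n + 1 + t - s)) :
    Iso (N.ext a b s t ha hb) (N'.ext a b s t ha hb) where
  e0 := e.e0.prodCongr e.e1
  e1 := e.e0.prodCongr e.e1
  mem0 _ _ := and_congr (e.mem0 _ _) (e.mem1 _ _)
  mem1 _ _ := and_congr (e.mem0 _ _) (e.mem1 _ _)
  comm0 := (e.hom.ext ha hb s t ha hb).comm0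
  comm1 := (e.hom.ext ha hb s t ha hb).comm1

/-- The two tensor factors of `ext (ext N a b) c d` can be interchanged. -/
def Iso.extComm (N : Pre σ n) (a b c d : MvPolynomial σ ℚ) (s t s' t' : ℤ)
    (ha : IsHomog a (n + 1 + s - t)) (hb : IsHomog b (n + 1 + t - s))
    (hc : IsHomog c (n + 1 + s' - t')) (hd : IsHomog d (n + 1 + t' - s')) :
    Iso ((N.ext a b s t ha hb).ext c d s' t' hc hd) ((N.ext c d s' t' hc hd).ext a b s t ha hb) where
  e0 :=
    -- The sign sits on the component that is odd in both rank one factors: it is the Koszul sign of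
    -- their interchange.
    { toFun := fun x => ((x.1.1, x.2.2), (-x.2.1, x.1.2))
      invFun := fun x => ((x.1.1, x.2.2), (-x.2.1, x.1.2))
      left_inv := fun x => by
        refine Prod.ext (Prod.ext rfl rfl) (Prod.ext (neg_neg x.2.1) rfl)
      right_inv := fun x => by
        refine Prod.ext (Prod.ext rfl rfl) (Prod.ext (neg_neg x.2.1) rfl)
      map_add' := fun x y => Prod.ext rfl (Prod.ext (neg_add x.2.1 y.2.1) rfl)
      map_smul' := fun r x => Prod.ext rfl (Prod.ext (smul_neg r x.2.1).symm rfl) }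
  e1 :=
    { toFun := fun x => ((x.2.1, -x.1.2), (x.1.1, x.2.2))
      invFun := fun x => ((x.2.1, -x.1.2), (x.1.1, x.2.2))
      left_inv := fun x => by
        refine Prod.ext (Prod.ext rfl (neg_neg x.1.2)) rfl
      right_inv := fun x => by
        refine Prod.ext (Prod.ext rfl (neg_neg x.1.2)) rfl
      map_add' := fun x y => Prod.ext (Prod.ext rfl (neg_add x.1.2 y.1.2)) rfl
      map_smul' := fun r x => Prod.ext (Prod.ext rfl (smul_neg r x.1.2).symm) rfl }
  mem0 k x := by
    constructor
    · rintro ⟨⟨h1, h2⟩, h3, h4⟩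
      exact ⟨⟨GrMod.mem_cast h1 (by ring), GrMod.mem_cast h4 (by ring)⟩,
        AddSubgroup.neg_mem _ (GrMod.mem_cast h3 (by ring)), GrMod.mem_cast h2 (by ring)⟩
    · rintro ⟨⟨h1, h2⟩, h3, h4⟩
      exact ⟨⟨GrMod.mem_cast h1 (by ring), GrMod.mem_cast h4 (by ring)⟩,
        (AddSubgroup.neg_mem_iff _).1 (GrMod.mem_cast h3 (by ring)), GrMod.mem_cast h2 (by ring)⟩
  mem1 k x := by
    constructor
    · rintro ⟨⟨h1, h2⟩, h3, h4⟩
      exact ⟨⟨GrMod.mem_cast h3 (by ring), AddSubgroup.neg_mem _ (GrMod.mem_cast h2 (by ring))⟩,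
        GrMod.mem_cast h1 (by ring), GrMod.mem_cast h4 (by ring)⟩
    · rintro ⟨⟨h1, h2⟩, h3, h4⟩
      exact ⟨⟨GrMod.mem_cast h3 (by ring), (AddSubgroup.neg_mem_iff _).1 (GrMod.mem_cast h2 (by ring))⟩,
        GrMod.mem_cast h1 (by ring), GrMod.mem_cast h4 (by ring)⟩
  comm0 := by
    rintro ⟨⟨x, y⟩, ⟨z, v⟩⟩
    refine Prod.ext (Prod.ext ?_ ?_) (Prod.ext ?_ ?_)
    · change a • x + N.d1 y + -(d • z) = a • x + (d • (-z) + N.d1 y)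
      module
    · change -(c • y + (N.d0 z + -(a • v))) = a • v + (N.d0 (-z) + -(c • y))
      rw [map_neg]; module
    · change c • x + (b • z + N.d1 v) = c • x + N.d1 v + -(b • (-z))
      module
    · change N.d0 x + -(b • y) + -(d • v) = N.d0 x + -(d • v) + -(b • y)
      module
  comm1 := by
    rintro ⟨⟨x, y⟩, ⟨z, v⟩⟩
    refine Prod.ext (Prod.ext ?_ ?_) (Prod.ext ?_ ?_)
    · change d • x + (b • z + N.d1 v) = b • z + (d • x + N.d1 v)
      module
    · change N.d0 x + -(b • y) + -(c • v) = b • (-y) + (N.d0 x + -(c • v))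
      module
    · change -(a • x + N.d1 y + -(c • z)) = c • z + N.d1 (-y) + -(a • x)
      rw [map_neg]; module
    · change d • y + (N.d0 z + -(a • v)) = N.d0 z + -(d • (-y)) + -(a • v)
      module

/-- A row operation: `{(a, c), (b, d)} ≅ {(a - c, c), (b, b + d)}`. -/
def Iso.rowOp (N : Pre σ n) (a b c d : MvPolynomial σ ℚ) (s t : ℤ)
    (ha : IsHomog a (n + 1 + s - t)) (hb : IsHomog b (n + 1 + t - s))
    (hc : IsHomog c (n + 1 + s - t)) (hd : IsHomog d (n + 1 + t - s)) :
    Iso ((N.ext a b s t ha hb).ext c d s t hc hd)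
      ((N.ext (a - c) b s t (ha.sub hc) hb).ext c (b + d) s t hc (hb.add hd)) where
  e0 :=
    -- A unipotent change of basis. It has degree `0` because both rows carry the same shifts `s`,
    -- `t`.
    { toFun := fun x => ((x.1.1, x.1.2 - x.2.2), x.2)
      invFun := fun x => ((x.1.1, x.1.2 + x.2.2), x.2)
      left_inv := fun x => Prod.ext (Prod.ext rfl (sub_add_cancel x.1.2 x.2.2)) rfl
      right_inv := fun x => Prod.ext (Prod.ext rfl (add_sub_cancel_right x.1.2 x.2.2)) rfl
      map_add' := fun x y =>
        Prod.ext (Prod.ext rfl (add_sub_add_comm x.1.2 y.1.2 x.2.2 y.2.2)) rfl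
      map_smul' := fun r x => Prod.ext (Prod.ext rfl (smul_sub r x.1.2 x.2.2).symm) rfl }
  e1 :=
    { toFun := fun x => (x.1, (x.2.1 - x.1.1, x.2.2))
      invFun := fun x => (x.1, (x.2.1 + x.1.1, x.2.2))
      left_inv := fun x => Prod.ext rfl (Prod.ext (sub_add_cancel x.2.1 x.1.1) rfl)
      right_inv := fun x => Prod.ext rfl (Prod.ext (add_sub_cancel_right x.2.1 x.1.1) rfl)
      map_add' := fun x y =>
        Prod.ext rfl (Prod.ext (add_sub_add_comm x.2.1 y.2.1 x.1.1 y.1.1) rfl)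
      map_smul' := fun r x => Prod.ext rfl (Prod.ext (smul_sub r x.2.1 x.1.1).symm rfl) }
  mem0 k x := by
    constructor
    · rintro ⟨⟨h1, h2⟩, h3, h4⟩
      exact ⟨⟨h1, AddSubgroup.sub_mem _ h2 (GrMod.mem_cast h4 (by ring))⟩, h3, h4⟩
    · rintro ⟨⟨h1, h2⟩, h3, h4⟩
      exact ⟨⟨h1, (congrArg (· ∈ N.M1.piece (k - s - t)) (sub_add_cancel x.1.2 x.2.2)).mp
        (AddSubgroup.add_mem _ h2 (GrMod.mem_cast h4 (by ring)))⟩, h3, h4⟩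
  mem1 k x := by
    constructor
    · rintro ⟨⟨h1, h2⟩, h3, h4⟩
      exact ⟨⟨h1, h2⟩, AddSubgroup.sub_mem _ h3 (GrMod.mem_cast h1 (by ring)), h4⟩
    · rintro ⟨⟨h1, h2⟩, h3, h4⟩
      exact ⟨⟨h1, h2⟩, (congrArg (· ∈ N.M0.piece (k - s - t)) (sub_add_cancel x.2.1 x.1.1)).mp
        (AddSubgroup.add_mem _ h3 (GrMod.mem_cast h1 (by ring))), h4⟩
  comm0 := by
    rintro ⟨⟨x, y⟩, ⟨z, v⟩⟩
    refine Prod.ext (Prod.ext ?_ ?_) (Prod.ext ?_ ?_)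
    · change c • x + (b • z + N.d1 v) = c • x + (b • z + N.d1 v)
      rfl
    · change c • y + (N.d0 z + -(a • v)) = c • (y - v) + (N.d0 z + -((a - c) • v))
      module
    · change a • x + N.d1 y + -(d • z) - (c • x + (b • z + N.d1 v)) =
        (a - c) • x + N.d1 (y - v) + -((b + d) • z)
      rw [map_sub]; module
    · change N.d0 x + -(b • y) + -(d • v) = N.d0 x + -(b • (y - v)) + -((b + d) • v)
      module
  comm1 := by
    rintro ⟨⟨x, y⟩, ⟨z, v⟩⟩
    refine Prod.ext (Prod.ext ?_ ?_) (Prod.ext ?_ ?_)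
    · change d • x + (b • z + N.d1 v) = (b + d) • x + (b • (z - x) + N.d1 v)
      module
    · change d • y + (N.d0 z + -(a • v)) - (N.d0 x + -(b • y) + -(c • v)) =
        (b + d) • y + (N.d0 (z - x) + -((a - c) • v))
      rw [map_sub]; module
    · change a • x + N.d1 y + -(c • z) = (a - c) • x + N.d1 y + -(c • (z - x))
      module
    · change N.d0 x + -(b • y) + -(c • v) = N.d0 x + -(b • y) + -(c • v)
      rfl

/-- Killing the entry `b` of a row that acts regularly. -/
def extProj (q : Mor N N') (a b : MvPolynomial σ ℚ) (s t : ℤ) (ha : IsHomog a (n + 1 + s - t))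
    (hb : IsHomog b (n + 1 + t - s)) (h0 : ∀ x, q.f0 (b • x) = 0) (h1 : ∀ x, q.f1 (b • x) = 0) :
    Mor (N.ext a b s t ha hb) N' where
  f0 := q.f0 ∘ₗ LinearMap.fst _ _ _
  f1 := q.f1 ∘ₗ LinearMap.snd _ _ _
  comm0 := by
    rintro ⟨x, y⟩
    change q.f1 (N.d0 x + -(b • y)) = N'.d0 (q.f0 x)
    rw [map_add, map_neg, h1, neg_zero, add_zero, q.comm0]
  comm1 := by
    rintro ⟨x, y⟩
    change q.f0 (b • x + N.d1 y) = N'.d1 (q.f1 y)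
    rw [map_add, h0, zero_add, q.comm1]

end ext

/-! ### Killing a regular entry of a row -/

section Lifting
variable {N N' : Pre (ι ⊕ β) n} {a b : MvPolynomial (ι ⊕ β) ℚ} {s t : ℤ}
  {ha : IsHomog a (n + 1 + s - t)} {hb : IsHomog b (n + 1 + t - s)}

/-- Killing an entry that acts regularly does not change maps from free factorizations. -/
theorem extProj_lifts {w : MvPolynomial β ℚ} {q : Mor N N'}
    (h0 : GrMod.RegQuot N.M0 N'.M0 q.f0 b s (n + 1 + t - s))
    (h1 : GrMod.RegQuot N.M1 N'.M1 q.f1 b s (n + 1 + t - s))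
    {u : MvPolynomial (ι ⊕ β) ℚ} (hN : N.HasPot u) (hu : u + a * b = GrFree.incl ι β w) :
    Lifts w (extProj q a b s t ha hb h0.map_smul h1.map_smul) where
  deg0 k x hx := GrMod.mem_cast (h0.deg _ _ hx.1) (by ring)
  deg1 k x hx := GrMod.mem_cast (h1.deg _ _ hx.2) (by ring)
  lift P f0 f1 hf := by
    -- `F0`, `F1` lift `f0`, `f1` through `q` as graded linear maps only; they need not commute with
    -- the differentials.
    obtain ⟨F0, hF0, eF0⟩ := P.M0.exists_lift N.M0 q.f0 f0 (-s) fun k x hx =>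
      h0.surj _ _ (GrMod.mem_cast (hf.deg0 k x hx) (by ring))
    obtain ⟨F1, hF1, eF1⟩ := P.M1.exists_lift N.M1 q.f1 f1 (-s) fun k x hx =>
      h1.surj _ _ (GrMod.mem_cast (hf.deg1 k x hx) (by ring))
    -- The failure of `F` to be a chain map dies under `q`, hence is `b` times a graded map `G`.
    -- This `G` is the second component of the lift.
    obtain ⟨G0, hG0, eG0⟩ := P.M0.exists_lift N.M1 (b • LinearMap.id)
      (N.d0.comp F0 - F1.comp P.d0) (-t) fun k x hx => h1.ker _ _
        (AddSubgroup.sub_mem _ (GrMod.mem_cast (N.d0_deg _ _ (hF0 k x hx)) (by ring))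
          (GrMod.mem_cast (hF1 _ _ (P.d0_deg k x hx)) (by ring)))
        (by simp [q.comm0, eF0, eF1, hf.comm0])
    obtain ⟨G1, hG1, eG1⟩ := P.M1.exists_lift N.M0 (b • LinearMap.id)
      (N.d1.comp F1 - F0.comp P.d1) (-t) fun k x hx => h0.ker _ _
        (AddSubgroup.sub_mem _ (GrMod.mem_cast (N.d1_deg _ _ (hF1 k x hx)) (by ring))
          (GrMod.mem_cast (hF0 _ _ (P.d1_deg k x hx)) (by ring)))
        (by simp [q.comm1, eF0, eF1, hf.comm1])
    replace eG0 : ∀ x, b • G0 x = N.d0 (F0 x) - F1 (P.d0 x) := eG0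
    replace eG1 : ∀ x, b • G1 x = N.d1 (F1 x) - F0 (P.d1 x) := eG1
    let g0 : P.M0.carrier →ₛₗ[GrFree.incl ι β] (N.ext a b s t ha hb).M0.carrier := pairMap F0 G0
    let g1 : P.M1.carrier →ₛₗ[GrFree.incl ι β] (N.ext a b s t ha hb).M1.carrier := pairMap (-G1) F1
    refine ⟨g0, g1, ⟨fun k x hx => mem_ext0 (hF0 k x hx) (hG0 k x hx),
      fun k x hx => mem_ext1 (AddSubgroup.neg_mem _ (hG1 k x hx)) (hF1 k x hx),
      fun x => ?_, fun x => ?_⟩, fun x => eF0 x, fun x => eF1 x⟩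
    · refine Prod.ext ?_ ?_
      · change -G1 (P.d0 x) = a • F0 x + N.d1 (G0 x)
        -- Since `b` acts injectively, the identity that involves `a` may be checked after
        -- multiplication by `b`. There it compares `d² = u` on `N` with `d² = u + a b` on `P`.
        refine sub_eq_zero.1 (h0.inj _ ?_)
        rw [smul_sub, smul_neg, eG1, P.d1_d0, smul_add, ← map_smul N.d1, eG0, map_sub, hN.1,
          map_smulₛₗ, ← hu]
        module
      · change F1 (P.d0 x) = N.d0 (F0 x) + -(b • G0 x)
        rw [eG0]; abel
    · refine Prod.ext ?_ ?_
      · change F0 (P.d1 x) = b • (-G1 x) + N.d1 (F1 x)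
        rw [smul_neg, eG1]; abel
      · change G0 (P.d1 x) = N.d0 (-G1 x) + -(a • F1 x)
        refine sub_eq_zero.1 (h1.inj _ ?_)
        rw [smul_sub, eG0, P.d0_d1, map_neg, smul_add, smul_neg, ← map_smul N.d0, eG1, map_sub,
          hN.2, map_smulₛₗ, ← hu]
        module
  null P f0 f1 h0' h1' hf hh := by
    obtain ⟨H0, hH0, eH0⟩ := P.M0.exists_lift N.M1 q.f1 h0' (-n - 1 - s) fun k x hx =>
      h1.surj _ _ (GrMod.mem_cast (hh.deg0 k x hx) (by ring))
    obtain ⟨H1, hH1, eH1⟩ := P.M1.exists_lift N.M0 q.f0 h1' (-n - 1 - s) fun k x hx =>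
      h0.surj _ _ (GrMod.mem_cast (hh.deg1 k x hx) (by ring))
    let F0 := (LinearMap.fst _ N.M0.carrier N.M1.carrier).comp f0
    let F1 := (LinearMap.snd _ N.M0.carrier N.M1.carrier).comp f1
    let F0' := (LinearMap.snd _ N.M0.carrier N.M1.carrier).comp f0
    let F1' := (LinearMap.fst _ N.M0.carrier N.M1.carrier).comp f1
    have hF0 : ∀ k x, x ∈ P.M0.piece k → F0 x ∈ N.M0.piece (k - s) := fun k x hx => (hf.deg0 k x hx).1
    have hF1 : ∀ k x, x ∈ P.M1.piece k → F1 x ∈ N.M1.piece (k - s) := fun k x hx => (hf.deg1 k x hx).2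
    have c0 : ∀ x, F1' (P.d0 x) = a • F0 x + N.d1 (F0' x) := fun x =>
      congrArg Prod.fst (hf.comm0 x)
    have c1 : ∀ x, F1 (P.d0 x) = N.d0 (F0 x) + -(b • F0' x) := fun x =>
      congrArg Prod.snd (hf.comm0 x)
    have c2 : ∀ x, F0 (P.d1 x) = b • F1' x + N.d1 (F1 x) := fun x =>
      congrArg Prod.fst (hf.comm1 x)
    have c3 : ∀ x, F0' (P.d1 x) = N.d0 (F1' x) + -(a • F1 x) := fun x =>
      congrArg Prod.snd (hf.comm1 x)
    have q0 : ∀ x, q.f0 (F0 x) = h1' (P.d0 x) + N'.d1 (h0' x) := hh.eq0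
    have q1 : ∀ x, q.f1 (F1 x) = h0' (P.d1 x) + N'.d0 (h1' x) := hh.eq1
    -- The same device one step up: the homotopy lifts to `H`, and `F - H d - d H` dies under `q`,
    -- hence is divisible by `b`.
    obtain ⟨G0, hG0, eG0⟩ := P.M0.exists_lift N.M0 (b • LinearMap.id)
      (F0 - H1.comp P.d0 - N.d1.comp H0) (-n - 1 - t) fun k x hx => h0.ker _ _
        (AddSubgroup.sub_mem _ (AddSubgroup.sub_mem _ (GrMod.mem_cast (hF0 k x hx) (by ring))
          (GrMod.mem_cast (hH1 _ _ (P.d0_deg k x hx)) (by ring)))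
          (GrMod.mem_cast (N.d1_deg _ _ (hH0 k x hx)) (by ring)))
        (by simp [q.comm1, eH0, eH1, q0])
    obtain ⟨G1, hG1, eG1⟩ := P.M1.exists_lift N.M1 (b • LinearMap.id)
      (F1 - H0.comp P.d1 - N.d0.comp H1) (-n - 1 - t) fun k x hx => h1.ker _ _
        (AddSubgroup.sub_mem _ (AddSubgroup.sub_mem _ (GrMod.mem_cast (hF1 k x hx) (by ring))
          (GrMod.mem_cast (hH0 _ _ (P.d1_deg k x hx)) (by ring)))
          (GrMod.mem_cast (N.d0_deg _ _ (hH1 k x hx)) (by ring)))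
        (by simp [q.comm0, eH0, eH1, q1])
    replace eG0 : ∀ x, b • G0 x = F0 x - H1 (P.d0 x) - N.d1 (H0 x) := eG0
    replace eG1 : ∀ x, b • G1 x = F1 x - H0 (P.d1 x) - N.d0 (H1 x) := eG1
    let k0 : P.M0.carrier →ₛₗ[GrFree.incl ι β] (N.ext a b s t ha hb).M1.carrier := pairMap G0 H0
    let k1 : P.M1.carrier →ₛₗ[GrFree.incl ι β] (N.ext a b s t ha hb).M0.carrier := pairMap H1 (-G1)
    refine ⟨k0, k1, fun k x hx => mem_ext1 (GrMod.mem_cast (hG0 k x hx) (by ring))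
      (GrMod.mem_cast (hH0 k x hx) (by ring)),
      fun k x hx => mem_ext0 (GrMod.mem_cast (hH1 k x hx) (by ring))
      (AddSubgroup.neg_mem _ (GrMod.mem_cast (hG1 k x hx) (by ring))), fun x => ?_, fun x => ?_⟩
    · refine Prod.ext ?_ ?_
      · change F0 x = H1 (P.d0 x) + (b • G0 x + N.d1 (H0 x))
        rw [eG0]; abel
      · change F0' x = -G1 (P.d0 x) + (N.d0 (G0 x) + -(a • H0 x))
        refine sub_eq_zero.1 (h1.inj _ ?_)
        rw [smul_sub, smul_add, smul_neg, eG1, smul_add, ← map_smul N.d0, eG0, c1, P.d1_d0,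
          map_sub, map_sub, hN.2, map_smulₛₗ, ← hu]
        module
    · refine Prod.ext ?_ ?_
      · change F1' x = G0 (P.d1 x) + (a • H1 x + N.d1 (-G1 x))
        refine sub_eq_zero.1 (h0.inj _ ?_)
        rw [smul_sub, smul_add, eG0, map_neg, smul_add, smul_neg, ← map_smul N.d1, eG1, c2,
          P.d0_d1, map_sub, map_sub, hN.1, map_smulₛₗ, ← hu]
        module
      · change F1 x = H0 (P.d1 x) + (N.d0 (H1 x) + -(b • (-G1 x)))
        rw [smul_neg, eG1]; abel

end Lifting
end Pre

/-! ### Homogeneous components and homogeneous ideals -/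

section Components
variable {σ : Type}

/-- The component of degree `k`, all variables having degree `2`. -/
def homogComp (k : ℤ) : MvPolynomial σ ℚ →ₗ[ℚ] MvPolynomial σ ℚ :=
  MvPolynomial.weightedHomogeneousComponent (fun _ : σ => (2 : ℤ)) k

theorem isHomog_homogComp (k : ℤ) (F : MvPolynomial σ ℚ) : IsHomog (homogComp k F) k :=
  MvPolynomial.weightedHomogeneousComponent_isWeightedHomogeneous _ _

theorem IsHomog.homogComp_eq {F : MvPolynomial σ ℚ} {k : ℤ} (h : IsHomog F k) :
    homogComp k F = F :=
  MvPolynomial.IsWeightedHomogeneous.weightedHomogeneousComponent_same h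

theorem homogComp_mul {b : MvPolynomial σ ℚ} {p : ℤ} (hb : IsHomog b p) (F : MvPolynomial σ ℚ)
    (k : ℤ) : homogComp (k + p) (F * b) = homogComp k F * b := by
  classical
  let _ := MvPolynomial.weightedGradedAlgebra ℚ (fun _ : σ => (2 : ℤ))
  have := DirectSum.coe_decompose_mul_add_of_right_mem
    (MvPolynomial.weightedHomogeneousSubmodule ℚ (fun _ : σ => (2 : ℤ))) (i := k) (a := F) (b := b) hb
  have key (G : MvPolynomial σ ℚ) (j : ℤ) : (DirectSum.decompose
      (MvPolynomial.weightedHomogeneousSubmodule ℚ (fun _ : σ => (2 : ℤ))) G j :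
        MvPolynomial σ ℚ) = homogComp j G :=
    MvPolynomial.weightedDecomposition.decompose'_apply ℚ _ G j
  rwa [key, key] at this

/-- An ideal that contains the homogeneous components of its elements. -/
def IsHomogIdeal (I : Ideal (MvPolynomial σ ℚ)) : Prop :=
  ∀ F ∈ I, ∀ k, homogComp k F ∈ I

theorem IsHomogIdeal.bot : IsHomogIdeal (⊥ : Ideal (MvPolynomial σ ℚ)) := by
  intro F hF k
  rw [Ideal.mem_bot] at hF ⊢
  rw [hF, map_zero]

theorem IsHomogIdeal.sup_span {I : Ideal (MvPolynomial σ ℚ)} (hI : IsHomogIdeal I)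
    {b : MvPolynomial σ ℚ} {p : ℤ} (hb : IsHomog b p) : IsHomogIdeal (I ⊔ Ideal.span {b}) := by
  intro F hF k
  obtain ⟨i, hi, j, hj, rfl⟩ := Submodule.mem_sup.1 hF
  obtain ⟨c, rfl⟩ := Ideal.mem_span_singleton'.1 hj
  rw [map_add, show k = k - p + p by ring, homogComp_mul hb]
  exact add_mem (Ideal.mem_sup_left (hI _ hi _))
    (Ideal.mem_sup_right (Ideal.mul_mem_left _ _ (Ideal.mem_span_singleton_self b)))

end Components

/-! ### Quotients of the polynomial ring -/

namespace GrMod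
variable {σ : Type}

/-- The graded module `(ℚ[σ] / I){u}`. -/
def quot (I : Ideal (MvPolynomial σ ℚ)) (u : ℤ) : GrMod σ where
  carrier := MvPolynomial σ ℚ ⧸ I
  piece k :=
    { carrier := {x | ∃ r, IsHomog r (k - u) ∧ Ideal.Quotient.mk I r = x}
      zero_mem' := ⟨0, IsHomog.zero _, map_zero _⟩
      add_mem' := by
        rintro _ _ ⟨r, hr, rfl⟩ ⟨r', hr', rfl⟩
        exact ⟨r + r', hr.add hr', map_add _ _ _⟩
      neg_mem' := by
        rintro _ ⟨r, hr, rfl⟩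
        exact ⟨-r, hr.neg, map_neg _ _⟩ }
  smul_mem := by
    rintro j k r _ hr ⟨x, hx, rfl⟩
    exact ⟨r * x, (hr.mul hx).cast (by ring), rfl⟩

theorem regQuot_quot {I : Ideal (MvPolynomial σ ℚ)} (hI : IsHomogIdeal I) {b : MvPolynomial σ ℚ}
    {p : ℤ} (hb : IsHomog b p) (hreg : ∀ y, b * y ∈ I → y ∈ I) (u s : ℤ) :
    RegQuot (quot I u) (quot (I ⊔ Ideal.span {b}) (u + s))
      (Submodule.factor le_sup_left) b s p where
  deg := by
    rintro k _ ⟨r, hr, rfl⟩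
    exact ⟨r, hr.cast (by ring), rfl⟩
  surj := by
    rintro k _ ⟨r, hr, rfl⟩
    exact ⟨_, ⟨r, hr.cast (by ring), rfl⟩, rfl⟩
  map_smul x := by
    obtain ⟨r, rfl⟩ := Ideal.Quotient.mk_surjective x
    exact Ideal.Quotient.eq_zero_iff_mem.2
      (Ideal.mem_sup_right (Ideal.mul_mem_right r _ (Ideal.mem_span_singleton_self b)))
  ker := by
    rintro k _ ⟨r, hr, rfl⟩ h
    have h' : r ∈ I ⊔ Ideal.span {b} := Ideal.Quotient.eq_zero_iff_mem.1 h
    obtain ⟨i, hi, j, hj, e⟩ := Submodule.mem_sup.1 h'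
    obtain ⟨c, rfl⟩ := Ideal.mem_span_singleton'.1 hj
    -- The cofactor `c` need not be homogeneous. Its component of the right degree serves as well,
    -- because `I` contains the components of its elements.
    refine ⟨_, ⟨homogComp (k - u) c, isHomog_homogComp _ _, rfl⟩, ?_⟩
    refine Ideal.Quotient.eq.2 (?_ : b * homogComp (k - u) c - r ∈ I)
    have e' := congrArg (homogComp (k - u + p)) e
    rw [map_add, homogComp_mul hb, (hr.cast (by ring : k + p - u = k - u + p)).homogComp_eq] at e'
    rw [← e', show b * homogComp (k - u) c - (homogComp (k - u + p) i + homogComp (k - u) c * b) =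
      -homogComp (k - u + p) i by ring]
    exact neg_mem (hI _ hi _)
  inj x hx := by
    obtain ⟨r, rfl⟩ := Ideal.Quotient.mk_surjective x
    exact Ideal.Quotient.eq_zero_iff_mem.2 (hreg _ (Ideal.Quotient.eq_zero_iff_mem.1 hx))

end GrMod

/-! ### Quotient rings as factorizations in one parity -/

namespace Pre
variable {σ : Type} {n : ℕ}

/-- `(ℚ[σ] / I){u}` in even parity. -/
def quot (n : ℕ) (I : Ideal (MvPolynomial σ ℚ)) (u : ℤ) : Pre σ n where
  M0 := GrMod.quot I u
  M1 := GrMod.zero σ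
  d0 := 0
  d1 := 0
  d0_deg _ _ _ := trivial
  d1_deg _ _ _ := AddSubgroup.zero_mem _

theorem hasPot_quot {I : Ideal (MvPolynomial σ ℚ)} {u : ℤ} {w : MvPolynomial σ ℚ} (hw : w ∈ I) :
    (quot n I u).HasPot w where
  d1_d0 x := by
    obtain ⟨r, rfl⟩ := Ideal.Quotient.mk_surjective x
    exact (Ideal.Quotient.eq_zero_iff_mem.2 (Ideal.mul_mem_right r _ hw)).symm
  d0_d1 _ := rfl

/-- `quot n I u → quot n (I + (b)) (u + s)`. -/
def quotMor (n : ℕ) (I : Ideal (MvPolynomial σ ℚ)) (b : MvPolynomial σ ℚ) (u s : ℤ) :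
    Mor (quot n I u) (quot n (I ⊔ Ideal.span {b}) (u + s)) where
  f0 := Submodule.factor le_sup_left
  f1 := 0
  comm0 _ := rfl
  comm1 _ := map_zero (Submodule.factor (M := MvPolynomial σ ℚ)
    (le_sup_left : I ≤ I ⊔ Ideal.span {b}))

/-- Both components of a morphism are quotients by the regular element `b`. -/
structure Mor.RegQuot {N N' : Pre σ n} (q : Mor N N') (b : MvPolynomial σ ℚ) (s p : ℤ) : Prop where
  h0 : GrMod.RegQuot N.M0 N'.M0 q.f0 b s p
  h1 : GrMod.RegQuot N.M1 N'.M1 q.f1 b s p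

/-- The components of `ext` are sums of shifted copies of those of `N`, so `b` stays regular after
further rows are attached. An outer row can thus be killed while inner rows are still present. -/
theorem Mor.RegQuot.ext {N N' : Pre σ n} {q : Mor N N'} {b : MvPolynomial σ ℚ} {s p : ℤ}
    (h : q.RegQuot b s p) {a c : MvPolynomial σ ℚ} {u v : ℤ} (ha : IsHomog a (n + 1 + u - v))
    (hc : IsHomog c (n + 1 + v - u)) : (q.ext ha hc u v ha hc).RegQuot b s p :=
  ⟨h.h0.prodShift h.h1 u v, h.h0.prodShift h.h1 v u⟩

theorem regQuot_quotMor {I : Ideal (MvPolynomial σ ℚ)} (hI : IsHomogIdeal I)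
    {b : MvPolynomial σ ℚ} {p : ℤ} (hb : IsHomog b p) (hreg : ∀ y, b * y ∈ I → y ∈ I) (u s : ℤ) :
    (quotMor n I b u s).RegQuot b s p :=
  ⟨GrMod.regQuot_quot hI hb hreg u s, GrMod.RegQuot.zero b s p⟩

section Lifting
variable {ι β : Type} {w : MvPolynomial β ℚ}

/-- There is a morphism along which maps from free factorizations lift. -/
def Resolves (w : MvPolynomial β ℚ) (T T' : Pre (ι ⊕ β) n) : Prop := ∃ p : Mor T T', Lifts w p

theorem Resolves.trans {T T' T'' : Pre (ι ⊕ β) n} (h : Resolves w T T') (h' : Resolves w T' T'') :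
    Resolves w T T'' := by
  obtain ⟨p, hp⟩ := h
  obtain ⟨q, hq⟩ := h'
  exact ⟨_, hq.comp hp⟩

theorem Resolves.swap {T T' : Pre (ι ⊕ β) n} (h : Resolves w T T') :
    Resolves w T.swap T'.swap := by
  obtain ⟨p, hp⟩ := h
  exact ⟨_, hp.swap⟩

theorem Iso.resolves {T T' : Pre (ι ⊕ β) n} (e : Iso T T') : Resolves w T T' := ⟨_, e.lifts w⟩

theorem Mor.RegQuot.resolves {N N' : Pre (ι ⊕ β) n} {q : Mor N N'} {a b : MvPolynomial (ι ⊕ β) ℚ}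
    {s t : ℤ} (h : q.RegQuot b s (n + 1 + t - s)) (ha : IsHomog a (n + 1 + s - t))
    (hb : IsHomog b (n + 1 + t - s)) {v : MvPolynomial (ι ⊕ β) ℚ} (hN : N.HasPot v)
    (hv : v + a * b = GrFree.incl ι β w) : Resolves w (N.ext a b s t ha hb) N' :=
  ⟨_, extProj_lifts h.h0 h.h1 hN hv⟩

/-- The row `(b, a)` is the row `(a, b)` with the parities interchanged, definitionally. Killing a
first entry therefore costs a `swap`. -/
theorem Mor.RegQuot.resolves_swap {N N' : Pre (ι ⊕ β) n} {q : Mor N N'}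
    {a b : MvPolynomial (ι ⊕ β) ℚ}
    {s t : ℤ} (h : q.RegQuot a t (n + 1 + s - t)) (ha : IsHomog a (n + 1 + s - t))
    (hb : IsHomog b (n + 1 + t - s)) {v : MvPolynomial (ι ⊕ β) ℚ} (hN : N.HasPot v)
    (hv : v + a * b = GrFree.incl ι β w) : Resolves w (N.ext a b s t ha hb) N'.swap :=
  (h.resolves hb ha hN (by rw [mul_comm, hv])).swap

end Lifting

end Pre

/-! ### Tensor products with free modules of small rank -/

section Chi
variable {A M M' : Type} [CommRing A] [AddCommGroup M'] [Module A M'] [AddCommGroup M]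
  [Module A M]

/-- `M ⊗ ((A ⊗ A) ⊕ (A ⊗ A)) ≅ M ⊕ M`. -/
def tensorSquare (A M : Type) [CommRing A] [AddCommGroup M] [Module A M] :
    M ⊗[A] ((A ⊗[A] A) × (A ⊗[A] A)) ≃ₗ[A] M × M :=
  (TensorProduct.congr (LinearEquiv.refl A M)
    ((TensorProduct.lid A A).prodCongr (TensorProduct.lid A A))).trans
  ((TensorProduct.prodRight A A M A A).trans
    ((TensorProduct.rid A M).prodCongr (TensorProduct.rid A M)))

theorem tensorSquare_tmul (m : M) (p q : A ⊗[A] A) : tensorSquare A M (m ⊗ₜ (p, q)) =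
    (TensorProduct.lid A A p • m, TensorProduct.lid A A q • m) := by
  simp [tensorSquare]

theorem tensorSquare_symm_apply (x y : M) : (tensorSquare A M).symm (x, y) =
    x ⊗ₜ[A] ((1 : A) ⊗ₜ[A] (1 : A), 0) + y ⊗ₜ[A] (0, (1 : A) ⊗ₜ[A] (1 : A)) := by
  rw [LinearEquiv.symm_apply_eq, map_add, tensorSquare_tmul, tensorSquare_tmul]
  simp

/-- Under the identification with `M × M`, a map given by a `2 × 2` matrix of scalars acts by that
matrix. -/
theorem lTensor_tensorSquare_symm
    {f : (A ⊗[A] A) × (A ⊗[A] A) →ₗ[A] (A ⊗[A] A) × (A ⊗[A] A)} {α β γ δ : A}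
    (h1 : f ((1 : A) ⊗ₜ[A] (1 : A), 0) = (α • (1 : A) ⊗ₜ[A] (1 : A), β • (1 : A) ⊗ₜ[A] (1 : A)))
    (h2 : f (0, (1 : A) ⊗ₜ[A] (1 : A)) = (γ • (1 : A) ⊗ₜ[A] (1 : A), δ • (1 : A) ⊗ₜ[A] (1 : A)))
    (x y : M) : LinearMap.lTensor M f ((tensorSquare A M).symm (x, y)) =
      (tensorSquare A M).symm (α • x + γ • y, β • x + δ • y) := by
  rw [LinearEquiv.eq_symm_apply, tensorSquare_symm_apply, map_add, LinearMap.lTensor_tmul,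
    LinearMap.lTensor_tmul, h1, h2, map_add, tensorSquare_tmul, tensorSquare_tmul]
  simp

theorem rTensor_tensorSquare_symm (g : M →ₗ[A] M') (x y : M) :
    LinearMap.rTensor _ g ((tensorSquare A M).symm (x, y)) =
      (tensorSquare A M').symm (g x, g y) := by
  rw [tensorSquare_symm_apply, tensorSquare_symm_apply, map_add, LinearMap.rTensor_tmul,
    LinearMap.rTensor_tmul]

theorem lTensor_lid_symm (f : M →ₗ[A] M') (x : M) :
    LinearMap.lTensor A f ((TensorProduct.lid A M).symm x) =
      (TensorProduct.lid A M').symm (f x) := rfl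

theorem rTensor_lid_symm (a : A) (x : M) :
    LinearMap.rTensor M (LinearMap.mulLeft A a) ((TensorProduct.lid A M).symm x) =
      (TensorProduct.lid A M).symm (a • x) := by
  rw [TensorProduct.lid_symm_apply, TensorProduct.lid_symm_apply, LinearMap.rTensor_tmul,
    LinearMap.mulLeft_apply, mul_one, TensorProduct.tmul_smul, TensorProduct.smul_tmul', smul_eq_mul,
    mul_one]

end Chi

namespace GrFree
variable {σ : Type}

theorem lid_mem {s k : ℤ} {M : GrFree σ} {z : ((base σ s).tensor M).carrier}
    (hz : z ∈ ((base σ s).tensor M).piece k) :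
    TensorProduct.lid (MvPolynomial σ ℚ) M.carrier z ∈ M.piece (k - s) := by
  refine AddSubgroup.closure_induction
    (p := fun z _ => TensorProduct.lid (MvPolynomial σ ℚ) M.carrier z ∈ M.piece (k - s))
    ?_ ?_ ?_ ?_ hz
  · rintro _ ⟨i, j, (x : MvPolynomial σ ℚ), y, hk, hx, hy, rfl⟩
    change x • y ∈ _
    exact GrMod.mem_cast (M := M.toGrMod) (M.toGrMod.smul_mem hx hy) (by rw [← hk]; ring)
  · rw [map_zero]; exact AddSubgroup.zero_mem _
  · intro x y _ _ hx hy; rw [map_add]; exact AddSubgroup.add_mem _ hx hy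
  · intro x _ hx; rw [map_neg]; exact AddSubgroup.neg_mem _ hx

theorem mem_iff_lid_symm {s k : ℤ} {M : GrFree σ} (x : M.carrier) :
    x ∈ M.piece (k - s) ↔ ((TensorProduct.lid (MvPolynomial σ ℚ) M.carrier).symm x :
      ((base σ s).tensor M).carrier) ∈ ((base σ s).tensor M).piece k := by
  constructor
  · intro hx
    exact AddSubgroup.subset_closure ⟨s, k - s, (1 : MvPolynomial σ ℚ), x, by ring,
      (IsHomog.one.cast (by ring) : IsHomog 1 (s - s)), hx, rfl⟩
  · intro hx
    have := lid_mem hx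
    rwa [LinearEquiv.apply_symm_apply] at this

theorem mem_iff_tensorSquare_symm {s₁ s₂ s₃ s₄ u k : ℤ} {M : GrFree σ} (x y : M.carrier) :
    x ∈ M.piece (k - u - s₁ - s₂) ∧ y ∈ M.piece (k - u - s₃ - s₄) ↔
      ((tensorSquare (MvPolynomial σ ℚ) M.carrier).symm (x, y) :
        (M.tensor ((((base σ s₁).tensor (base σ s₂)).prod
          ((base σ s₃).tensor (base σ s₄))).shift u)).carrier) ∈
      (M.tensor ((((base σ s₁).tensor (base σ s₂)).prod
          ((base σ s₃).tensor (base σ s₄))).shift u)).piece k := by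
  have one_mem (s t j : ℤ) (h : j = s + t) : ((1 : MvPolynomial σ ℚ) ⊗ₜ (1 : MvPolynomial σ ℚ) :
      ((base σ s).tensor (base σ t)).carrier) ∈ ((base σ s).tensor (base σ t)).piece j :=
    AddSubgroup.subset_closure ⟨s, t, (1 : MvPolynomial σ ℚ), (1 : MvPolynomial σ ℚ), h.symm,
      (IsHomog.one.cast (by ring) : IsHomog 1 (s - s)),
      (IsHomog.one.cast (by ring) : IsHomog 1 (t - t)), rfl⟩
  constructor
  · rintro ⟨hx, hy⟩
    rw [tensorSquare_symm_apply]
    refine AddSubgroup.add_mem _ (AddSubgroup.subset_closure ⟨k - u - s₁ - s₂, u + s₁ + s₂,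
        x, ((1 : MvPolynomial σ ℚ) ⊗ₜ (1 : MvPolynomial σ ℚ), 0), by ring, hx,
        ⟨one_mem _ _ _ (by ring), AddSubgroup.zero_mem _⟩, rfl⟩)
      (AddSubgroup.subset_closure ⟨k - u - s₃ - s₄, u + s₃ + s₄,
        y, (0, (1 : MvPolynomial σ ℚ) ⊗ₜ (1 : MvPolynomial σ ℚ)), by ring, hy,
        ⟨AddSubgroup.zero_mem _, one_mem _ _ _ (by ring)⟩, rfl⟩)
  · intro h
    suffices H : ∀ z ∈ (M.tensor ((((base σ s₁).tensor (base σ s₂)).prod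
          ((base σ s₃).tensor (base σ s₄))).shift u)).piece k,
        (tensorSquare (MvPolynomial σ ℚ) M.carrier z).1 ∈ M.piece (k - u - s₁ - s₂) ∧
        (tensorSquare (MvPolynomial σ ℚ) M.carrier z).2 ∈ M.piece (k - u - s₃ - s₄) by
      have := H _ h
      rwa [LinearEquiv.apply_symm_apply] at this
    intro z hz
    refine AddSubgroup.closure_induction (p := fun z _ =>
      (tensorSquare (MvPolynomial σ ℚ) M.carrier z).1 ∈ M.piece (k - u - s₁ - s₂) ∧
        (tensorSquare (MvPolynomial σ ℚ) M.carrier z).2 ∈ M.piece (k - u - s₃ - s₄))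
      ?_ ?_ ?_ ?_ hz
    · rintro _ ⟨i, j, x, ⟨p, q⟩, hk, hx, ⟨hp, hq⟩, rfl⟩
      refine (congrArg (fun v : M.carrier × M.carrier => v.1 ∈ M.piece (k - u - s₁ - s₂) ∧
        v.2 ∈ M.piece (k - u - s₃ - s₄)) (tensorSquare_tmul x p q)).mpr ?_
      exact ⟨GrMod.mem_cast (M := M.toGrMod) (M.toGrMod.smul_mem (lid_mem hp) hx)
          (by rw [← hk]; ring),
        GrMod.mem_cast (M := M.toGrMod) (M.toGrMod.smul_mem (lid_mem hq) hx)
          (by rw [← hk]; ring)⟩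
    · rw [map_zero]; exact ⟨AddSubgroup.zero_mem _, AddSubgroup.zero_mem _⟩
    · intro x y _ _ hx hy
      rw [map_add]
      exact ⟨AddSubgroup.add_mem _ hx.1 hy.1, AddSubgroup.add_mem _ hx.2 hy.2⟩
    · intro x _ hx
      rw [map_neg]
      exact ⟨AddSubgroup.neg_mem _ hx.1, AddSubgroup.neg_mem _ hx.2⟩

end GrFree

/-! ### Tensor products with Koszul factorizations as iterated `ext` -/

namespace Pre
variable {σ : Type} {n : ℕ}

/-- `{a, b}` as an `ext`. -/
def koszulIso (a b : MvPolynomial σ ℚ) (p : ℤ) (ha : IsHomog a p)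
    (hb : IsHomog b (2 * (n + 1) - p)) :
    Iso ((quot n ⊥ 0).ext a b 0 (n + 1 - p) (ha.cast (by ring)) (hb.cast (by ring)))
      (GrFact.koszul n a b p ha hb).toPre where
  e0 := (LinearEquiv.prodUnique (M₂ := PUnit)).trans (Submodule.quotEquivOfEqBot ⊥ rfl)
  e1 := (LinearEquiv.prodUnique (M₂ := PUnit)).trans (Submodule.quotEquivOfEqBot ⊥ rfl)
  mem0 := by
    rintro k ⟨x, y⟩
    obtain ⟨x, rfl⟩ := Ideal.Quotient.mk_surjective x
    constructor
    · rintro ⟨⟨r, hr, e⟩, -⟩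
      have e' : r = x := sub_eq_zero.1 (Ideal.Quotient.eq.1 e)
      subst e'
      exact (hr.cast (by ring) : IsHomog r (k - 0))
    · intro (hx : IsHomog x (k - 0))
      exact ⟨⟨x, hx.cast (by ring), rfl⟩, trivial⟩
  mem1 := by
    rintro k ⟨x, y⟩
    obtain ⟨x, rfl⟩ := Ideal.Quotient.mk_surjective x
    constructor
    · rintro ⟨⟨r, hr, e⟩, -⟩
      have e' : r = x := sub_eq_zero.1 (Ideal.Quotient.eq.1 e)
      subst e'
      exact (hr.cast (by ring) : IsHomog r (k - (n + 1 - p)))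
    · intro (hx : IsHomog x (k - (n + 1 - p)))
      exact ⟨⟨x, hx.cast (by ring), rfl⟩, trivial⟩
  comm0 := by
    rintro ⟨x, y⟩
    obtain ⟨x, rfl⟩ := Ideal.Quotient.mk_surjective x
    change a * x + 0 = a * x
    rw [add_zero]
  comm1 := by
    rintro ⟨x, y⟩
    obtain ⟨x, rfl⟩ := Ideal.Quotient.mk_surjective x
    change b * x + 0 = b * x
    rw [add_zero]

variable {w : MvPolynomial σ ℚ}

/-- `{a, b} ⊗ M` as an `ext`. -/
def koszulTensorIso (M : GrFact σ n w) (a b : MvPolynomial σ ℚ) (p u : ℤ) (ha : IsHomog a p)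
    (hb : IsHomog b (2 * (n + 1) - p)) :
    Iso (M.toPre.ext a b u (n + 1 - p + u) (ha.cast (by ring)) (hb.cast (by ring)))
      (((GrFact.koszul n a b p ha hb).tensor M).shift u).toPre where
  e0 := LinearEquiv.prodCongr (TensorProduct.lid (MvPolynomial σ ℚ) M.M0.carrier).symm
    -- In `tensor` the sign falls on the differential of `M`, in `ext` on the scalars `a`, `b`.
    -- Negating the component odd in both factors reconciles the two conventions.
    ((LinearEquiv.neg _).trans (TensorProduct.lid (MvPolynomial σ ℚ) M.M1.carrier).symm)
  e1 := (LinearEquiv.prodComm _ _ _).trans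
    (LinearEquiv.prodCongr (TensorProduct.lid (MvPolynomial σ ℚ) M.M1.carrier).symm
      (TensorProduct.lid (MvPolynomial σ ℚ) M.M0.carrier).symm)
  mem0 k x := by
    refine and_congr ?_ ?_
    · refine Iff.trans ?_ (GrFree.mem_iff_lid_symm x.1)
      exact iff_of_eq (congrArg (x.1 ∈ M.M0.piece ·) (by ring))
    · refine Iff.trans ?_ (GrFree.mem_iff_lid_symm (-x.2))
      refine Iff.trans (iff_of_eq (congrArg (x.2 ∈ M.M1.piece ·) (?_ : _ = k - u - (n + 1 - p))))
        (AddSubgroup.neg_mem_iff _).symm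
      ring
  mem1 k x := by
    refine Iff.trans (and_congr ?_ ?_) and_comm
    · refine Iff.trans ?_ (GrFree.mem_iff_lid_symm x.1)
      exact iff_of_eq (congrArg (x.1 ∈ M.M0.piece ·) (by ring))
    · refine Iff.trans ?_ (GrFree.mem_iff_lid_symm x.2)
      exact iff_of_eq (congrArg (x.2 ∈ M.M1.piece ·) (by ring))
  comm0 := by
    rintro ⟨(x : M.M0.carrier), (y : M.M1.carrier)⟩
    refine Prod.ext ?_ ?_
    · change (TensorProduct.lid (MvPolynomial σ ℚ) M.M1.carrier).symm (M.d0 x + -(b • y)) =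
        LinearMap.lTensor _ M.d0 ((TensorProduct.lid (MvPolynomial σ ℚ) M.M0.carrier).symm x) +
        LinearMap.rTensor M.M1.carrier (LinearMap.mulLeft _ b)
          ((TensorProduct.lid (MvPolynomial σ ℚ) M.M1.carrier).symm (-y))
      rw [rTensor_lid_symm, lTensor_lid_symm, ← map_add, smul_neg]
    · change (TensorProduct.lid (MvPolynomial σ ℚ) M.M0.carrier).symm (a • x + M.d1 y) =
        LinearMap.rTensor M.M0.carrier (LinearMap.mulLeft _ a)
          ((TensorProduct.lid (MvPolynomial σ ℚ) M.M0.carrier).symm x) +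
        -LinearMap.lTensor _ M.d1 ((TensorProduct.lid (MvPolynomial σ ℚ) M.M1.carrier).symm (-y))
      rw [rTensor_lid_symm, lTensor_lid_symm, map_neg, map_neg, neg_neg, ← map_add]
  comm1 := by
    rintro ⟨(x : M.M0.carrier), (y : M.M1.carrier)⟩
    refine Prod.ext ?_ ?_
    · change (TensorProduct.lid (MvPolynomial σ ℚ) M.M0.carrier).symm (b • x + M.d1 y) =
        LinearMap.lTensor _ M.d1 ((TensorProduct.lid (MvPolynomial σ ℚ) M.M1.carrier).symm y) +
        LinearMap.rTensor M.M0.carrier (LinearMap.mulLeft _ b)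
          ((TensorProduct.lid (MvPolynomial σ ℚ) M.M0.carrier).symm x)
      rw [rTensor_lid_symm, lTensor_lid_symm, ← map_add, add_comm]
    · change (TensorProduct.lid (MvPolynomial σ ℚ) M.M1.carrier).symm (-(M.d0 x + -(a • y))) =
        LinearMap.rTensor M.M1.carrier (LinearMap.mulLeft _ a)
          ((TensorProduct.lid (MvPolynomial σ ℚ) M.M1.carrier).symm y) +
        -LinearMap.lTensor _ M.d0 ((TensorProduct.lid (MvPolynomial σ ℚ) M.M0.carrier).symm x)
      rw [rTensor_lid_symm, lTensor_lid_symm, ← map_neg, ← map_add]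
      congr 1
      abel

theorem smul_tmul_one (a : MvPolynomial σ ℚ) :
    LinearMap.rTensor (MvPolynomial σ ℚ) (LinearMap.mulLeft (MvPolynomial σ ℚ) a)
      ((1 : MvPolynomial σ ℚ) ⊗ₜ[MvPolynomial σ ℚ] (1 : MvPolynomial σ ℚ)) = a • 1 ⊗ₜ 1 ∧
    LinearMap.lTensor (MvPolynomial σ ℚ) (LinearMap.mulLeft (MvPolynomial σ ℚ) a)
      ((1 : MvPolynomial σ ℚ) ⊗ₜ[MvPolynomial σ ℚ] (1 : MvPolynomial σ ℚ)) = a • 1 ⊗ₜ 1 := by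
  constructor
  · rw [LinearMap.rTensor_tmul, TensorProduct.smul_tmul', LinearMap.mulLeft_apply, smul_eq_mul]
  · rw [LinearMap.lTensor_tmul, ← TensorProduct.tmul_smul, LinearMap.mulLeft_apply, smul_eq_mul]

section Square
variable {a b c d : MvPolynomial σ ℚ} {p p' u : ℤ} {ha : IsHomog a p}
  {hb : IsHomog b (2 * (n + 1) - p)} {hc : IsHomog c p'} {hd : IsHomog d (2 * (n + 1) - p')}

local notation "A₂" => MvPolynomial σ ℚ ⊗[MvPolynomial σ ℚ] MvPolynomial σ ℚ

/-- The differential `d0` of `{a, b} ⊗ {c, d}`, with explicit types. -/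
def sqD0 (a b c d : MvPolynomial σ ℚ) : A₂ × A₂ →ₗ[MvPolynomial σ ℚ] A₂ × A₂ :=
  LinearMap.prod (LinearMap.coprod (LinearMap.lTensor _ (LinearMap.mulLeft _ c))
      (LinearMap.rTensor _ (LinearMap.mulLeft _ b)))
    (LinearMap.coprod (LinearMap.rTensor _ (LinearMap.mulLeft _ a))
      (-LinearMap.lTensor _ (LinearMap.mulLeft _ d)))

theorem sqD0_fst : sqD0 a b c d ((1 : MvPolynomial σ ℚ) ⊗ₜ (1 : MvPolynomial σ ℚ), 0) =
    (c • 1 ⊗ₜ 1, a • 1 ⊗ₜ 1) := by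
  simp only [sqD0, LinearMap.prod_apply, Function.prod, LinearMap.coprod_apply, map_zero, add_zero,
    (smul_tmul_one _).1, (smul_tmul_one _).2]

theorem sqD0_snd : sqD0 a b c d (0, (1 : MvPolynomial σ ℚ) ⊗ₜ (1 : MvPolynomial σ ℚ)) =
    (b • 1 ⊗ₜ 1, (-d) • 1 ⊗ₜ 1) := by
  simp only [sqD0, LinearMap.prod_apply, Function.prod, LinearMap.coprod_apply, map_zero, zero_add,
    (smul_tmul_one _).1, (smul_tmul_one _).2, LinearMap.neg_apply]
  refine Prod.ext rfl ?_
  module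

/-- `M ⊗ ({a, b} ⊗ {c, d}){u}` as an iterated `ext`. -/
def tensorKoszulKoszulIso (M : GrFact σ n w) (a b c d : MvPolynomial σ ℚ) (p p' u : ℤ)
    (ha : IsHomog a p) (hb : IsHomog b (2 * (n + 1) - p)) (hc : IsHomog c p')
    (hd : IsHomog d (2 * (n + 1) - p')) :
    Iso ((M.toPre.ext c d 0 (n + 1 - p') (hc.cast (by ring)) (hd.cast (by ring))).ext
        a b u (n + 1 - p + u) (ha.cast (by ring)) (hb.cast (by ring)))
      (M.tensor (((GrFact.koszul n a b p ha hb).tensor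
        (GrFact.koszul n c d p' hc hd)).shift u)).toPre where
  e0 :=
    LinearEquiv.trans (M₂ := (M.M0.carrier × M.M0.carrier) × (M.M1.carrier × M.M1.carrier))
    (σ₁₂ := RingHom.id (MvPolynomial σ ℚ)) (σ₂₁ := RingHom.id (MvPolynomial σ ℚ))
    { toFun := fun x => ((x.1.1, -x.2.1), (x.1.2, x.2.2))
      invFun := fun x => ((x.1.1, x.2.1), (-x.1.2, x.2.2))
      left_inv := fun x => Prod.ext rfl (Prod.ext (neg_neg x.2.1) rfl)
      right_inv := fun x => Prod.ext (Prod.ext rfl (neg_neg x.1.2)) rfl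
      map_add' := fun x y => Prod.ext (Prod.ext rfl (neg_add x.2.1 y.2.1)) rfl
      map_smul' := fun r x => Prod.ext (Prod.ext rfl (smul_neg r x.2.1).symm) rfl }
    ((tensorSquare _ M.M0.carrier).symm.prodCongr (tensorSquare _ M.M1.carrier).symm)
  e1 :=
    LinearEquiv.trans (M₂ := (M.M0.carrier × M.M0.carrier) × (M.M1.carrier × M.M1.carrier))
    (σ₁₂ := RingHom.id (MvPolynomial σ ℚ)) (σ₂₁ := RingHom.id (MvPolynomial σ ℚ))
    { toFun := fun x => ((x.2.1, x.1.1), (x.2.2, -x.1.2))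
      invFun := fun x => ((x.1.2, -x.2.2), (x.1.1, x.2.1))
      left_inv := fun x => Prod.ext (Prod.ext rfl (neg_neg x.1.2)) rfl
      right_inv := fun x => Prod.ext rfl (Prod.ext rfl (neg_neg x.2.2))
      map_add' := fun x y => Prod.ext rfl (Prod.ext rfl (neg_add x.1.2 y.1.2))
      map_smul' := fun r x => Prod.ext rfl (Prod.ext rfl (smul_neg r x.1.2).symm) }
    ((tensorSquare _ M.M0.carrier).symm.prodCongr (tensorSquare _ M.M1.carrier).symm)
  mem0 := by
    rintro k ⟨⟨(x : M.M0.carrier), (y : M.M1.carrier)⟩,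
      ⟨(z : M.M0.carrier), (v : M.M1.carrier)⟩⟩
    refine Iff.trans ?_ (and_congr (GrFree.mem_iff_tensorSquare_symm x (-z))
      (GrFree.mem_iff_tensorSquare_symm y v))
    constructor
    · rintro ⟨⟨h1, h2⟩, h3, h4⟩
      exact ⟨⟨GrMod.mem_cast h1 (by ring), AddSubgroup.neg_mem _ (GrMod.mem_cast h3 (by ring))⟩,
        GrMod.mem_cast h2 (by ring), GrMod.mem_cast h4 (by ring)⟩
    · rintro ⟨⟨h1, h3⟩, h2, h4⟩
      exact ⟨⟨GrMod.mem_cast (M := M.M0.toGrMod) h1 (by ring),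
        GrMod.mem_cast (M := M.M1.toGrMod) h2 (by ring)⟩,
        GrMod.mem_cast (M := M.M0.toGrMod) ((AddSubgroup.neg_mem_iff _).1 h3) (by ring),
        GrMod.mem_cast (M := M.M1.toGrMod) h4 (by ring)⟩
  mem1 := by
    rintro k ⟨⟨(x : M.M0.carrier), (y : M.M1.carrier)⟩,
      ⟨(z : M.M0.carrier), (v : M.M1.carrier)⟩⟩
    refine Iff.trans ?_ (and_congr (GrFree.mem_iff_tensorSquare_symm z x)
      (GrFree.mem_iff_tensorSquare_symm v (-y)))
    constructor
    · rintro ⟨⟨h1, h2⟩, h3, h4⟩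
      exact ⟨⟨GrMod.mem_cast h3 (by ring), GrMod.mem_cast h1 (by ring)⟩,
        GrMod.mem_cast h4 (by ring), AddSubgroup.neg_mem _ (GrMod.mem_cast h2 (by ring))⟩
    · rintro ⟨⟨h3, h1⟩, h4, h2⟩
      exact ⟨⟨GrMod.mem_cast (M := M.M0.toGrMod) h1 (by ring),
        GrMod.mem_cast (M := M.M1.toGrMod) ((AddSubgroup.neg_mem_iff _).1 h2) (by ring)⟩,
        GrMod.mem_cast (M := M.M0.toGrMod) h3 (by ring),
        GrMod.mem_cast (M := M.M1.toGrMod) h4 (by ring)⟩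
  comm0 := by
    rintro ⟨⟨(x : M.M0.carrier), (y : M.M1.carrier)⟩,
      ⟨(z : M.M0.carrier), (v : M.M1.carrier)⟩⟩
    refine Prod.ext ?_ ?_
    · change (tensorSquare _ M.M0.carrier).symm
          (c • x + M.d1 y + -(b • z), a • x + (d • z + M.d1 v)) =
        LinearMap.lTensor M.M0.carrier (sqD0 a b c d) ((tensorSquare _ M.M0.carrier).symm (x, -z)) +
        LinearMap.rTensor _ M.d1 ((tensorSquare _ M.M1.carrier).symm (y, v))
      rw [lTensor_tensorSquare_symm sqD0_fst sqD0_snd, rTensor_tensorSquare_symm, ← map_add,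
        Prod.mk_add_mk]
      congr 1
      refine Prod.ext ?_ ?_ <;> module
    -- `sqD0` with `c` and `d` exchanged is the differential `d1` of `{a, b} ⊗ {c, d}`.
    · change (tensorSquare _ M.M1.carrier).symm
          (M.d0 x + -(d • y) + -(b • v), -(a • y + (M.d0 z + -(c • v)))) =
        LinearMap.rTensor _ M.d0 ((tensorSquare _ M.M0.carrier).symm (x, -z)) +
        -LinearMap.lTensor M.M1.carrier (sqD0 a b d c) ((tensorSquare _ M.M1.carrier).symm (y, v))
      rw [lTensor_tensorSquare_symm sqD0_fst sqD0_snd, rTensor_tensorSquare_symm, ← map_neg,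
        ← map_add, Prod.neg_mk, Prod.mk_add_mk, map_neg]
      congr 1
      refine Prod.ext ?_ ?_ <;> module
  comm1 := by
    rintro ⟨⟨(x : M.M0.carrier), (y : M.M1.carrier)⟩,
      ⟨(z : M.M0.carrier), (v : M.M1.carrier)⟩⟩
    refine Prod.ext ?_ ?_
    · change (tensorSquare _ M.M0.carrier).symm
          (b • x + (d • z + M.d1 v), -(c • x + M.d1 y + -(a • z))) =
        LinearMap.lTensor M.M0.carrier (sqD0 a b d c) ((tensorSquare _ M.M0.carrier).symm (z, x)) +
        LinearMap.rTensor _ M.d1 ((tensorSquare _ M.M1.carrier).symm (v, -y))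
      rw [lTensor_tensorSquare_symm sqD0_fst sqD0_snd, rTensor_tensorSquare_symm, ← map_add,
        Prod.mk_add_mk, map_neg]
      congr 1
      refine Prod.ext ?_ ?_ <;> module
    · change (tensorSquare _ M.M1.carrier).symm
          (b • y + (M.d0 z + -(c • v)), M.d0 x + -(d • y) + -(a • v)) =
        LinearMap.rTensor _ M.d0 ((tensorSquare _ M.M0.carrier).symm (z, x)) +
        -LinearMap.lTensor M.M1.carrier (sqD0 a b c d) ((tensorSquare _ M.M1.carrier).symm (v, -y))
      rw [lTensor_tensorSquare_symm sqD0_fst sqD0_snd, rTensor_tensorSquare_symm, ← map_neg,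
        ← map_add, Prod.neg_mk, Prod.mk_add_mk]
      congr 1
      refine Prod.ext ?_ ?_ <;> module

end Square

end Pre

namespace GrFact
variable {σ : Type} {n : ℕ} {w : MvPolynomial σ ℚ}

/-! ### Factorizations determined by a module -/

/-- The difference of two homomorphisms. -/
def Hom.sub {M N : GrFact σ n w} (f g : Hom M N) : Hom M N where
  f0 := f.f0 - g.f0
  f1 := f.f1 - g.f1
  f0_deg k x hx := AddSubgroup.sub_mem _ (f.f0_deg k x hx) (g.f0_deg k x hx)
  f1_deg k x hx := AddSubgroup.sub_mem _ (f.f1_deg k x hx) (g.f1_deg k x hx)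
  comm0 x := by simp [f.comm0, g.comm0]
  comm1 x := by simp [f.comm1, g.comm1]

/-- `h0, h1` is a homotopy from `f` to `0`. -/
structure IsNullHomotopy {M N : GrFact σ n w} (f : Hom M N)
    (h0 : M.M0.carrier →ₗ[MvPolynomial σ ℚ] N.M1.carrier)
    (h1 : M.M1.carrier →ₗ[MvPolynomial σ ℚ] N.M0.carrier) : Prop where
  deg0 : ∀ k x, x ∈ M.M0.piece k → h0 x ∈ N.M1.piece (k - n - 1)
  deg1 : ∀ k x, x ∈ M.M1.piece k → h1 x ∈ N.M0.piece (k - n - 1)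
  eq0 : ∀ x, f.f0 x = h1 (M.d0 x) + N.d1 (h0 x)
  eq1 : ∀ x, f.f1 x = h0 (M.d1 x) + N.d0 (h1 x)

/-- Homotopy classes of maps into `M` are graded maps to `Q` that vanish on the image of `d0`. -/
structure IsResolution (M : GrFact σ n w) (Q : GrMod σ)
    (ε : M.M1.carrier →ₗ[MvPolynomial σ ℚ] Q.carrier) : Prop where
  deg : ∀ k x, x ∈ M.M1.piece k → ε x ∈ Q.piece k
  comm : ∀ x, ε (M.d0 x) = 0
  lift : ∀ (P : GrFact σ n w) (φ : P.M1.carrier →ₗ[MvPolynomial σ ℚ] Q.carrier),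
    (∀ k x, x ∈ P.M1.piece k → φ x ∈ Q.piece k) → (∀ x, φ (P.d0 x) = 0) →
    ∃ f : Hom P M, ∀ x, ε (f.f1 x) = φ x
  null : ∀ (P : GrFact σ n w) (f : Hom P M), (∀ x, ε (f.f1 x) = 0) →
    ∃ h0 h1, IsNullHomotopy f h0 h1

/-- Graded isomorphisms of graded modules. -/
structure _root_.MatFact.GrMod.Iso (Q Q' : GrMod σ) where
  e : Q.carrier ≃ₗ[MvPolynomial σ ℚ] Q'.carrier
  mem : ∀ k x, x ∈ Q.piece k ↔ e x ∈ Q'.piece k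

theorem IsResolution.trans {M : GrFact σ n w} {Q Q' : GrMod σ}
    {ε : M.M1.carrier →ₗ[MvPolynomial σ ℚ] Q.carrier} (h : IsResolution M Q ε)
    (e : GrMod.Iso Q Q') : IsResolution M Q' (e.e.toLinearMap ∘ₗ ε) where
  deg k x hx := (e.mem _ _).1 (h.deg k x hx)
  comm x := by simp [h.comm]
  lift P φ hφ hφ' := by
    obtain ⟨f, hf⟩ := h.lift P (e.e.symm.toLinearMap ∘ₗ φ)
      (fun k x hx => (e.mem _ _).2 (by simpa using hφ k x hx)) (fun x => by simp [hφ'])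
    exact ⟨f, fun x => by simp [hf]⟩
  null P f hf := h.null P f fun x => e.e.injective (by simpa using hf x)

theorem IsResolution.prod {M N : GrFact σ n w} {Q Q' : GrMod σ}
    {ε : M.M1.carrier →ₗ[MvPolynomial σ ℚ] Q.carrier}
    {ε' : N.M1.carrier →ₗ[MvPolynomial σ ℚ] Q'.carrier} (h : IsResolution M Q ε)
    (h' : IsResolution N Q' ε') :
    IsResolution (M.prod N) (Q.prodShift Q' 0 0) (ε.prodMap ε') where
  deg k x hx := ⟨GrMod.mem_cast (h.deg _ _ hx.1) (by ring),
    GrMod.mem_cast (h'.deg _ _ hx.2) (by ring)⟩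
  comm x := Prod.ext (h.comm x.1) (h'.comm x.2)
  lift P φ hφ hφ' := by
    obtain ⟨f, hf⟩ := h.lift P (LinearMap.fst _ _ _ ∘ₗ φ)
      (fun k x hx => GrMod.mem_cast (hφ k x hx).1 (by ring))
      (fun x => congrArg Prod.fst (hφ' x))
    obtain ⟨g, hg⟩ := h'.lift P (LinearMap.snd _ _ _ ∘ₗ φ)
      (fun k x hx => GrMod.mem_cast (hφ k x hx).2 (by ring))
      (fun x => congrArg Prod.snd (hφ' x))
    exact ⟨⟨f.f0.prod g.f0, f.f1.prod g.f1, fun k x hx => ⟨f.f0_deg k x hx, g.f0_deg k x hx⟩,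
      fun k x hx => ⟨f.f1_deg k x hx, g.f1_deg k x hx⟩,
      fun x => Prod.ext (f.comm0 x) (g.comm0 x), fun x => Prod.ext (f.comm1 x) (g.comm1 x)⟩,
      fun x => Prod.ext (hf x) (hg x)⟩
  null P f hf := by
    let f₁ : Hom P M := ⟨LinearMap.fst _ _ _ ∘ₗ f.f0, LinearMap.fst _ _ _ ∘ₗ f.f1,
      fun k x hx => (f.f0_deg k x hx).1, fun k x hx => (f.f1_deg k x hx).1,
      fun x => congrArg Prod.fst (f.comm0 x), fun x => congrArg Prod.fst (f.comm1 x)⟩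
    let f₂ : Hom P N := ⟨LinearMap.snd _ _ _ ∘ₗ f.f0, LinearMap.snd _ _ _ ∘ₗ f.f1,
      fun k x hx => (f.f0_deg k x hx).2, fun k x hx => (f.f1_deg k x hx).2,
      fun x => congrArg Prod.snd (f.comm0 x), fun x => congrArg Prod.snd (f.comm1 x)⟩
    obtain ⟨a0, a1, ha⟩ := h.null P f₁ fun x => congrArg Prod.fst (hf x)
    obtain ⟨b0, b1, hb⟩ := h'.null P f₂ fun x => congrArg Prod.snd (hf x)
    exact ⟨a0.prod b0, a1.prod b1, fun k x hx => ⟨ha.deg0 k x hx, hb.deg0 k x hx⟩,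
      fun k x hx => ⟨ha.deg1 k x hx, hb.deg1 k x hx⟩,
      fun x => Prod.ext (ha.eq0 x) (hb.eq0 x), fun x => Prod.ext (ha.eq1 x) (hb.eq1 x)⟩

theorem IsResolution.pi {m : ℕ} {M : Fin m → GrFact σ n w} {Q : Fin m → GrMod σ}
    {ε : ∀ i, (M i).M1.carrier →ₗ[MvPolynomial σ ℚ] (Q i).carrier}
    (h : ∀ i, IsResolution (M i) (Q i) (ε i)) :
    IsResolution (GrFact.pi M) (GrMod.pi Q)
      (LinearMap.pi fun i => ε i ∘ₗ LinearMap.proj i) where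
  deg k x hx i _ := (h i).deg _ _ (hx i trivial)
  comm x := funext fun i => (h i).comm (x i)
  lift P φ hφ hφ' := by
    choose f hf using fun i => (h i).lift P (LinearMap.proj i ∘ₗ φ)
      (fun k x hx => hφ k x hx i trivial) (fun x => congrFun (hφ' x) i)
    exact ⟨⟨LinearMap.pi fun i => (f i).f0, LinearMap.pi fun i => (f i).f1,
      fun k x hx i _ => (f i).f0_deg k x hx, fun k x hx i _ => (f i).f1_deg k x hx,
      fun x => funext fun i => (f i).comm0 x, fun x => funext fun i => (f i).comm1 x⟩,
      fun x => funext fun i => hf i x⟩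
  null P f hf := by
    let g (i : Fin m) : Hom P (M i) := ⟨LinearMap.proj i ∘ₗ f.f0, LinearMap.proj i ∘ₗ f.f1,
      fun k x hx => f.f0_deg k x hx i trivial, fun k x hx => f.f1_deg k x hx i trivial,
      fun x => congrFun (f.comm0 x) i, fun x => congrFun (f.comm1 x) i⟩
    choose a0 a1 ha using fun i => (h i).null P (g i) fun x => congrFun (hf x) i
    exact ⟨LinearMap.pi a0, LinearMap.pi a1, fun k x hx i _ => (ha i).deg0 k x hx,
      fun k x hx i _ => (ha i).deg1 k x hx, fun x => funext fun i => (ha i).eq0 x,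
      fun x => funext fun i => (ha i).eq1 x⟩

/-- A homotopy equivalence. -/
theorem IsResolution.exists_equiv {M N : GrFact σ n w} {Q : GrMod σ}
    {ε : M.M1.carrier →ₗ[MvPolynomial σ ℚ] Q.carrier}
    {ε' : N.M1.carrier →ₗ[MvPolynomial σ ℚ] Q.carrier} (h : IsResolution M Q ε)
    (h' : IsResolution N Q ε') :
    ∃ (f : M ⟶ N) (g : N ⟶ M), Homotopic (f ≫ g) (𝟙 M) ∧ Homotopic (g ≫ f) (𝟙 N) := by
  -- Each augmentation is lifted through the other resolution. The composites differ from the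
  -- identities by maps that the augmentations kill, so these differences are null-homotopic.
  obtain ⟨f, hf⟩ := h'.lift M ε h.deg h.comm
  obtain ⟨g, hg⟩ := h.lift N ε' h'.deg h'.comm
  let f' : M ⟶ N := f
  let g' : N ⟶ M := g
  obtain ⟨a0, a1, ha⟩ := h.null M (Hom.sub (f' ≫ g') (𝟙 M)) fun x => by
    change ε (g.f1 (f.f1 x) - x) = 0
    rw [map_sub, hg, hf, sub_self]
  obtain ⟨b0, b1, hb⟩ := h'.null N (Hom.sub (g' ≫ f') (𝟙 N)) fun x => by
    change ε' (f.f1 (g.f1 x) - x) = 0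
    rw [map_sub, hf, hg, sub_self]
  exact ⟨f', g', ⟨a0, a1, ha.deg0, ha.deg1, ha.eq0, ha.eq1⟩,
    ⟨b0, b1, hb.deg0, hb.deg1, hb.eq0, hb.eq1⟩⟩

/-! ### Resolutions over the boundary ring from lifting properties -/

section OfLifts
variable {ι β : Type} {w : MvPolynomial β ℚ}

/-- A semilinear map as a linear map to the restriction. -/
def toRestrict {P : Type} [AddCommGroup P] [Module (MvPolynomial β ℚ) P] {M : GrMod (ι ⊕ β)}
    (f : P →ₛₗ[GrFree.incl ι β] M.carrier) : P →ₗ[MvPolynomial β ℚ] M.restrict.carrier where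
  toFun := f
  map_add' := f.map_add
  map_smul' := f.map_smulₛₗ

/-- A linear map to the restriction as a semilinear map. -/
def ofRestrict {P : Type} [AddCommGroup P] [Module (MvPolynomial β ℚ) P] {M : GrMod (ι ⊕ β)}
    (f : P →ₗ[MvPolynomial β ℚ] M.restrict.carrier) : P →ₛₗ[GrFree.incl ι β] M.carrier where
  toFun := f
  map_add' := f.map_add
  map_smul' := f.map_smul

/-- Restriction of a linear map. -/
def restrictMap {M N : GrMod (ι ⊕ β)}
    (f : M.carrier →ₗ[MvPolynomial (ι ⊕ β) ℚ] N.carrier) :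
    M.restrict.carrier →ₗ[MvPolynomial β ℚ] N.restrict.carrier where
  toFun := f
  map_add' := f.map_add
  map_smul' r x := f.map_smul (GrFree.incl ι β r) x

theorem IsResolution.of_lifts {X : GrFact (ι ⊕ β) n (GrFree.incl ι β w)}
    {I : Ideal (MvPolynomial (ι ⊕ β) ℚ)} {u : ℤ} {p : Pre.Mor X.toPre (Pre.quot n I u).swap}
    (h : Pre.Lifts w p) :
    IsResolution X.restrict (GrMod.quot I u).restrict (restrictMap p.f1) where
  deg := h.deg1
  comm := p.comm0
  lift P φ hφ hφ' := by
    -- The target is zero in even parity, so a chain map to it is just a graded `φ` on `P.M1` with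
    -- `φ ∘ d0 = 0`.
    obtain ⟨g0, g1, hg, -, e1⟩ := h.lift P 0 (ofRestrict φ)
      ⟨fun _ _ _ => trivial, hφ, hφ', fun _ => rfl⟩
    exact ⟨⟨toRestrict g0, toRestrict g1, hg.deg0, hg.deg1, hg.comm0, hg.comm1⟩, e1⟩
  null P f hf := by
    obtain ⟨h0, h1, hh⟩ := h.null P (ofRestrict (M := X.M0.toGrMod) f.f0)
      (ofRestrict (M := X.M1.toGrMod) f.f1) 0 0
      ⟨f.f0_deg, f.f1_deg, f.comm0, f.comm1⟩
      ⟨fun _ _ _ => AddSubgroup.zero_mem _, fun _ _ _ => trivial, fun _ => rfl,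
        fun x => (hf x).trans (zero_add (0 : (GrMod.quot I u).carrier)).symm⟩
    exact ⟨toRestrict h0, toRestrict h1, hh.deg0, hh.deg1, hh.eq0, hh.eq1⟩

theorem IsResolution.susp_of_lifts {X : GrFact (ι ⊕ β) n (GrFree.incl ι β w)}
    {I : Ideal (MvPolynomial (ι ⊕ β) ℚ)} {u : ℤ} {p : Pre.Mor X.toPre (Pre.quot n I u)}
    (h : Pre.Lifts w p) (s : ℤ) :
    IsResolution (X.restrict.susp.shift s) ((GrMod.quot I u).restrict.shift s)
      (restrictMap p.f0) where
  deg k x := h.deg0 (k - s) x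
  comm x := (p.f0.map_neg (X.d1 x)).trans (neg_eq_zero.mpr (p.comm1 x))
  lift P φ hφ hφ' := by
    -- Maps from `P` to `X⟨1⟩{s}` are maps from `P⟨1⟩{-s}` to `X`; the two signs in the
    -- differentials match.
    obtain ⟨g0, g1, hg, e0, -⟩ := h.lift (P.susp.shift (-s))
      (ofRestrict (M := GrMod.quot I u) φ) 0
      ⟨fun k x hx => GrMod.mem_cast (hφ _ x hx) (by ring), fun _ _ _ => trivial, fun _ => rfl,
        fun x => (φ.map_neg (P.d0 x)).trans (neg_eq_zero.mpr (hφ' x))⟩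
    have hc0 (x) : g1 (-P.d1 x) = X.d0 (g0 x) := hg.comm0 x
    have hc1 (x) : g0 (-P.d0 x) = X.d1 (g1 x) := hg.comm1 x
    refine ⟨⟨toRestrict (M := X.M1.toGrMod) g1, toRestrict (M := X.M0.toGrMod) g0,
      fun k x hx => hg.deg1 (k - s) x (GrMod.mem_cast (M := P.M0.toGrMod) hx (by ring)),
      fun k x hx => hg.deg0 (k - s) x (GrMod.mem_cast (M := P.M1.toGrMod) hx (by ring)),
      fun x => ?_, fun x => ?_⟩, e0⟩
    · exact neg_eq_iff_eq_neg.mp ((g0.map_neg (P.d0 x)).symm.trans (hc1 x))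
    · exact neg_eq_iff_eq_neg.mp ((g1.map_neg (P.d1 x)).symm.trans (hc0 x))
  null P f hf := by
    have fc0 (x) : f.f1 (P.d0 x) = -X.d1 (f.f0 x) := f.comm0 x
    have fc1 (x) : f.f0 (P.d1 x) = -X.d0 (f.f1 x) := f.comm1 x
    obtain ⟨h0, h1, hh⟩ := h.null (P.susp.shift (-s)) (ofRestrict (M := X.M0.toGrMod) f.f1)
      (ofRestrict (M := X.M1.toGrMod) f.f0) 0 0
      ⟨fun k x hx => GrMod.mem_cast (M := X.M0.toGrMod) (f.f1_deg _ x hx) (by ring),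
        fun k x hx => GrMod.mem_cast (M := X.M1.toGrMod) (f.f0_deg _ x hx) (by ring),
        fun x => (f.f0.map_neg (P.d1 x)).trans (neg_eq_iff_eq_neg.mpr (fc1 x)),
        fun x => (f.f1.map_neg (P.d0 x)).trans (neg_eq_iff_eq_neg.mpr (fc0 x))⟩
      ⟨fun _ _ _ => trivial, fun _ _ _ => AddSubgroup.zero_mem _,
        fun x => (hf x).trans (zero_add (0 : (GrMod.quot I u).carrier)).symm, fun _ => rfl⟩
    let k0 : P.M1.carrier →ₛₗ[GrFree.incl ι β] X.M1.carrier := h0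
    let k1 : P.M0.carrier →ₛₗ[GrFree.incl ι β] X.M0.carrier := h1
    have he0 (x) : f.f1 x = k1 (-P.d1 x) + X.d1 (k0 x) := hh.eq0 x
    have he1 (x) : f.f0 x = k0 (-P.d0 x) + X.d0 (k1 x) := hh.eq1 x
    refine ⟨toRestrict (M := X.M0.toGrMod) (-h1), toRestrict (M := X.M1.toGrMod) (-h0),
      fun k x hx => ?_, fun k x hx => ?_, fun x => ?_, fun x => ?_⟩
    · exact AddSubgroup.neg_mem _ (GrMod.mem_cast (M := X.M0.toGrMod) (hh.deg1 (k - s) x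
        (GrMod.mem_cast (M := P.M0.toGrMod) hx (by ring))) (by ring))
    · exact AddSubgroup.neg_mem _ (GrMod.mem_cast (M := X.M1.toGrMod) (hh.deg0 (k - s) x
        (GrMod.mem_cast (M := P.M1.toGrMod) hx (by ring))) (by ring))
    · change f.f0 x = -k0 (P.d0 x) + -X.d0 (-k1 x)
      rw [X.d0.map_neg, neg_neg, ← k0.map_neg]
      exact he1 x
    · change f.f1 x = -k1 (P.d1 x) + -X.d1 (-k0 x)
      rw [X.d1.map_neg, neg_neg, ← k1.map_neg]
      exact he0 x

end OfLifts

/-! ### Finiteness of the cohomology -/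

theorem finite_of_injective {V W : Type} [AddCommGroup V] [Module (MvPolynomial σ ℚ) V]
    [AddCommGroup W] [Module (MvPolynomial σ ℚ) W] (f : V →ₗ[MvPolynomial σ ℚ] W)
    (hf : Function.Injective f) [Module.Finite ℚ (RestrictScalars ℚ (MvPolynomial σ ℚ) W)] :
    Module.Finite ℚ (RestrictScalars ℚ (MvPolynomial σ ℚ) V) := by
  let _ : Module ℚ V := Module.compHom V (algebraMap ℚ (MvPolynomial σ ℚ))
  let _ : Module ℚ W := Module.compHom W (algebraMap ℚ (MvPolynomial σ ℚ))
  have fin : Module.Finite ℚ W := ‹_›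
  let g : V →ₗ[ℚ] W :=
    { toFun := f
      map_add' := f.map_add
      map_smul' := fun c x => f.map_smul (algebraMap ℚ (MvPolynomial σ ℚ) c) x }
  exact Module.Finite.of_injective g hf

theorem finite_of_surjective {V W : Type} [AddCommGroup V] [Module (MvPolynomial σ ℚ) V]
    [AddCommGroup W] [Module (MvPolynomial σ ℚ) W] (f : V →ₗ[MvPolynomial σ ℚ] W)
    (hf : Function.Surjective f) [Module.Finite ℚ (RestrictScalars ℚ (MvPolynomial σ ℚ) V)] :
    Module.Finite ℚ (RestrictScalars ℚ (MvPolynomial σ ℚ) W) := by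
  let g : RestrictScalars ℚ (MvPolynomial σ ℚ) V →ₗ[ℚ] RestrictScalars ℚ (MvPolynomial σ ℚ) W :=
    { toFun := f
      map_add' := f.map_add
      map_smul' := fun c x => f.map_smul (algebraMap ℚ (MvPolynomial σ ℚ) c) x }
  exact Module.Finite.of_surjective g hf

theorem sub_C_mem_maxIdeal (r : MvPolynomial σ ℚ) : ∃ c : ℚ, r - MvPolynomial.C c ∈ maxIdeal σ := by
  induction r using MvPolynomial.induction_on with
  | C a => exact ⟨a, by simp⟩
  | add p q hp hq =>
    obtain ⟨a, ha⟩ := hp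
    obtain ⟨b, hb⟩ := hq
    refine ⟨a + b, ?_⟩
    rw [map_add, add_sub_add_comm]
    exact add_mem ha hb
  | mul_X p i _ =>
    exact ⟨0, by
      rw [map_zero, sub_zero]
      exact Ideal.mul_mem_left _ _ (Ideal.subset_span ⟨i, rfl⟩)⟩

theorem finite_red (M : GrFree σ) [Module.Finite (MvPolynomial σ ℚ) M.carrier] :
    Module.Finite ℚ (RestrictScalars ℚ (MvPolynomial σ ℚ) (Red M)) := by
  obtain ⟨S, hS⟩ := (Module.Finite.of_surjective _
    (Submodule.mkQ_surjective (maxIdeal σ • ⊤ : Submodule (MvPolynomial σ ℚ) M.carrier))).fg_top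
  refine ⟨⟨S, ?_⟩⟩
  rw [eq_top_iff]
  rintro (x : Red M) -
  have hx : x ∈ Submodule.span (MvPolynomial σ ℚ) (S : Set (Red M)) := hS ▸ trivial
  induction hx using Submodule.span_induction with
  | mem x hx => exact Submodule.subset_span hx
  | zero => exact Submodule.zero_mem _
  | add x y _ _ hx hy => exact Submodule.add_mem _ hx hy
  | smul r x _ hx =>
    -- A polynomial acts on `M / 𝔪 M` through its constant term, so generators over the polynomial
    -- ring already span over `ℚ`.
    obtain ⟨c, hc⟩ := sub_C_mem_maxIdeal r
    have : r • x = (MvPolynomial.C c : MvPolynomial σ ℚ) • x := by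
      rw [← sub_eq_zero, ← sub_smul]
      obtain ⟨y, rfl⟩ := Submodule.mkQ_surjective _ x
      rw [← map_smul]
      exact (Submodule.Quotient.mk_eq_zero _).2 (Submodule.smul_mem_smul hc trivial)
    rw [this]
    exact Submodule.smul_mem _ c hx

theorem finDimCohomology_of_finite (M : GrFact σ n w)
    (h0 : Module.Finite (MvPolynomial σ ℚ) M.M0.carrier)
    (h1 : Module.Finite (MvPolynomial σ ℚ) M.M1.carrier) : FinDimCohomology M := by
  have f0 := finite_red M.M0
  have f1 := finite_red M.M1
  have k0 := finite_of_injective (LinearMap.ker (redMap M.d0)).subtype Subtype.val_injective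
  have k1 := finite_of_injective (LinearMap.ker (redMap M.d1)).subtype Subtype.val_injective
  exact ⟨finite_of_surjective (Submodule.mkQ _) (Submodule.mkQ_surjective _),
    finite_of_surjective (Submodule.mkQ _) (Submodule.mkQ_surjective _)⟩

/-- The cohomology of a retract up to homotopy is finite-dimensional. -/
theorem finite_cohomology_of_homotopy {V V₁ V' V₁' : Type} [AddCommGroup V] [AddCommGroup V₁]
    [AddCommGroup V'] [AddCommGroup V₁'] [Module (MvPolynomial σ ℚ) V]
    [Module (MvPolynomial σ ℚ) V₁] [Module (MvPolynomial σ ℚ) V'] [Module (MvPolynomial σ ℚ) V₁']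
    {a : V →ₗ[MvPolynomial σ ℚ] V₁} {b : V₁ →ₗ[MvPolynomial σ ℚ] V}
    {a' : V' →ₗ[MvPolynomial σ ℚ] V₁'} {b' : V₁' →ₗ[MvPolynomial σ ℚ] V'}
    {f : V →ₗ[MvPolynomial σ ℚ] V'} {f₁ : V₁ →ₗ[MvPolynomial σ ℚ] V₁'}
    {g : V' →ₗ[MvPolynomial σ ℚ] V} {g₁ : V₁' →ₗ[MvPolynomial σ ℚ] V₁}
    {h : V →ₗ[MvPolynomial σ ℚ] V₁} {h₁ : V₁ →ₗ[MvPolynomial σ ℚ] V}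
    (hf : ∀ x, f₁ (a x) = a' (f x)) (hf₁ : ∀ x, f (b x) = b' (f₁ x))
    (hg : ∀ x, g (b' x) = b (g₁ x)) (hh : ∀ x, g (f x) - x = h₁ (a x) + b (h x))
    (fin : Module.Finite ℚ (RestrictScalars ℚ (MvPolynomial σ ℚ)
      (LinearMap.ker a' ⧸ (LinearMap.range b').submoduleOf (LinearMap.ker a')))) :
    Module.Finite ℚ (RestrictScalars ℚ (MvPolynomial σ ℚ)
      (LinearMap.ker a ⧸ (LinearMap.range b).submoduleOf (LinearMap.ker a))) := by
  let φ : LinearMap.ker a →ₗ[MvPolynomial σ ℚ] LinearMap.ker a' :=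
    f.restrict fun x hx => by
      rw [LinearMap.mem_ker, ← hf, LinearMap.mem_ker.1 hx, map_zero]
  refine finite_of_injective (Submodule.mapQ _ ((LinearMap.range b').submoduleOf _) φ ?_) ?_
  · rintro ⟨x, hx⟩ ⟨y, rfl⟩
    exact ⟨f₁ y, (hf₁ y).symm⟩
  · refine (injective_iff_map_eq_zero _).2 fun x hx => ?_
    obtain ⟨⟨x, hx'⟩, rfl⟩ := Submodule.mkQ_surjective _ x
    obtain ⟨y, hy⟩ := (Submodule.Quotient.mk_eq_zero _).1 hx
    replace hy : b' y = f x := hy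
    -- If `f x = b' y` and `a x = 0`, then `b (g₁ y) = g (f x) = x + b (h x)`. So `x` is a boundary,
    -- and the map on cohomology is injective.
    refine (Submodule.Quotient.mk_eq_zero _).2 ⟨g₁ y - h x, ?_⟩
    have := hh x
    rw [LinearMap.mem_ker.1 hx', map_zero, zero_add, ← hy, hg] at this
    change b (g₁ y - h x) = x
    rw [map_sub, ← this, sub_sub_cancel]

/-- This serves `C(Γ)`, whose modules have infinite rank over the boundary ring because of the
internal marks. -/
theorem FinDimCohomology.of_homotopic {M N : GrFact σ n w} (f : M ⟶ N) (g : N ⟶ M)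
    (h : Homotopic (f ≫ g) (𝟙 M)) (hN : FinDimCohomology N) : FinDimCohomology M := by
  obtain ⟨h0, h1, -, -, e0, e1⟩ := h
  constructor
  · refine finite_cohomology_of_homotopy (f := redMap (Hom.f0 f)) (f₁ := redMap (Hom.f1 f))
      (g := redMap (Hom.f0 g)) (g₁ := redMap (Hom.f1 g)) (h := redMap h0) (h₁ := redMap h1)
      ?_ ?_ ?_ ?_ hN.1 <;> intro x <;> obtain ⟨x, rfl⟩ := Submodule.mkQ_surjective _ x
    · exact congrArg (Submodule.mkQ _) (Hom.comm0 f x)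
    · exact congrArg (Submodule.mkQ _) (Hom.comm1 f x)
    · exact congrArg (Submodule.mkQ _) (Hom.comm1 g x)
    · exact congrArg (Submodule.mkQ _) (e0 x)
  · refine finite_cohomology_of_homotopy (f := redMap (Hom.f1 f)) (f₁ := redMap (Hom.f0 f))
      (g := redMap (Hom.f1 g)) (g₁ := redMap (Hom.f0 g)) (h := redMap h1) (h₁ := redMap h0)
      ?_ ?_ ?_ ?_ hN.2 <;> intro x <;> obtain ⟨x, rfl⟩ := Submodule.mkQ_surjective _ x
    · exact congrArg (Submodule.mkQ _) (Hom.comm1 f x)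
    · exact congrArg (Submodule.mkQ _) (Hom.comm0 f x)
    · exact congrArg (Submodule.mkQ _) (Hom.comm0 g x)
    · exact congrArg (Submodule.mkQ _) (e1 x)

/-- A homotopy equivalence is an isomorphism in `hmf_w`. -/
theorem hmf_iso {M N : GrFact σ n w} (hM : FinDimCohomology M) (hN : FinDimCohomology N)
    (f : M ⟶ N) (g : N ⟶ M) (hfg : Homotopic (f ≫ g) (𝟙 M)) (hgf : Homotopic (g ≫ f) (𝟙 N)) :
    Nonempty (Hmf.of M hM ≅ Hmf.of N hN) := by
  let F : (⟨M, hM⟩ : Mf σ n w) ⟶ ⟨N, hN⟩ := ⟨f⟩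
  let G : (⟨N, hN⟩ : Mf σ n w) ⟶ ⟨M, hM⟩ := ⟨g⟩
  refine ⟨⟨(Quotient.functor (Mf.Homotopic σ n w)).map F,
    (Quotient.functor (Mf.Homotopic σ n w)).map G, ?_, ?_⟩⟩
  · refine ((Quotient.functor _).map_comp F G).symm.trans ?_
    exact (CategoryTheory.Quotient.sound (Mf.Homotopic σ n w) (a := ⟨M, hM⟩) (b := ⟨M, hM⟩)
      (f₁ := F ≫ G) (f₂ := 𝟙 _) hfg).trans ((Quotient.functor _).map_id _)
  · refine ((Quotient.functor _).map_comp G F).symm.trans ?_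
    exact (CategoryTheory.Quotient.sound (Mf.Homotopic σ n w) (a := ⟨N, hN⟩) (b := ⟨N, hN⟩)
      (f₁ := G ≫ F) (f₂ := 𝟙 _) hgf).trans ((Quotient.functor _).map_id _)

end GrFact

namespace Pre
variable {σ : Type} {n : ℕ}

/-! ### Resolutions by products of two and of four Koszul factorizations -/

/-- The identity map. -/
def Iso.refl (T : Pre σ n) : Iso T T where
  e0 := LinearEquiv.refl _ _
  e1 := LinearEquiv.refl _ _
  mem0 _ _ := Iff.rfl
  mem1 _ _ := Iff.rfl
  comm0 _ := rfl
  comm1 _ := rfl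

/-- Rewriting the shifts in `ext`. -/
def extCongr (N : Pre σ n) {a b : MvPolynomial σ ℚ} {s t s' t' : ℤ}
    (ha : IsHomog a (n + 1 + s - t)) (hb : IsHomog b (n + 1 + t - s))
    (ha' : IsHomog a (n + 1 + s' - t')) (hb' : IsHomog b (n + 1 + t' - s'))
    (hs : s = s') (ht : t = t') : Iso (N.ext a b s t ha hb) (N.ext a b s' t' ha' hb') := by
  subst hs ht
  exact Iso.refl _

/-- `M{0} ≅ M`. -/
def shiftZeroIso {w : MvPolynomial σ ℚ} (M : GrFact σ n w) : Iso (M.shift 0).toPre M.toPre where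
  e0 := LinearEquiv.refl _ _
  e1 := LinearEquiv.refl _ _
  mem0 k x := by
    change x ∈ M.M0.piece (k - 0) ↔ x ∈ M.M0.piece k
    rw [sub_zero]
  mem1 k x := by
    change x ∈ M.M1.piece (k - 0) ↔ x ∈ M.M1.piece k
    rw [sub_zero]
  comm0 _ := rfl
  comm1 _ := rfl

variable {ι β : Type} {w : MvPolynomial β ℚ}

/-- The outer entry `b` goes first, with the row `(c, d)` still attached. Then `d` is killed over
the quotient by `I + (b)`, on which the remaining potential `v + a b` vanishes. -/
theorem resolves_ext_ext {a b c d : MvPolynomial (ι ⊕ β) ℚ} {s t s' t' : ℤ}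
    {I : Ideal (MvPolynomial (ι ⊕ β) ℚ)} {u : ℤ} {v : MvPolynomial (ι ⊕ β) ℚ}
    (ha : IsHomog a (n + 1 + s - t)) (hb : IsHomog b (n + 1 + t - s))
    (hc : IsHomog c (n + 1 + s' - t')) (hd : IsHomog d (n + 1 + t' - s'))
    (hI : IsHomogIdeal I) (hv : v ∈ I) (hw : v + c * d + a * b = GrFree.incl ι β w)
    (h₁ : ∀ y, b * y ∈ I → y ∈ I)
    (h₂ : ∀ y, d * y ∈ I ⊔ Ideal.span {b} → y ∈ I ⊔ Ideal.span {b}) :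
    Resolves w (((quot n I u).ext c d s' t' hc hd).ext a b s t ha hb)
      (quot n (I ⊔ Ideal.span {b} ⊔ Ideal.span {d}) (u + s + s')) := by
  refine (((regQuot_quotMor hI hb h₁ u s).ext hc hd).resolves ha hb (hasPot_quot hv).ext hw).trans ?_
  refine (regQuot_quotMor (hI.sup_span hb) hd h₂ (u + s) s').resolves hc hd
    (hasPot_quot (w := v + a * b) ?_) (by rw [← hw]; ring)
  exact add_mem (Ideal.mem_sup_left hv)
    (Ideal.mem_sup_right (Ideal.mul_mem_left _ _ (Ideal.mem_span_singleton_self b)))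

theorem resolves_ext_ext_swap {a b c d : MvPolynomial (ι ⊕ β) ℚ} {s t s' t' : ℤ}
    {I : Ideal (MvPolynomial (ι ⊕ β) ℚ)} {u : ℤ} {v : MvPolynomial (ι ⊕ β) ℚ}
    (ha : IsHomog a (n + 1 + s - t)) (hb : IsHomog b (n + 1 + t - s))
    (hc : IsHomog c (n + 1 + s' - t')) (hd : IsHomog d (n + 1 + t' - s'))
    (hI : IsHomogIdeal I) (hv : v ∈ I) (hw : v + c * d + a * b = GrFree.incl ι β w)
    (h₁ : ∀ y, a * y ∈ I → y ∈ I)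
    (h₂ : ∀ y, d * y ∈ I ⊔ Ideal.span {a} → y ∈ I ⊔ Ideal.span {a}) :
    Resolves w (((quot n I u).ext c d s' t' hc hd).ext a b s t ha hb)
      (quot n (I ⊔ Ideal.span {a} ⊔ Ideal.span {d}) (u + t + s')).swap := by
  refine (((regQuot_quotMor hI ha h₁ u t).ext hc hd).resolves_swap ha hb
    (hasPot_quot hv).ext hw).trans (Resolves.swap ?_)
  refine (regQuot_quotMor (hI.sup_span ha) hd h₂ (u + t) s').resolves hc hd
    (hasPot_quot (w := v + b * a) ?_) (by rw [← hw]; ring)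
  exact add_mem (Ideal.mem_sup_left hv)
    (Ideal.mem_sup_right (Ideal.mul_mem_left _ _ (Ideal.mem_span_singleton_self a)))

theorem resolves_koszul_tensor {a b c d : MvPolynomial (ι ⊕ β) ℚ} {p p' : ℤ}
    (ha : IsHomog a p) (hb : IsHomog b (2 * (n + 1) - p)) (hc : IsHomog c p')
    (hd : IsHomog d (2 * (n + 1) - p')) (hw : a * b + c * d = GrFree.incl ι β w)
    (h₁ : ∀ y, b * y ∈ (⊥ : Ideal _) → y ∈ (⊥ : Ideal _))
    (h₂ : ∀ y, d * y ∈ ⊥ ⊔ Ideal.span {b} → y ∈ ⊥ ⊔ Ideal.span {b}) :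
    Resolves w ((GrFact.koszul n a b p ha hb).tensor (GrFact.koszul n c d p' hc hd)).toPre
      (quot n (⊥ ⊔ Ideal.span {b} ⊔ Ideal.span {d}) 0) := by
  refine (((Iso.ext (koszulIso c d p' hc hd) a b 0 (n + 1 - p + 0) (ha.cast (by ring))
    (hb.cast (by ring))).trans (koszulTensorIso _ a b p 0 ha hb)).trans
      (shiftZeroIso _)).symm.resolves.trans ?_
  exact resolves_ext_ext _ _ _ _ .bot (zero_mem _) (by rw [← hw]; ring) h₁ h₂

/-- The row operation yields the rows `(c - a, d)` and `(a, d + b)`. Killing `d + b` and the first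
entry `c - a` lands in odd parity, where the module of `Γ` lives. -/
theorem resolves_koszul_tensor_rowOp {a b c d : MvPolynomial (ι ⊕ β) ℚ} {p : ℤ}
    (ha : IsHomog a p) (hb : IsHomog b (2 * (n + 1) - p)) (hc : IsHomog c p)
    (hd : IsHomog d (2 * (n + 1) - p)) (hw : a * b + c * d = GrFree.incl ι β w)
    (h₁ : ∀ y, (d + b) * y ∈ (⊥ : Ideal _) → y ∈ (⊥ : Ideal _))
    (h₂ : ∀ y, (c - a) * y ∈ ⊥ ⊔ Ideal.span {d + b} → y ∈ ⊥ ⊔ Ideal.span {d + b}) :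
    Resolves w ((GrFact.koszul n a b p ha hb).tensor (GrFact.koszul n c d p hc hd)).toPre
      (quot n (⊥ ⊔ Ideal.span {d + b} ⊔ Ideal.span {c - a}) (n + 1 - p)).swap := by
  refine (((Iso.ext (koszulIso c d p hc hd) a b 0 (n + 1 - p + 0) (ha.cast (by ring))
    (hb.cast (by ring))).trans (koszulTensorIso _ a b p 0 ha hb)).trans
      (shiftZeroIso _)).symm.resolves.trans ?_
  -- `Iso.rowOp` wants literally equal shifts on both rows, so the `+ 0` left by the shift
  -- isomorphism has to go.
  refine (extCongr _ _ _ (ha.cast (by ring)) (hb.cast (by ring)) rfl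
    (add_zero ((n : ℤ) + 1 - p))).resolves.trans ?_
  refine (Iso.rowOp _ c d a b _ _ _ _ _ _).resolves.trans ?_
  refine (((regQuot_quotMor .bot ((hd.add hb).cast (by ring)) h₁ 0 0).ext _ _).resolves _ _
    (hasPot_quot (zero_mem _)).ext (by rw [← hw]; ring)).trans ?_
  have := (regQuot_quotMor (n := n) (IsHomogIdeal.bot.sup_span (hd.add hb))
    ((hc.sub ha).cast (by ring)) h₂ (0 + 0) (n + 1 - p)).resolves_swap (w := w) (s := 0)
    ((hc.sub ha).cast (by ring)) (hd.cast (by ring)) (hasPot_quot (w := a * (d + b))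
      (Ideal.mem_sup_right (Ideal.mul_mem_left _ _ (Ideal.mem_span_singleton_self _))))
    (by rw [← hw]; ring)
  rwa [zero_add, zero_add] at this

/-- The entries are killed in the order `b₃`, `b₁`, `a₄`, `b₂`. The single first entry `a₄` accounts
for the odd parity and for the summand `n + 1 - q'` of the shift. -/
theorem resolves_koszul_tensor_tensor {a₁ b₁ a₂ b₂ a₃ b₃ a₄ b₄ : MvPolynomial (ι ⊕ β) ℚ}
    {p p' q q' u u' : ℤ} (ha₁ : IsHomog a₁ p) (hb₁ : IsHomog b₁ (2 * (n + 1) - p))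
    (ha₂ : IsHomog a₂ p') (hb₂ : IsHomog b₂ (2 * (n + 1) - p'))
    (ha₃ : IsHomog a₃ q) (hb₃ : IsHomog b₃ (2 * (n + 1) - q))
    (ha₄ : IsHomog a₄ q') (hb₄ : IsHomog b₄ (2 * (n + 1) - q'))
    (hw : a₁ * b₁ + a₂ * b₂ + (a₃ * b₃ + a₄ * b₄) = GrFree.incl ι β w)
    (h₃ : ∀ y, b₃ * y ∈ (⊥ : Ideal _) → y ∈ (⊥ : Ideal _))
    (h₁ : ∀ y, b₁ * y ∈ ⊥ ⊔ Ideal.span {b₃} → y ∈ ⊥ ⊔ Ideal.span {b₃})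
    (h₄ : ∀ y, a₄ * y ∈ ⊥ ⊔ Ideal.span {b₃} ⊔ Ideal.span {b₁} →
      y ∈ ⊥ ⊔ Ideal.span {b₃} ⊔ Ideal.span {b₁})
    (h₂ : ∀ y, b₂ * y ∈ ⊥ ⊔ Ideal.span {b₃} ⊔ Ideal.span {b₁} ⊔ Ideal.span {a₄} →
      y ∈ ⊥ ⊔ Ideal.span {b₃} ⊔ Ideal.span {b₁} ⊔ Ideal.span {a₄}) :
    Resolves w ((((GrFact.koszul n a₁ b₁ p ha₁ hb₁).tensor
      (GrFact.koszul n a₂ b₂ p' ha₂ hb₂)).shift u).tensor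
      (((GrFact.koszul n a₃ b₃ q ha₃ hb₃).tensor
        (GrFact.koszul n a₄ b₄ q' ha₄ hb₄)).shift u')).toPre
      (quot n (⊥ ⊔ Ideal.span {b₃} ⊔ Ideal.span {b₁} ⊔ Ideal.span {a₄} ⊔ Ideal.span {b₂})
        (u' + u + (n + 1 - q'))).swap := by
  let e := (Iso.ext (koszulIso a₂ b₂ p' ha₂ hb₂) a₁ b₁ u (n + 1 - p + u) (ha₁.cast (by ring))
    (hb₁.cast (by ring))).trans (koszulTensorIso _ a₁ b₁ p u ha₁ hb₁)
  refine (((e.ext a₄ b₄ 0 (n + 1 - q') (ha₄.cast (by ring)) (hb₄.cast (by ring))).ext a₃ b₃ u'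
    (n + 1 - q + u') (ha₃.cast (by ring)) (hb₃.cast (by ring))).trans
      (tensorKoszulKoszulIso _ a₃ b₃ a₄ b₄ q q' u' ha₃ hb₃ ha₄ hb₄)).symm.resolves.trans ?_
  -- Rows are killed from the outside inwards, so row `1` is moved outside row `4`.
  refine (Iso.ext (Iso.extComm _ _ _ _ _ _ _ _ _ _ _ _ _) _ _ _ _ _ _).resolves.trans ?_
  have ha₁' : IsHomog a₁ (n + 1 + u - (n + 1 - p + u)) := ha₁.cast (by ring)
  have hb₁' : IsHomog b₁ (n + 1 + (n + 1 - p + u) - u) := hb₁.cast (by ring)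
  have hb₃' : IsHomog b₃ (n + 1 + (n + 1 - q + u') - u') := hb₃.cast (by ring)
  have mem {I : Ideal (MvPolynomial (ι ⊕ β) ℚ)} (a b) : a * b ∈ I ⊔ Ideal.span {b} :=
    Ideal.mem_sup_right (Ideal.mul_mem_left _ _ (Ideal.mem_span_singleton_self b))
  refine (((((regQuot_quotMor .bot hb₃' h₃ 0 u').ext _ _).ext _ _).ext _ _).resolves _ _
    (hasPot_quot (zero_mem _)).ext.ext.ext (by rw [← hw]; ring)).trans ?_
  refine ((((regQuot_quotMor (.sup_span .bot hb₃) hb₁' h₁ (0 + u') u).ext _ _).ext _ _).resolves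
    ha₁' hb₁' (hasPot_quot (mem a₃ b₃)).ext.ext (by rw [← hw]; ring)).trans ?_
  have := resolves_ext_ext_swap (n := n) (w := w) (u := 0 + u' + u) (s := 0) (t := n + 1 - q')
    (s' := 0) (t' := n + 1 - p') (ha₄.cast (by ring)) (hb₄.cast (by ring)) (ha₂.cast (by ring))
    (hb₂.cast (by ring)) ((IsHomogIdeal.bot.sup_span hb₃).sup_span hb₁)
    (v := a₃ * b₃ + a₁ * b₁) (add_mem (Ideal.mem_sup_left (mem _ _)) (mem _ _))
    (by rw [← hw]; ring) h₄ h₂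
  rw [show u' + u + ((n : ℤ) + 1 - q') = 0 + u' + u + (n + 1 - q') + 0 by ring]
  exact this

end Pre

/-! ### An ideal in a polynomial ring in one variable -/

section OneVariable
open Polynomial
variable {B : Type} [CommRing B]

/-- The polynomial `r₀ + ∑ rᵢ t^(i+1)`. -/
def remPoly {m : ℕ} (r₀ : B) (r : Fin m → B) : B[X] := C r₀ + ∑ i, C (r i) * X ^ (i.1 + 1)

theorem coeff_remPoly_zero {m : ℕ} (r₀ : B) (r : Fin m → B) : (remPoly r₀ r).coeff 0 = r₀ := by
  rw [remPoly, coeff_add, coeff_C_zero, finsetSum_coeff, Finset.sum_eq_zero, add_zero]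
  intro i _
  rw [coeff_C_mul_X_pow, if_neg (by omega)]

theorem coeff_remPoly_succ {m : ℕ} (r₀ : B) (r : Fin m → B) (i : Fin m) :
    (remPoly r₀ r).coeff (i.1 + 1) = r i := by
  rw [remPoly, coeff_add, coeff_C_succ, zero_add, finsetSum_coeff, Finset.sum_eq_single i]
  · rw [coeff_C_mul_X_pow, if_pos rfl]
  · intro j _ hj
    rw [coeff_C_mul_X_pow, if_neg fun h => hj (Fin.ext (by omega))]
  · simp

theorem degree_remPoly_lt {m : ℕ} (r₀ : B) (r : Fin m → B) :
    (remPoly r₀ r).degree < ((m + 1 : ℕ) : WithBot ℕ) := by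
  refine (degree_add_le _ _).trans_lt (max_lt (degree_C_le.trans_lt (by exact_mod_cast m.succ_pos))
    ((degree_sum_le _ _).trans_lt ((Finset.sup_lt_iff (WithBot.bot_lt_coe _)).2 fun i _ =>
      (degree_C_mul_X_pow_le _ _).trans_lt ?_)))
  exact_mod_cast Nat.succ_lt_succ i.2

theorem exists_eq_remPoly {m : ℕ} {F : B[X]} (hF : F.degree < ((m + 1 : ℕ) : WithBot ℕ)) :
    ∃ r₀ r, F = remPoly (m := m) r₀ r := by
  refine ⟨F.coeff 0, fun i => F.coeff (i.1 + 1), ext fun k => ?_⟩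
  rcases k with _ | k
  · rw [coeff_remPoly_zero]
  · by_cases hk : k < m
    · exact (coeff_remPoly_succ _ (fun i : Fin m => F.coeff (i.1 + 1)) ⟨k, hk⟩).symm
    · have : ((m + 1 : ℕ) : WithBot ℕ) ≤ ((k + 1 : ℕ) : WithBot ℕ) := by exact_mod_cast by omega
      rw [coeff_eq_zero_of_degree_lt (hF.trans_le this),
        coeff_eq_zero_of_degree_lt ((degree_remPoly_lt _ _).trans_le this)]

/-- Division with remainder by `U`, rescaled to be monic. -/
theorem exists_eq_mul_add_remPoly [Nontrivial B] {m : ℕ} {U : B[X]} (hU : IsUnit U.leadingCoeff)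
    (hd : U.natDegree = m + 1) (F : B[X]) :
    ∃ q r₀ r, F = q * U + remPoly (m := m) r₀ r := by
  obtain ⟨c, hc⟩ := hU.exists_left_inv
  have hV : (C c * U).Monic := by
    rw [Monic, leadingCoeff_C_mul_of_isUnit (.of_mul_eq_one _ hc), hc]
  have hVd : (C c * U).degree = ((m + 1 : ℕ) : WithBot ℕ) := by
    rw [degree_C_mul_of_isUnit (.of_mul_eq_one _ hc), degree_eq_natDegree, hd]
    rintro rfl
    simp at hd
  obtain ⟨r₀, r, hr⟩ := exists_eq_remPoly ((degree_modByMonic_lt F hV).trans_eq hVd)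
  refine ⟨F /ₘ (C c * U) * C c, r₀, r, ?_⟩
  rw [← hr, mul_assoc, mul_comm (F /ₘ _), add_comm, modByMonic_add_div]

variable {D : Type} [CommRing D] [IsDomain D]

/-- Modulo `y` the relation reads `G = α U` over a domain. The unit leading coefficient keeps the
degree of `U`, while that of `G` is smaller, so `α` vanishes modulo `y`. -/
theorem C_dvd_of_eq_mul_add (φ : B →+* D) {y : B} (hφ : ∀ r, φ r = 0 ↔ y ∣ r) {U G α β : B[X]}
    (hU : IsUnit U.leadingCoeff) (hG : G.degree < U.natDegree)
    (e : G = α * U + β * (C y * X)) : C y ∣ α := by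
  have hU' : (U.map φ).degree = U.natDegree := by
    have h := (hU.map φ).ne_zero
    rw [degree_map_eq_of_leadingCoeff_ne_zero _ h, degree_eq_natDegree]
    rintro rfl
    simp at h
  have hy : φ y = 0 := (hφ y).2 dvd_rfl
  have e' := congrArg (map φ) e
  rw [Polynomial.map_add, Polynomial.map_mul, Polynomial.map_mul, Polynomial.map_mul, map_C, hy,
    C_0, zero_mul, mul_zero, add_zero] at e'
  have hα : α.map φ = 0 := by
    by_contra hα
    have h := (degree_map_le (f := φ)).trans_lt hG
    rw [e', degree_mul, hU', degree_eq_natDegree hα] at h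
    have : (α.map φ).natDegree + U.natDegree < U.natDegree := by exact_mod_cast h
    omega
  refine (C_dvd_iff_dvd_coeff _ _).2 fun k => (hφ _).1 ?_
  rw [← coeff_map, hα, coeff_zero]

/-- The algebraic core. A remainder `α U + β y t` has `α = y γ`, so it equals `y (γ U + β t)` with
constant term `y γ(0) U(0)`. Conversely `y U(0) = y U - (U.divX) y t` lies in the ideal. Thus `U(0)`
affects only the constant coordinate. -/
theorem remPoly_mem_span_iff [IsDomain B] (φ : B →+* D) {y : B} (hφ : ∀ r, φ r = 0 ↔ y ∣ r)
    {U : B[X]} {m : ℕ} (hU : IsUnit U.leadingCoeff) (hd : U.natDegree = m + 1) (r₀ : B)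
    (r : Fin m → B) : remPoly r₀ r ∈ Ideal.span {U, C y * X} ↔
      y * U.coeff 0 ∣ r₀ ∧ ∀ i, y ∣ r i := by
  rw [Ideal.mem_span_pair]
  constructor
  · rintro ⟨α, β, e⟩
    obtain ⟨γ, rfl⟩ := C_dvd_of_eq_mul_add φ hφ hU
      ((degree_remPoly_lt r₀ r).trans_eq (by rw [hd])) e.symm
    have e' : remPoly r₀ r = C y * (γ * U + β * X) := by rw [← e]; ring
    constructor
    · refine ⟨γ.coeff 0, ?_⟩
      rw [← coeff_remPoly_zero r₀ r, e', coeff_C_mul, coeff_add, mul_coeff_zero, coeff_mul_X_zero]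
      ring
    · intro i
      rw [← coeff_remPoly_succ r₀ r i, e', coeff_C_mul]
      exact dvd_mul_right _ _
  · rintro ⟨⟨c, hc⟩, h⟩
    choose c' hc' using h
    refine ⟨C (c * y), ∑ i, C (c' i) * X ^ i.1 - C c * U.divX, ?_⟩
    rw [remPoly, hc, sub_mul, Finset.sum_mul]
    have h1 : ∑ i, C (r i) * X ^ (i.1 + 1) = ∑ i, C (c' i) * X ^ i.1 * (C y * X) :=
      Finset.sum_congr rfl fun i _ => by rw [hc', C_mul]; ring
    have h2 := congrArg (fun V => C c * C y * V) (divX_mul_X_add U)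
    rw [h1]
    simp only [C_mul] at h2 ⊢
    linear_combination -h2

/-- `y t` is regular modulo `U`. -/
theorem dvd_of_dvd_C_mul_X_mul [IsDomain B] {y : B} (hy : Prime y) {U : B[X]}
    (hU : IsUnit U.leadingCoeff) (h0 : U.coeff 0 ≠ 0) {G : B[X]} (h : U ∣ C y * X * G) : U ∣ G := by
  obtain ⟨α, hα⟩ := h
  -- The primes `y` and `t` of `B[t]` are cancelled in turn: `y` does not divide `U` because of the
  -- unit leading coefficient, nor does `t` because `U(0) ≠ 0`.
  have hyU : ¬ C y ∣ U := fun h =>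
    hy.not_isUnit (isUnit_of_dvd_unit ((C_dvd_iff_dvd_coeff _ _).1 h _) hU)
  obtain ⟨β, rfl⟩ := ((prime_C_iff.2 hy).dvd_or_dvd (hα ▸ ⟨X * G, by ring⟩ : C y ∣ U * α)).resolve_left
    hyU
  have h1 : X * G = U * β := mul_left_cancel₀ (prime_C_iff.2 hy).ne_zero (by
    linear_combination hα)
  obtain ⟨γ, rfl⟩ := (prime_X.dvd_or_dvd (h1 ▸ ⟨G, rfl⟩ : X ∣ U * β)).resolve_left
    fun h => h0 (X_dvd_iff.1 h)
  exact ⟨γ, mul_left_cancel₀ X_ne_zero (by linear_combination h1)⟩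

end OneVariable

/-! ### Ideals as kernels of substitutions -/

section Substitution
variable {σ : Type}

/-- Modulo `I`, the identity and `φ` are algebra maps that agree on the variables. -/
theorem sub_mem_of_X {I : Ideal (MvPolynomial σ ℚ)} (φ : MvPolynomial σ ℚ →ₐ[ℚ] MvPolynomial σ ℚ)
    (h : ∀ i, MvPolynomial.X i - φ (MvPolynomial.X i) ∈ I) (F : MvPolynomial σ ℚ) :
    F - φ F ∈ I := by
  rw [← Ideal.Quotient.eq_zero_iff_mem, map_sub, sub_eq_zero]
  have : (Ideal.Quotient.mkₐ ℚ I) = (Ideal.Quotient.mkₐ ℚ I).comp φ := MvPolynomial.algHom_ext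
    fun i => sub_eq_zero.1 ((map_sub _ _ _).symm.trans (Ideal.Quotient.eq_zero_iff_mem.2 (h i)))
  exact AlgHom.congr_fun this F

/-- As a kernel into a domain `I` is prime, so regularity of `b` on `A / I` only needs `φ b ≠ 0`. -/
theorem mem_of_mul_mem {A D : Type} [CommRing A] [CommRing D] [IsDomain D] {I : Ideal A}
    {φ : A →+* D} (hφ : ∀ F, φ F = 0 ↔ F ∈ I) {b : A} (hb : φ b ≠ 0) (y : A) (h : b * y ∈ I) :
    y ∈ I := by
  rw [← hφ, map_mul] at h
  exact (hφ y).1 ((mul_eq_zero.1 h).resolve_left hb)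

theorem bot_sup_span {A : Type} [CommRing A] (b F : A) : F ∈ ⊥ ⊔ Ideal.span {b} ↔ b ∣ F := by
  rw [bot_sup_eq, Ideal.mem_span_singleton]

end Substitution

/-! ### Polynomials from wide edges -/

section Wide
open Polynomial

theorem map_gPoly {A B : Type} [CommRing A] [CommRing B] (f : A →+* B) (s t : A) (m : ℕ) :
    f (gPoly s t m) = gPoly (f s) (f t) m := by
  induction m using Nat.twoStepInduction with
  | zero => exact map_ofNat f 2
  | one => simp [gPoly]
  | more m h0 h1 => simp only [gPoly, map_sub, map_mul, h0, h1]

theorem map_gDivSnd {A B : Type} [CommRing A] [CommRing B] (f : A →+* B) (b t t' : A) (m : ℕ) :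
    f (gDivSnd b t t' m) = gDivSnd (f b) (f t) (f t') m := by
  induction m using Nat.twoStepInduction with
  | zero => simp [gDivSnd]
  | one => simp [gDivSnd]
  | more m h0 h1 => simp only [gDivSnd, map_sub, map_mul, map_gPoly, h0, h1]

variable {B : Type} [CommRing B]

/-- `P` has degree at most `m`, and its coefficient of degree `m` is `c`. -/
structure HasLead (P : B[X]) (m : ℕ) (c : B) : Prop where
  le : P.natDegree ≤ m
  coeff : P.coeff m = c

namespace HasLead
variable {P Q : B[X]} {m k : ℕ} {c d : B}

theorem mul (hP : HasLead P m c) (hQ : HasLead Q k d) : HasLead (P * Q) (m + k) (c * d) :=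
  ⟨natDegree_mul_le_of_le hP.le hQ.le, by
    rw [coeff_mul_add_eq_of_natDegree_le hP.le hQ.le, hP.coeff, hQ.coeff]⟩

theorem sub (hP : HasLead P m c) (hQ : HasLead Q m d) : HasLead (P - Q) m (c - d) :=
  ⟨(natDegree_sub_le_of_le hP.le hQ.le).trans_eq (max_self m), by
    rw [coeff_sub, hP.coeff, hQ.coeff]⟩

theorem add (hP : HasLead P m c) (hQ : HasLead Q m d) : HasLead (P + Q) m (c + d) :=
  ⟨natDegree_add_le_of_degree_le hP.le hQ.le, by rw [coeff_add, hP.coeff, hQ.coeff]⟩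

theorem zero_of_lt (hP : HasLead P m c) (h : m < k) : HasLead P k 0 :=
  ⟨hP.le.trans h.le, coeff_eq_zero_of_natDegree_lt (hP.le.trans_lt h)⟩

theorem congr (hP : HasLead P m c) (h : m = k) (h' : c = d) : HasLead P k d := by
  subst h h'
  exact hP

theorem C (r : B) : HasLead (C r) 0 r := ⟨(natDegree_C r).le, coeff_C_zero⟩

theorem X : HasLead (X : B[X]) 1 1 := ⟨natDegree_X_le, coeff_X_one⟩

theorem ofNat_two : HasLead (2 : B[X]) 0 2 := C 2

theorem zero : HasLead (0 : B[X]) m 0 := ⟨by simp, coeff_zero _⟩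

end HasLead

theorem hasLead_gPoly {b T : B[X]} {c : B} (hb : HasLead b 1 1) (hT : HasLead T 1 c) (m : ℕ) :
    HasLead (gPoly b T (m + 1)) (m + 1) 1 := by
  induction m using Nat.twoStepInduction with
  | zero => exact hb
  | one => exact ((hb.mul hb).sub ((hT.mul .ofNat_two).zero_of_lt (by omega))).congr rfl (by ring)
  | more m h0 h1 =>
    exact (((hb.mul h1).congr (by ring) rfl).sub
      ((hT.mul h0).zero_of_lt (by omega : _ < m + 2 + 1))).congr rfl (by ring)

/-- In the recursion, `b` times the previous term carries its leading coefficient along and `gPoly`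
subtracts `1`. The last summand has too small a degree, because `T'` is only linear in the variable.
-/
theorem hasLead_gDivSnd {b T T' : B[X]} {c d : B} (hb : HasLead b 1 1) (hT : HasLead T 1 c)
    (hT' : HasLead T' 1 d) (m : ℕ) :
    HasLead (gDivSnd b T T' (m + 2)) m (-((m + 2 : ℕ) : B)) := by
  induction m using Nat.twoStepInduction with
  | zero =>
    have : gDivSnd b T T' 2 = 0 - 2 := by simp [gDivSnd, gPoly]
    rw [this]
    exact (HasLead.zero.sub .ofNat_two).congr rfl (by simp)
  | one =>
    have : gDivSnd b T T' 3 = b * (0 - 2) - b := by simp [gDivSnd, gPoly]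
    rw [this]
    exact ((hb.mul (HasLead.zero.sub .ofNat_two)).sub hb).congr rfl (by push_cast; ring)
  | more m h0 h1 =>
    exact ((((hb.mul h1).congr (by ring) rfl).sub (hasLead_gPoly hb hT (m + 1))).sub
      ((hT'.mul h0).zero_of_lt (by omega : _ < m + 1 + 1))).congr rfl (by push_cast; ring)

end Wide

/-! ### The polynomials of the square -/

section Square
open MvPolynomial

theorem map_arcPoly {A B : Type} [CommRing A] [CommRing B] (f : A →+* B) (n : ℕ) (x y : A) :
    f (arcPoly n x y) = arcPoly n (f x) (f y) := by
  simp [arcPoly, map_sum]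

/-- The coordinates of the boundary marks. -/
abbrev bd {ι : Type} (i : Fin 4) : MvPolynomial (ι ⊕ Fin 4) ℚ := X (Sum.inr i)

/-- The inclusion of the polynomials in the boundary marks. -/
def toMarks : MvPolynomial (Fin 0 ⊕ Fin 4) ℚ →ₐ[ℚ] MvPolynomial (Fin 2 ⊕ Fin 4) ℚ :=
  rename (Sum.map Fin.elim0 id)

/-- The substitution `x₂ = x₁ + x₃ - x₄`. -/
def substSum : MvPolynomial (Fin 0 ⊕ Fin 4) ℚ →ₐ[ℚ] MvPolynomial (Fin 0 ⊕ Fin 4) ℚ :=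
  aeval (Sum.elim Fin.elim0 ![bd 0, bd 0 + bd 2 - bd 3, bd 2, bd 3])

/-- The substitution `x₁ = x₄`. -/
def substDiff : MvPolynomial (Fin 0 ⊕ Fin 4) ℚ →ₐ[ℚ] MvPolynomial (Fin 0 ⊕ Fin 4) ℚ :=
  aeval (Sum.elim Fin.elim0 ![bd 3, bd 1, bd 2, bd 3])

/-- The substitution `x₂ = x₁ + x₃ - x₄`, `x₅ = x₄ + t`, `x₆ = x₁ + t`. -/
def substMarks : MvPolynomial (Fin 2 ⊕ Fin 4) ℚ →ₐ[ℚ]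
    Polynomial (MvPolynomial (Fin 0 ⊕ Fin 4) ℚ) :=
  aeval (Sum.elim ![Polynomial.C (bd 3) + Polynomial.X, Polynomial.C (bd 0) + Polynomial.X]
    ![Polynomial.C (bd 0), Polynomial.C (bd 0 + bd 2 - bd 3), Polynomial.C (bd 2),
      Polynomial.C (bd 3)])

/-- The evaluation at `t = x₅ - x₄`. -/
def evalMarks : Polynomial (MvPolynomial (Fin 0 ⊕ Fin 4) ℚ) →ₐ[ℚ]
    MvPolynomial (Fin 2 ⊕ Fin 4) ℚ :=
  Polynomial.eval₂AlgHom toMarks (X (Sum.inl 0) - bd 3) fun _ => Commute.all _ _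

theorem toMarks_bd (i : Fin 4) : toMarks (bd i) = bd i := rename_X _ _

theorem evalMarks_C (r : MvPolynomial (Fin 0 ⊕ Fin 4) ℚ) :
    evalMarks (Polynomial.C r) = toMarks r := Polynomial.eval₂_C _ _

theorem evalMarks_X : evalMarks Polynomial.X = X (Sum.inl 0) - bd 3 := Polynomial.eval₂_X _ _

theorem substMarks_bd (i : Fin 4) : substMarks (bd i) = Polynomial.C (substSum (bd i)) := by
  fin_cases i <;> simp [substMarks, substSum]

/-- The coefficients of `G` may still involve `x₂`; apart from eliminating it, the round trip
changes nothing. -/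
theorem substMarks_evalMarks (G : Polynomial (MvPolynomial (Fin 0 ⊕ Fin 4) ℚ)) :
    substMarks (evalMarks G) = G.map (substSum : _ →+* _) := by
  have h (r) : substMarks (toMarks r) = Polynomial.C (substSum r) := by
    induction r using MvPolynomial.induction_on with
    | C a => simp [toMarks, substMarks, substSum, MvPolynomial.algebraMap_eq]
    | add p q hp hq => simp only [map_add, hp, hq]
    | mul_X p i hp =>
      obtain ⟨i, hi⟩ | i := i
      · exact absurd hi (Nat.not_lt_zero _)
      · rw [map_mul, map_mul, hp, map_mul, map_mul]
        exact congrArg _ ((congrArg substMarks (toMarks_bd i)).trans (substMarks_bd i))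
  induction G using Polynomial.induction_on' with
  | add p q hp hq => simp only [map_add, hp, hq, Polynomial.map_add]
  | monomial k r =>
    rw [← Polynomial.C_mul_X_pow_eq_monomial, map_mul, map_pow, evalMarks_C, evalMarks_X,
      map_mul, map_pow, h, Polynomial.map_mul, Polynomial.map_pow, Polynomial.map_C,
      Polynomial.map_X]
    congr 2
    simp [substMarks]

theorem sub_substSum_mem (F : MvPolynomial (Fin 0 ⊕ Fin 4) ℚ) :
    F - substSum F ∈ ⊥ ⊔ Ideal.span {bd 2 - bd 3 + (bd 0 - bd 1)} := by
  refine sub_mem_of_X substSum (fun i => ?_) F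
  obtain ⟨i, hi⟩ | i := i
  · exact absurd hi (Nat.not_lt_zero _)
  · rw [bot_sup_span]
    fin_cases i
    · simp [substSum]
    · exact ⟨-1, by simp [substSum]; ring⟩
    · simp [substSum]
    · simp [substSum]

theorem substSum_eq_zero_iff (F : MvPolynomial (Fin 0 ⊕ Fin 4) ℚ) :
    substSum F = 0 ↔ F ∈ ⊥ ⊔ Ideal.span {bd 2 - bd 3 + (bd 0 - bd 1)} := by
  constructor
  · intro h
    have := sub_substSum_mem F
    rwa [h, sub_zero] at this
  · rw [bot_sup_span]
    rintro ⟨c, rfl⟩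
    rw [map_mul]
    refine mul_eq_zero_of_left ?_ _
    simp [substSum]
    try ring

theorem substDiff_eq_zero_iff (F : MvPolynomial (Fin 0 ⊕ Fin 4) ℚ) :
    substDiff F = 0 ↔ bd 0 - bd 3 ∣ F := by
  constructor
  · intro h
    have := sub_mem_of_X (I := Ideal.span {bd 0 - bd 3}) substDiff (fun i => ?_) F
    · rwa [h, sub_zero, Ideal.mem_span_singleton] at this
    obtain ⟨i, hi⟩ | i := i
    · exact absurd hi (Nat.not_lt_zero _)
    · rw [Ideal.mem_span_singleton]
      fin_cases i <;> simp [substDiff]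
  · rintro ⟨c, rfl⟩
    rw [map_mul]
    refine mul_eq_zero_of_left ?_ _
    simp [substDiff]

theorem X_sub_X_ne_zero {σ : Type} {i j : σ} (h : i ≠ j) :
    (X i - X j : MvPolynomial σ ℚ) ≠ 0 := fun e => h (X_injective (sub_eq_zero.1 e))

/-- Its multiples form the kernel of `substDiff`, a map to a domain. -/
theorem prime_diff : Prime (bd 0 - bd 3 : MvPolynomial (Fin 0 ⊕ Fin 4) ℚ) := by
  refine ⟨X_sub_X_ne_zero (by simp), fun h => ?_, fun a b h => ?_⟩
  · have h1 := (substDiff_eq_zero_iff 1).2 h.dvd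
    exact one_ne_zero ((map_one substDiff).symm.trans h1)
  · rw [← substDiff_eq_zero_iff, map_mul, mul_eq_zero] at h
    rwa [← substDiff_eq_zero_iff, ← substDiff_eq_zero_iff]

theorem sub_evalMarks_mem (F : MvPolynomial (Fin 2 ⊕ Fin 4) ℚ) : F - evalMarks (substMarks F) ∈
    ⊥ ⊔ Ideal.span {bd 2 + X (Sum.inl 1) - X (Sum.inl 0) - bd 1} ⊔
      Ideal.span {bd 0 + X (Sum.inl 0) - X (Sum.inl 1) - bd 3} := by
  refine sub_mem_of_X (evalMarks.comp substMarks) (fun i => ?_) F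
  rw [bot_sup_eq, ← Ideal.span_union, Set.singleton_union, Ideal.mem_span_pair, AlgHom.comp_apply]
  obtain i | i := i
  · fin_cases i
    · exact ⟨0, 0, by simp [substMarks, evalMarks_C, evalMarks_X, toMarks_bd]⟩
    · exact ⟨0, -1, by simp [substMarks, evalMarks_C, evalMarks_X, toMarks_bd]; ring⟩
  · fin_cases i
    · exact ⟨0, 0, by simp [substMarks, evalMarks_C, toMarks_bd]⟩
    · exact ⟨-1, -1, by simp [substMarks, evalMarks_C, toMarks_bd]; ring⟩
    · exact ⟨0, 0, by simp [substMarks, evalMarks_C, toMarks_bd]⟩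
    · exact ⟨0, 0, by simp [substMarks, evalMarks_C, toMarks_bd]⟩

theorem substMarks_eq_zero_iff (F : MvPolynomial (Fin 2 ⊕ Fin 4) ℚ) : substMarks F = 0 ↔
    F ∈ ⊥ ⊔ Ideal.span {bd 2 + X (Sum.inl 1) - X (Sum.inl 0) - bd 1} ⊔
      Ideal.span {bd 0 + X (Sum.inl 0) - X (Sum.inl 1) - bd 3} := by
  constructor
  · intro h
    have := sub_evalMarks_mem F
    rwa [h, map_zero, sub_zero] at this
  · rw [bot_sup_eq, ← Ideal.span_union, Set.singleton_union, Ideal.mem_span_pair]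
    rintro ⟨a, b, rfl⟩
    rw [map_add, map_mul, map_mul]
    have h1 : substMarks (bd 2 + X (Sum.inl 1) - X (Sum.inl 0) - bd 1) = 0 := by
      simp [substMarks]; ring
    have h2 : substMarks (bd 0 + X (Sum.inl 0) - X (Sum.inl 1) - bd 3) = 0 := by
      simp [substMarks]
    rw [h1, h2, mul_zero, mul_zero, add_zero]

theorem substMarks_prod : substMarks (bd 0 * X (Sum.inl 0) - X (Sum.inl 1) * bd 3) =
    Polynomial.C (bd 0 - bd 3) * Polynomial.X := by
  simp [substMarks]; ring

/-- The polynomial `u₂` of the wide edge at the marks `3, 6, 5, 2`. -/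
abbrev sndPoly (n : ℕ) : MvPolynomial (Fin 2 ⊕ Fin 4) ℚ :=
  u₂ n (bd 2) (X (Sum.inl 1)) (X (Sum.inl 0)) (bd 1)

/-- After substitution, `x₅ + x₂` is monic of degree one in `t`, and both products `x₃ x₆`, `x₅ x₂`
are linear in `t`. The degree `n - 1` is written `n - 2 + 1` to match `remPoly` with `m = n - 2`. -/
theorem hasLead_sndPoly {n : ℕ} (hn : 2 ≤ n) :
    HasLead (substMarks (sndPoly n)) (n - 2 + 1) (-((n + 1 : ℕ) : MvPolynomial _ ℚ)) := by
  have h : substMarks (sndPoly n) = gDivSnd (Polynomial.X + Polynomial.C (bd 3 + (bd 0 + bd 2 - bd 3)))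
      (Polynomial.C (bd 2) * (Polynomial.C (bd 0) + Polynomial.X))
      ((Polynomial.C (bd 3) + Polynomial.X) * Polynomial.C (bd 0 + bd 2 - bd 3))
      (n - 2 + 1 + 2) := by
    rw [show n - 2 + 1 + 2 = n + 1 by omega]
    refine (map_gDivSnd (RingHomClass.toRingHom substMarks) _ _ _ _).trans ?_
    congr 1 <;> simp [substMarks]; ring
  have hX (r : MvPolynomial (Fin 0 ⊕ Fin 4) ℚ) :
      HasLead (Polynomial.C r + Polynomial.X) 1 1 :=
    (((HasLead.C r).zero_of_lt one_pos).add .X).congr rfl (zero_add 1)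
  rw [h]
  refine (hasLead_gDivSnd (by rw [add_comm]; exact hX _) ((HasLead.C _).mul (hX _))
    ((hX _).mul (HasLead.C _)) _).congr rfl ?_
  rw [show n - 2 + 1 + 2 = n + 1 by omega]

theorem isUnit_natCast_succ {σ : Type} (n : ℕ) : IsUnit (-((n + 1 : ℕ) : MvPolynomial σ ℚ)) := by
  rw [IsUnit.neg_iff, ← map_natCast (MvPolynomial.C : ℚ →+* MvPolynomial σ ℚ)]
  exact (isUnit_iff_ne_zero.2 (by exact_mod_cast n.succ_ne_zero)).map _

theorem natDegree_sndPoly {n : ℕ} (hn : 2 ≤ n) :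
    (substMarks (sndPoly n)).natDegree = n - 2 + 1 := by
  refine le_antisymm (hasLead_sndPoly hn).le (Polynomial.le_natDegree_of_ne_zero ?_)
  rw [(hasLead_sndPoly hn).coeff]
  exact (isUnit_natCast_succ n).ne_zero

theorem isUnit_leadingCoeff_sndPoly {n : ℕ} (hn : 2 ≤ n) :
    IsUnit (substMarks (sndPoly n)).leadingCoeff := by
  rw [Polynomial.leadingCoeff, natDegree_sndPoly hn, (hasLead_sndPoly hn).coeff]
  exact isUnit_natCast_succ n

/-- At `t = 0` the marks are `x₆ = x₁`, `x₅ = x₄`. The linear entry of the wide edge then vanishes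
and the quadratic one is `(x₁ - x₄)(x₃ - x₄)`, so only the `u₂` term of `u_spec` survives. -/
theorem coeff_sndPoly_mul (n : ℕ) :
    (substMarks (sndPoly n)).coeff 0 * ((bd 0 - bd 3) * (bd 2 - bd 3)) =
      bd 2 ^ (n + 1) + bd 0 ^ (n + 1) - bd 3 ^ (n + 1) - (bd 0 + bd 2 - bd 3) ^ (n + 1) := by
  have h : (substMarks (sndPoly n)).coeff 0 = u₂ n (bd 2) (bd 0) (bd 3) (bd 0 + bd 2 - bd 3) := by
    rw [Polynomial.coeff_zero_eq_eval_zero]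
    refine (map_gDivSnd ((Polynomial.evalRingHom 0).comp (RingHomClass.toRingHom substMarks)) _ _ _ _).trans ?_
    rw [u₂]
    congr 1 <;> simp [substMarks]
  rw [h, ← u_spec]
  ring

theorem coeff_sndPoly_ne_zero {n : ℕ} (hn : 2 ≤ n) : (substMarks (sndPoly n)).coeff 0 ≠ 0 := by
  intro h
  have := coeff_sndPoly_mul n
  rw [h, zero_mul] at this
  -- At `x₁ = x₃ = 1`, `x₄ = 0` the identity becomes `2 - 2 ^ (n + 1) = 0`.
  have := congrArg (eval (Sum.elim Fin.elim0 ![1, 0, 1, 0])) this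
  simp at this
  rw [one_add_one_eq_two] at this
  have h2 : (2 : ℚ) ^ (n + 1) = 2 ^ 1 := by linarith
  have := pow_right_injective₀ (by norm_num) (by norm_num) h2
  omega

/-- This identifies `C(Γ₂)` with the constant coordinate of `Γ`. On the hyperplane `x₁ - x₂ = -(x₃ -
x₄)`, so multiplied by `x₃ - x₄` both sides become the restriction of `w`. -/
theorem substSum_arcPoly_sub (n : ℕ) : substSum (arcPoly n (bd 2) (bd 3) - arcPoly n (bd 0) (bd 1)) =
    (bd 0 - bd 3) * (substMarks (sndPoly n)).coeff 0 := by
  refine mul_right_cancel₀ (X_sub_X_ne_zero (i := Sum.inr 2) (j := Sum.inr 3) (by simp)) ?_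
  have h1 := arcPoly_mul n (substSum (bd 2)) (substSum (bd 3))
  have h2 := arcPoly_mul n (substSum (bd 0)) (substSum (bd 1))
  have h3 := coeff_sndPoly_mul n
  rw [map_sub, ← RingHom.coe_coe substSum, map_arcPoly, map_arcPoly, RingHom.coe_coe]
  have e0 : substSum (bd 0) = bd 0 := by simp [substSum]
  have e1 : substSum (bd 1) = bd 0 + bd 2 - bd 3 := by simp [substSum]
  have e2 : substSum (bd 2) = bd 2 := by simp [substSum]
  have e3 : substSum (bd 3) = bd 3 := by simp [substSum]
  rw [e2, e3] at h1
  rw [e0, e1] at h2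
  rw [e0, e1, e2, e3]
  linear_combination h1 + h2 - h3

/-- `φ` need not be surjective: it is enough that `ψ` undoes it modulo `I`. So the linear relations
can be eliminated before membership is tested. -/
theorem mem_sup_span_iff {A D : Type} [CommRing A] [CommRing D] {I : Ideal A} (φ : A →+* D)
    (ψ : D →+* A) (hφ : ∀ F ∈ I, φ F = 0) (hψ : ∀ F, F - ψ (φ F) ∈ I) (S : Set A) (F : A) :
    F ∈ I ⊔ Ideal.span S ↔ φ F ∈ Ideal.span (φ '' S) := by
  constructor
  · intro h
    obtain ⟨i, hi, j, hj, rfl⟩ := Submodule.mem_sup.1 h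
    rw [map_add, hφ i hi, zero_add, ← Ideal.map_span]
    exact Ideal.mem_map_of_mem φ hj
  · intro h
    have hle : Ideal.span (φ '' S) ≤ (I ⊔ Ideal.span S).comap ψ := by
      rw [Ideal.span_le]
      rintro _ ⟨s, hs, rfl⟩
      have := sub_mem (Ideal.mem_sup_right (Ideal.subset_span hs))
        (Ideal.mem_sup_left (hψ s) : _ ∈ I ⊔ Ideal.span S)
      rwa [sub_sub_cancel] at this
    have := add_mem (Ideal.mem_sup_left (hψ F) : _ ∈ I ⊔ Ideal.span S) (hle h)
    rwa [sub_add_cancel] at this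

/-! ### The quotient rings -/

/-- The ideal that describes `Γ`. -/
abbrev squareIdeal (n : ℕ) : Ideal (MvPolynomial (Fin 2 ⊕ Fin 4) ℚ) :=
  ⊥ ⊔ Ideal.span {bd 2 + X (Sum.inl 1) - X (Sum.inl 0) - bd 1} ⊔
    Ideal.span {bd 0 + X (Sum.inl 0) - X (Sum.inl 1) - bd 3} ⊔ Ideal.span {sndPoly n} ⊔
    Ideal.span {bd 0 * X (Sum.inl 0) - X (Sum.inl 1) * bd 3}

/-- The ideal that describes `Γ₁`. -/
abbrev arcsIdeal₁ : Ideal (MvPolynomial (Fin 0 ⊕ Fin 4) ℚ) :=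
  ⊥ ⊔ Ideal.span {bd 0 - bd 3} ⊔ Ideal.span {bd 2 - bd 1}

/-- The ideal that describes `Γ₂`. -/
abbrev arcsIdeal₂ (n : ℕ) : Ideal (MvPolynomial (Fin 0 ⊕ Fin 4) ℚ) :=
  ⊥ ⊔ Ideal.span {bd 2 - bd 3 + (bd 0 - bd 1)} ⊔
    Ideal.span {arcPoly n (bd 2) (bd 3) - arcPoly n (bd 0) (bd 1)}

theorem mem_squareIdeal_iff (n : ℕ) (F : MvPolynomial (Fin 2 ⊕ Fin 4) ℚ) : F ∈ squareIdeal n ↔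
    substMarks F ∈ Ideal.span {substMarks (sndPoly n),
      Polynomial.C (bd 0 - bd 3) * Polynomial.X} := by
  rw [squareIdeal, sup_assoc _ (Ideal.span {sndPoly n}), ← Ideal.span_union, Set.singleton_union,
    ← substMarks_prod]
  refine (mem_sup_span_iff (RingHomClass.toRingHom substMarks) (RingHomClass.toRingHom evalMarks)
    (fun F => (substMarks_eq_zero_iff F).2) sub_evalMarks_mem _ F).trans ?_
  rw [Set.image_pair]
  rfl

theorem mem_sup_sndPoly_iff (n : ℕ) (F : MvPolynomial (Fin 2 ⊕ Fin 4) ℚ) :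
    F ∈ ⊥ ⊔ Ideal.span {bd 2 + X (Sum.inl 1) - X (Sum.inl 0) - bd 1} ⊔
      Ideal.span {bd 0 + X (Sum.inl 0) - X (Sum.inl 1) - bd 3} ⊔ Ideal.span {sndPoly n} ↔
    substMarks (sndPoly n) ∣ substMarks F := by
  refine (mem_sup_span_iff (RingHomClass.toRingHom substMarks) (RingHomClass.toRingHom evalMarks)
    (fun F => (substMarks_eq_zero_iff F).2) sub_evalMarks_mem _ F).trans ?_
  rw [Set.image_singleton, Ideal.mem_span_singleton]
  rfl

theorem mem_arcsIdeal₁_iff (F : MvPolynomial (Fin 0 ⊕ Fin 4) ℚ) :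
    F ∈ arcsIdeal₁ ↔ bd 0 - bd 3 ∣ substSum F := by
  have h : arcsIdeal₁ = ⊥ ⊔ Ideal.span {bd 2 - bd 3 + (bd 0 - bd 1)} ⊔
      Ideal.span {bd 0 - bd 3} := by
    -- Given `x₁ = x₄`, the relations `x₃ = x₂` and `x₁ - x₂ + x₃ - x₄ = 0` are equivalent. So `Γ₁`
    -- is also described over the hyperplane.
    ext F
    rw [arcsIdeal₁, bot_sup_eq, bot_sup_eq, ← Ideal.span_union, ← Ideal.span_union,
      Set.singleton_union, Set.singleton_union, Ideal.mem_span_pair, Ideal.mem_span_pair]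
    constructor
    · rintro ⟨a, b, rfl⟩
      exact ⟨b, a - b, by ring⟩
    · rintro ⟨a, b, rfl⟩
      exact ⟨a + b, a, by ring⟩
  rw [h]
  refine (mem_sup_span_iff (RingHomClass.toRingHom substSum) (RingHom.id _)
    (fun F => (substSum_eq_zero_iff F).2) sub_substSum_mem _ F).trans ?_
  rw [Set.image_singleton, Ideal.mem_span_singleton]
  have : RingHomClass.toRingHom substSum (bd 0 - bd 3) = bd 0 - bd 3 := by simp [substSum]
  rw [this]
  rfl

theorem mem_arcsIdeal₂_iff (n : ℕ) (F : MvPolynomial (Fin 0 ⊕ Fin 4) ℚ) : F ∈ arcsIdeal₂ n ↔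
    (bd 0 - bd 3) * (substMarks (sndPoly n)).coeff 0 ∣ substSum F := by
  refine (mem_sup_span_iff (RingHomClass.toRingHom substSum) (RingHom.id _)
    (fun F => (substSum_eq_zero_iff F).2) sub_substSum_mem _ F).trans ?_
  rw [Set.image_singleton, Ideal.mem_span_singleton, ← substSum_arcPoly_sub]
  rfl

/-- The splitting of the ideal of `Γ`, coordinate by coordinate in the powers of `t = x₅ - x₄`. It
makes `sumMap` both well defined and injective. -/
theorem evalMarks_remPoly_mem_iff {n : ℕ} (hn : 2 ≤ n) (r₀ : MvPolynomial (Fin 0 ⊕ Fin 4) ℚ)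
    (r : Fin (n - 2) → MvPolynomial (Fin 0 ⊕ Fin 4) ℚ) :
    evalMarks (remPoly r₀ r) ∈ squareIdeal n ↔ r₀ ∈ arcsIdeal₂ n ∧ ∀ i, r i ∈ arcsIdeal₁ := by
  have h : (remPoly r₀ r).map (substSum : _ →+* _) =
      remPoly (substSum r₀) fun i => substSum (r i) := by
    simp [remPoly, Polynomial.map_sum]
  rw [mem_squareIdeal_iff, substMarks_evalMarks, h,
    remPoly_mem_span_iff (RingHomClass.toRingHom substDiff) substDiff_eq_zero_iff
      (isUnit_leadingCoeff_sndPoly hn) (natDegree_sndPoly hn), mem_arcsIdeal₂_iff]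
  simp only [mem_arcsIdeal₁_iff]

theorem exists_sub_evalMarks_remPoly_mem {n : ℕ} (hn : 2 ≤ n)
    (F : MvPolynomial (Fin 2 ⊕ Fin 4) ℚ) :
    ∃ r₀ r, evalMarks (remPoly (m := n - 2) r₀ r) - F ∈ squareIdeal n := by
  obtain ⟨q, r₀, r, h⟩ := exists_eq_mul_add_remPoly (isUnit_leadingCoeff_sndPoly hn)
    (natDegree_sndPoly hn) (substMarks F)
  refine ⟨r₀, r, ?_⟩
  have h1 := sub_evalMarks_mem F
  have h2 := sub_evalMarks_mem (sndPoly n)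
  have h3 : evalMarks (remPoly r₀ r) - F = -(F - evalMarks (substMarks F)) +
      evalMarks q * (sndPoly n - evalMarks (substMarks (sndPoly n))) + -(evalMarks q * sndPoly n) := by
    rw [h, map_add, map_mul]
    ring
  rw [h3]
  exact Ideal.mem_sup_left (add_mem (Ideal.mem_sup_left (add_mem (neg_mem h1)
    (Ideal.mul_mem_left _ _ h2))) (Ideal.mem_sup_right (neg_mem
      (Ideal.mul_mem_left _ _ (Ideal.mem_span_singleton_self _)))))

theorem homogComp_toMarks (k : ℤ) (F : MvPolynomial (Fin 0 ⊕ Fin 4) ℚ) :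
    homogComp k (toMarks F) = toMarks (homogComp k F) := by
  induction F using MvPolynomial.induction_on' with
  | add p q hp hq => simp only [map_add, hp, hq]
  | monomial d c =>
    have h : IsHomog (monomial d c) (2 * (d.degree : ℤ)) :=
      isWeightedHomogeneous_monomial _ _ _ (GrFree.weight_two d)
    have h' : IsHomog (toMarks (monomial d c)) (2 * (d.degree : ℤ)) := by
      rw [toMarks, rename_monomial]
      refine isWeightedHomogeneous_monomial _ _ _ ((GrFree.weight_two _).trans ?_)
      rw [Finsupp.degree_mapDomain]
    rw [homogComp, homogComp, weightedHomogeneousComponent_of_mem h,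
      weightedHomogeneousComponent_of_mem h']
    split_ifs
    · rfl
    · rw [map_zero]

/-- Since `t = x₅ - x₄` has degree `2`, the coefficient of `t ^ (i + 1)` contributes its component
of degree `k - 2 (i + 1)`. -/
theorem homogComp_evalMarks_remPoly (k : ℤ) {m : ℕ} (r₀ : MvPolynomial (Fin 0 ⊕ Fin 4) ℚ)
    (r : Fin m → MvPolynomial (Fin 0 ⊕ Fin 4) ℚ) : homogComp k (evalMarks (remPoly r₀ r)) =
      evalMarks (remPoly (homogComp k r₀) fun i => homogComp (k - 2 * (i.1 + 1)) (r i)) := by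
  simp only [remPoly, map_add, map_sum, map_mul, map_pow, evalMarks_C, evalMarks_X,
    homogComp_toMarks]
  congr 1
  refine Finset.sum_congr rfl fun i _ => ?_
  rw [← homogComp_toMarks, ← homogComp_mul (((IsHomog.X _).sub (IsHomog.X _)).pow (i.1 + 1))]
  congr 2
  push_cast
  ring

/-- Multiplication by `c` between quotients. -/
def mulMap (c : MvPolynomial (Fin 2 ⊕ Fin 4) ℚ) {I : Ideal (MvPolynomial (Fin 0 ⊕ Fin 4) ℚ)}
    {J : Ideal (MvPolynomial (Fin 2 ⊕ Fin 4) ℚ)} (h : ∀ r ∈ I, toMarks r * c ∈ J) :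
    (MvPolynomial (Fin 0 ⊕ Fin 4) ℚ ⧸ I) →ₛₗ[RingHomClass.toRingHom toMarks]
      MvPolynomial (Fin 2 ⊕ Fin 4) ℚ ⧸ J :=
  Submodule.liftQ I
    { toFun := fun r => Ideal.Quotient.mk J (toMarks r * c)
      map_add' := fun r s => by rw [map_add, add_mul, map_add]
      map_smul' := fun r s => by
        rw [smul_eq_mul, map_mul toMarks, mul_assoc]
        rfl }
    fun r hr => Ideal.Quotient.eq_zero_iff_mem.2 (h r hr)

theorem toMarks_incl (r : MvPolynomial (Fin 4) ℚ) :
    toMarks (GrFree.incl (Fin 0) (Fin 4) r) = GrFree.incl (Fin 2) (Fin 4) r :=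
  rename_rename _ _ _

/-- The module that describes `C(Γ₂) ⊕ ⨁ C(Γ₁)⟨1⟩{3 - n + 2 i}`. -/
abbrev sumMod (n : ℕ) : GrMod (Fin 4) :=
  (GrMod.quot (arcsIdeal₂ n) (n + 1 - 2 * n)).restrict.prodShift
    (GrMod.pi fun i : Fin (n - 2) =>
      (GrMod.quot arcsIdeal₁ 0).restrict.shift (3 - (n : ℤ) + 2 * (i : ℕ))) 0 0

/-- The module that describes `C(Γ)`. -/
abbrev squareMod (n : ℕ) : GrMod (Fin 4) :=
  (GrMod.quot (squareIdeal n) (-1 + -1 + (n + 1 - (2 * n - 2)))).restrict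

theorem toMarks_mem₂ {n : ℕ} (hn : 2 ≤ n) (r) (hr : r ∈ arcsIdeal₂ n) :
    toMarks r * 1 ∈ squareIdeal n := by
  have := (evalMarks_remPoly_mem_iff hn r 0).2 ⟨hr, fun _ => zero_mem _⟩
  simpa [remPoly, evalMarks_C] using this

theorem toMarks_mem₁ {n : ℕ} (hn : 2 ≤ n) (i : Fin (n - 2)) (r) (hr : r ∈ arcsIdeal₁) :
    toMarks r * (X (Sum.inl 0) - bd 3) ^ (i.1 + 1) ∈ squareIdeal n := by
  have := (evalMarks_remPoly_mem_iff hn 0 (Pi.single i r)).2 ⟨zero_mem _, fun j => ?_⟩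
  · rw [remPoly, Finset.sum_eq_single i (fun j _ hj => by rw [Pi.single_eq_of_ne hj]; simp)
      (by simp), Pi.single_eq_same] at this
    simpa [evalMarks_C, evalMarks_X] using this
  · by_cases h : j = i
    · subst h
      rwa [Pi.single_eq_same]
    · rw [Pi.single_eq_of_ne h]
      exact zero_mem _

/-- `(r₀, r) ↦ r₀ + ∑ rᵢ (x₅ - x₄)^(i+1)`. -/
def sumMap {n : ℕ} (hn : 2 ≤ n) :
    (sumMod n).carrier →ₗ[MvPolynomial (Fin 4) ℚ] (squareMod n).carrier where
  toFun x := mulMap 1 (toMarks_mem₂ hn) x.1 + ∑ i, mulMap _ (toMarks_mem₁ hn i) (x.2 i)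
  map_add' x y := by
    have h (i) : mulMap _ (toMarks_mem₁ hn i) ((x + y).2 i) = mulMap _ (toMarks_mem₁ hn i) (x.2 i) +
      mulMap _ (toMarks_mem₁ hn i) (y.2 i) := map_add _ _ _
    have h0 : mulMap 1 (toMarks_mem₂ hn) (x + y).1 = mulMap 1 (toMarks_mem₂ hn) x.1 +
      mulMap 1 (toMarks_mem₂ hn) y.1 := map_add _ _ _
    rw [h0, Finset.sum_congr rfl fun i _ => h i, Finset.sum_add_distrib]
    exact add_add_add_comm _ _ _ _
  map_smul' r x := by
    have h0 : mulMap 1 (toMarks_mem₂ hn) (r • x).1 =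
        GrFree.incl (Fin 2) (Fin 4) r • mulMap 1 (toMarks_mem₂ hn) x.1 := by
      rw [← toMarks_incl]
      exact (mulMap 1 (toMarks_mem₂ hn)).map_smulₛₗ (GrFree.incl (Fin 0) (Fin 4) r) x.1
    have h1 (i) : mulMap _ (toMarks_mem₁ hn i) ((r • x).2 i) =
        GrFree.incl (Fin 2) (Fin 4) r • mulMap _ (toMarks_mem₁ hn i) (x.2 i) := by
      rw [← toMarks_incl]
      exact (mulMap _ (toMarks_mem₁ hn i)).map_smulₛₗ (GrFree.incl (Fin 0) (Fin 4) r) (x.2 i)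
    rw [h0, Finset.sum_congr rfl fun i _ => h1 i, ← Finset.smul_sum, ← smul_add]
    rfl

theorem sumMap_mk {n : ℕ} (hn : 2 ≤ n) (r₀ : MvPolynomial (Fin 0 ⊕ Fin 4) ℚ)
    (r : Fin (n - 2) → MvPolynomial (Fin 0 ⊕ Fin 4) ℚ) :
    sumMap hn (Ideal.Quotient.mk _ r₀, fun i => Ideal.Quotient.mk _ (r i)) =
      Ideal.Quotient.mk (squareIdeal n) (evalMarks (remPoly r₀ r)) := by
  change Ideal.Quotient.mk (squareIdeal n) (toMarks r₀ * 1) +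
    ∑ i, Ideal.Quotient.mk (squareIdeal n) (toMarks (r i) * (X (Sum.inl 0) - bd 3) ^ (i.1 + 1)) = _
  rw [remPoly, map_add evalMarks, map_sum evalMarks, map_add, map_sum, mul_one, evalMarks_C]
  simp only [map_mul evalMarks, map_pow evalMarks, evalMarks_C, evalMarks_X]

theorem exists_rep {n : ℕ} (x : (sumMod n).carrier) :
    ∃ r₀, ∃ r : Fin (n - 2) → MvPolynomial (Fin 0 ⊕ Fin 4) ℚ,
      x = (Ideal.Quotient.mk _ r₀, fun i => Ideal.Quotient.mk _ (r i)) := by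
  obtain ⟨r₀, h₀⟩ := Ideal.Quotient.mk_surjective (I := arcsIdeal₂ n) x.1
  choose r hr using fun i => Ideal.Quotient.mk_surjective (I := arcsIdeal₁) (x.2 i)
  exact ⟨r₀, r, Prod.ext h₀.symm (funext fun i => (hr i).symm)⟩

theorem sumMap_bijective {n : ℕ} (hn : 2 ≤ n) : Function.Bijective (sumMap hn) := by
  constructor
  · refine (injective_iff_map_eq_zero _).2 fun x hx => ?_
    obtain ⟨r₀, r, rfl⟩ := exists_rep x
    obtain ⟨h0, h1⟩ := (evalMarks_remPoly_mem_iff hn r₀ r).1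
      (Ideal.Quotient.eq_zero_iff_mem.1 ((sumMap_mk hn r₀ r).symm.trans hx))
    exact Prod.ext (Ideal.Quotient.eq_zero_iff_mem.2 h0)
      (funext fun i => Ideal.Quotient.eq_zero_iff_mem.2 (h1 i))
  · intro y
    obtain ⟨F, rfl⟩ := Ideal.Quotient.mk_surjective (I := squareIdeal n) y
    obtain ⟨r₀, r, h⟩ := exists_sub_evalMarks_remPoly_mem hn F
    exact ⟨_, (sumMap_mk hn r₀ r).trans (Ideal.Quotient.eq.2 h)⟩

theorem isHomogIdeal_squareIdeal (n : ℕ) : IsHomogIdeal (squareIdeal n) := by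
  refine (((IsHomogIdeal.bot.sup_span (p := 2) ?_).sup_span (p := 2) ?_).sup_span
    (isHomog_gDivSnd ((IsHomog.X _).add (IsHomog.X _)) ((IsHomog.X _).mul (IsHomog.X _))
      ((IsHomog.X _).mul (IsHomog.X _)) _)).sup_span
    (((IsHomog.X _).mul (IsHomog.X _)).sub ((IsHomog.X _).mul (IsHomog.X _)))
  · exact (((IsHomog.X _).add (IsHomog.X _)).sub (IsHomog.X _)).sub (IsHomog.X _)
  · exact (((IsHomog.X _).add (IsHomog.X _)).sub (IsHomog.X _)).sub (IsHomog.X _)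

/-- The graded isomorphism of quotient modules. -/
def sumIso {n : ℕ} (hn : 2 ≤ n) : GrMod.Iso (sumMod n) (squareMod n) where
  e := LinearEquiv.ofBijective (sumMap hn) (sumMap_bijective hn)
  mem k x := by
    -- The shift of `squareMod` adds up to `1 - n`, so its degree `k` part consists of the classes
    -- of polynomials of degree `k - 1 + n`.
    have key (r₀) (r : Fin (n - 2) → _) := homogComp_evalMarks_remPoly (k - 1 + n) r₀ r
    constructor
    · rintro ⟨⟨r₀, hr₀, h₀⟩, h⟩
      choose r hr hr' using fun i => h i trivial
      have hx : x = (Ideal.Quotient.mk _ r₀, fun i => Ideal.Quotient.mk _ (r i)) :=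
        Prod.ext h₀.symm (funext fun i => (hr' i).symm)
      refine ⟨evalMarks (remPoly r₀ r), ?_, (sumMap_mk hn r₀ r).symm.trans
        (congrArg (sumMap hn) hx.symm)⟩
      have h1 : homogComp (k - 1 + n) r₀ = r₀ := (hr₀.cast (by ring)).homogComp_eq
      have h2 (i) : homogComp (k - 1 + n - 2 * (i.1 + 1)) (r i) = r i :=
        ((hr i).cast (by ring)).homogComp_eq
      have h3 := key r₀ r
      simp only [h1, h2] at h3
      rw [← h3]
      exact (isHomog_homogComp _ _).cast (by ring)
    · rintro ⟨F, hF, hFx⟩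
      obtain ⟨r₀, r, rfl⟩ := exists_rep x
      -- The ideal is homogeneous, so the components of `r₀` and `r` of the right degrees represent
      -- the same class. By injectivity of `sumMap` they also represent `x`.
      have h1 := isHomogIdeal_squareIdeal n (F - evalMarks (remPoly r₀ r))
        (Ideal.Quotient.eq.1 (hFx.trans (sumMap_mk hn r₀ r))) (k - 1 + n)
      rw [map_sub, (hF.cast (by ring)).homogComp_eq, key] at h1
      have h2 := (sumMap_mk hn _ _).trans ((Ideal.Quotient.eq.2 h1).symm.trans hFx)
      rw [← (sumMap_bijective hn).1 h2]
      exact ⟨⟨_, (isHomog_homogComp _ _).cast (by ring), rfl⟩,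
        fun i _ => ⟨_, (isHomog_homogComp _ _).cast (by ring), rfl⟩⟩

/-! ### The resolutions of the three graphs -/

theorem incl_squareW (ι : Type) (n : ℕ) : GrFree.incl ι (Fin 4) (squareW n) =
    bd 0 ^ (n + 1) - bd 1 ^ (n + 1) + bd 2 ^ (n + 1) - bd 3 ^ (n + 1) := by
  change rename Sum.inr (squareW n) = _
  simp [squareW]

theorem CΓ_eq (n : ℕ) : ∃ h h', CΓ n =
    ((((GraphPiece.wideFact n (.inr 0) (.inl 0) (.inl 1) (.inr 3)).tensor
      (GraphPiece.wideFact n (.inr 2) (.inl 1) (.inl 0) (.inr 1))).ofEq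
        (v := GrFree.incl (Fin 2) (Fin 4) (squareGraph.potential n)) h).restrict).ofEq h' :=
  ⟨_, _, rfl⟩

theorem CΓ₁_eq (n : ℕ) : ∃ h h', CΓ₁ n =
    ((((GraphPiece.arcFact n (.inr 0) (.inr 3)).tensor
      (GraphPiece.arcFact n (.inr 2) (.inr 1))).ofEq
        (v := GrFree.incl (Fin 0) (Fin 4) (arcsGraph₁.potential n)) h).restrict).ofEq h' :=
  ⟨_, _, rfl⟩

theorem CΓ₂_eq (n : ℕ) : ∃ h h', CΓ₂ n =
    ((((GraphPiece.arcFact n (.inr 0) (.inr 1)).tensor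
      (GraphPiece.arcFact n (.inr 2) (.inr 3))).ofEq
        (v := GrFree.incl (Fin 0) (Fin 4) (arcsGraph₂.potential n)) h).restrict).ofEq h' :=
  ⟨_, _, rfl⟩

/-- `toPre` forgets the potential, so the transports along equalities of potentials disappear. -/
theorem tensor_ofEq_toPre {σ : Type} {n : ℕ} {w w' v v' : MvPolynomial σ ℚ} (M : GrFact σ n w)
    (N : GrFact σ n v) (h : w = w') (h' : v = v') :
    ((M.ofEq h).tensor (N.ofEq h')).toPre = (M.tensor N).toPre := by
  subst h h'
  rfl

theorem arcFact_tensor_toPre {μ : Type} (n : ℕ) (i j k l : μ) :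
    ∃ ha hb hc hd, ((GraphPiece.arcFact n i j).tensor (GraphPiece.arcFact n k l)).toPre =
      ((GrFact.koszul n (arcPoly n (X i) (X j)) (X i - X j) (2 * n) ha hb).tensor
        (GrFact.koszul n (arcPoly n (X k) (X l)) (X k - X l) (2 * n) hc hd)).toPre :=
  ⟨_, _, _, _, tensor_ofEq_toPre _ _ _ _⟩

theorem wideFact_tensor_toPre {μ : Type} (n : ℕ) (i j k l i' j' k' l' : μ) :
    ∃ h₁ h₂ h₃ h₄ h₅ h₆ h₇ h₈,
      ((GraphPiece.wideFact n i j k l).tensor (GraphPiece.wideFact n i' j' k' l')).toPre =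
      ((((GrFact.koszul n (u₁ n (X i) (X j) (X k) (X l)) (X i + X j - X k - X l) (2 * n)
        h₁ h₂).tensor (GrFact.koszul n (u₂ n (X i) (X j) (X k) (X l)) (X i * X j - X k * X l)
          (2 * n - 2) h₃ h₄)).shift (-1)).tensor
      (((GrFact.koszul n (u₁ n (X i') (X j') (X k') (X l')) (X i' + X j' - X k' - X l') (2 * n)
        h₅ h₆).tensor (GrFact.koszul n (u₂ n (X i') (X j') (X k') (X l'))
          (X i' * X j' - X k' * X l') (2 * n - 2) h₇ h₈)).shift (-1))).toPre :=
  ⟨_, _, _, _, _, _, _, _, tensor_ofEq_toPre _ _ _ _⟩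

theorem exists_isResolution {ι β : Type} {n : ℕ} {w w' : MvPolynomial β ℚ}
    {v : MvPolynomial (ι ⊕ β) ℚ} {I : Ideal (MvPolynomial (ι ⊕ β) ℚ)} {u : ℤ}
    {X : GrFact (ι ⊕ β) n v} (h : v = GrFree.incl ι β w) (h' : w = w')
    (hX : Pre.Resolves w' X.toPre (Pre.quot n I u).swap) :
    ∃ ε, GrFact.IsResolution ((X.ofEq h).restrict.ofEq h') (GrMod.quot I u).restrict ε := by
  subst h h'
  obtain ⟨p, hp⟩ := hX
  exact ⟨_, .of_lifts hp⟩

theorem exists_isResolution_susp {ι β : Type} {n : ℕ} {w w' : MvPolynomial β ℚ}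
    {v : MvPolynomial (ι ⊕ β) ℚ} {I : Ideal (MvPolynomial (ι ⊕ β) ℚ)} {u : ℤ}
    {X : GrFact (ι ⊕ β) n v} (h : v = GrFree.incl ι β w) (h' : w = w')
    (hX : Pre.Resolves w' X.toPre (Pre.quot n I u)) (s : ℤ) :
    ∃ ε, GrFact.IsResolution (((X.ofEq h).restrict.ofEq h').susp.shift s)
      ((GrMod.quot I u).restrict.shift s) ε := by
  subst h h'
  obtain ⟨p, hp⟩ := hX
  exact ⟨_, .susp_of_lifts hp s⟩

theorem mul_mem_bot {σ : Type} {b : MvPolynomial σ ℚ} (hb : b ≠ 0) (y : MvPolynomial σ ℚ)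
    (h : b * y ∈ (⊥ : Ideal (MvPolynomial σ ℚ))) : y ∈ (⊥ : Ideal (MvPolynomial σ ℚ)) :=
  Ideal.mem_bot.2 ((mul_eq_zero.1 (Ideal.mem_bot.1 h)).resolve_left hb)

/-- The linear entries `x₁ - x₄`, `x₃ - x₂` form a regular sequence. Both are second entries, so the
quotient stays in even parity. -/
theorem resolves_arcs₁ (n : ℕ) :
    Pre.Resolves (squareW n) ((GraphPiece.arcFact n (.inr 0) (.inr 3)).tensor
      (GraphPiece.arcFact n (.inr 2) (.inr 1))).toPre (Pre.quot n arcsIdeal₁ 0) := by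
  have e : arcPoly n (bd 0) (bd 3) * (bd 0 - bd 3) + arcPoly n (bd 2) (bd 1) * (bd 2 - bd 1) =
      GrFree.incl (Fin 0) (Fin 4) (squareW n) := by
    rw [arcPoly_mul, arcPoly_mul, incl_squareW]
    ring
  have h (y) : (bd 2 - bd 1) * y ∈ ⊥ ⊔ Ideal.span {bd 0 - bd 3} →
      y ∈ (⊥ ⊔ Ideal.span {bd 0 - bd 3} : Ideal (MvPolynomial (Fin 0 ⊕ Fin 4) ℚ)) := by
    refine mem_of_mul_mem (φ := RingHomClass.toRingHom substDiff)
      (fun F => (substDiff_eq_zero_iff F).trans (bot_sup_span _ _).symm) ?_ y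
    have : substDiff (bd 2 - bd 1) = bd 2 - bd 1 := by simp [substDiff]
    exact this.trans_ne (X_sub_X_ne_zero (by simp))
  obtain ⟨ha, hb, hc, hd, hX⟩ := arcFact_tensor_toPre (μ := Fin 0 ⊕ Fin 4) n (.inr 0) (.inr 3)
    (.inr 2) (.inr 1)
  rw [hX]
  exact Pre.resolves_koszul_tensor _ _ _ _ e (mul_mem_bot (X_sub_X_ne_zero (by simp))) h

/-- The linear entries would again lead to even parity. The row operation instead exposes their sum
and the difference of the arc polynomials, whose quotient is a summand of the module of `Γ`. -/
theorem resolves_arcs₂ {n : ℕ} (hn : 2 ≤ n) :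
    Pre.Resolves (squareW n) ((GraphPiece.arcFact n (.inr 0) (.inr 1)).tensor
      (GraphPiece.arcFact n (.inr 2) (.inr 3))).toPre
      (Pre.quot n (arcsIdeal₂ n) (n + 1 - 2 * n)).swap := by
  have e : arcPoly n (bd 0) (bd 1) * (bd 0 - bd 1) + arcPoly n (bd 2) (bd 3) * (bd 2 - bd 3) =
      GrFree.incl (Fin 0) (Fin 4) (squareW n) := by
    rw [arcPoly_mul, arcPoly_mul, incl_squareW]
    ring
  have h1 : (bd 2 - bd 3 + (bd 0 - bd 1) : MvPolynomial (Fin 0 ⊕ Fin 4) ℚ) ≠ 0 := fun h => by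
    have := congrArg (eval (Sum.elim Fin.elim0 ![0, 0, 1, 0])) h
    simp at this
  have h2 := mem_of_mul_mem (φ := RingHomClass.toRingHom substSum) substSum_eq_zero_iff
    (b := arcPoly n (bd 2) (bd 3) - arcPoly n (bd 0) (bd 1)) ((substSum_arcPoly_sub n).trans_ne
      (mul_ne_zero prime_diff.ne_zero (coeff_sndPoly_ne_zero hn)))
  obtain ⟨ha, hb, hc, hd, hX⟩ := arcFact_tensor_toPre (μ := Fin 0 ⊕ Fin 4) n (.inr 0) (.inr 1)
    (.inr 2) (.inr 3)
  rw [hX]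
  exact Pre.resolves_koszul_tensor_rowOp _ _ _ _ e (mul_mem_bot h1) h2

/-- Eliminating `x₂` by the first linear relation maps onto a domain in which the second one stays
nonzero. -/
theorem mul_mem_sup_span (y : MvPolynomial (Fin 2 ⊕ Fin 4) ℚ)
    (h : (bd 0 + X (Sum.inl 0) - X (Sum.inl 1) - bd 3) * y ∈
      ⊥ ⊔ Ideal.span {bd 2 + X (Sum.inl 1) - X (Sum.inl 0) - bd 1}) :
    y ∈ ⊥ ⊔ Ideal.span {bd 2 + X (Sum.inl 1) - X (Sum.inl 0) - bd 1} := by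
  let φ : MvPolynomial (Fin 2 ⊕ Fin 4) ℚ →ₐ[ℚ] MvPolynomial (Fin 2 ⊕ Fin 4) ℚ :=
    aeval (Sum.elim ![X (Sum.inl 0), X (Sum.inl 1)]
      ![bd 0, bd 2 + X (Sum.inl 1) - X (Sum.inl 0), bd 2, bd 3])
  refine mem_of_mul_mem (φ := RingHomClass.toRingHom φ) (fun F => ⟨fun hF => ?_, fun hF => ?_⟩)
    (b := bd 0 + X (Sum.inl 0) - X (Sum.inl 1) - bd 3) (fun h => ?_) y h
  · have := sub_mem_of_X (I := ⊥ ⊔ Ideal.span {bd 2 + X (Sum.inl 1) - X (Sum.inl 0) - bd 1})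
      φ (fun i => ?_) F
    · rwa [show φ F = 0 from hF, sub_zero] at this
    rw [bot_sup_span]
    obtain i | i := i
    · fin_cases i <;> simp [φ]
    · fin_cases i
      · simp [φ]
      · exact ⟨-1, by simp [φ]⟩
      · simp [φ]
      · simp [φ]
  · obtain ⟨c, rfl⟩ := (bot_sup_span _ _).1 hF
    exact (map_mul φ _ c).trans (mul_eq_zero_of_left (by simp [φ]) _)
  · have := congrArg (eval (Sum.elim ![0, 0] ![1, 0, 0, 0])) h
    simp [φ] at this

theorem resolves_square {n : ℕ} (hn : 2 ≤ n) :
    Pre.Resolves (squareW n) ((GraphPiece.wideFact n (.inr 0) (.inl 0) (.inl 1) (.inr 3)).tensor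
      (GraphPiece.wideFact n (.inr 2) (.inl 1) (.inl 0) (.inr 1))).toPre
      (Pre.quot n (squareIdeal n) (-1 + -1 + (n + 1 - (2 * n - 2)))).swap := by
  have h3 : (bd 2 + X (Sum.inl 1) - X (Sum.inl 0) - bd 1 : MvPolynomial (Fin 2 ⊕ Fin 4) ℚ) ≠ 0 :=
    fun h => by
      have := congrArg (eval (Sum.elim ![0, 0] ![0, 0, 1, 0])) h
      simp at this
  have h4 := mem_of_mul_mem (φ := RingHomClass.toRingHom substMarks) substMarks_eq_zero_iff
    (b := sndPoly n) fun h => (isUnit_leadingCoeff_sndPoly hn).ne_zero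
      (Polynomial.leadingCoeff_eq_zero.2 h)
  obtain ⟨_, _, _, _, _, _, _, _, hX⟩ := wideFact_tensor_toPre (μ := Fin 2 ⊕ Fin 4) n (.inr 0)
    (.inl 0) (.inl 1) (.inr 3) (.inr 2) (.inl 1) (.inl 0) (.inr 1)
  rw [hX]
  refine Pre.resolves_koszul_tensor_tensor _ _ _ _ _ _ _ _ ?_ (mul_mem_bot h3) mul_mem_sup_span h4
    fun y hy => ?_
  · rw [u_spec, u_spec, incl_squareW]
    ring
  -- The last entry is `y t` modulo `U`, the only place where the ideal is not treated as the kernel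
  -- of a map to a domain.
  · rw [mem_sup_sndPoly_iff] at hy ⊢
    rw [map_mul, substMarks_prod] at hy
    exact dvd_of_dvd_C_mul_X_mul prime_diff (isUnit_leadingCoeff_sndPoly hn)
      (coeff_sndPoly_ne_zero hn) hy

theorem isResolution_CΓ {n : ℕ} (hn : 2 ≤ n) :
    ∃ ε, GrFact.IsResolution (CΓ n) (squareMod n) ε := by
  obtain ⟨h, h', e⟩ := CΓ_eq n
  rw [e]
  exact exists_isResolution h h' (resolves_square hn)

theorem isResolution_CΓ₁ (n : ℕ) (s : ℤ) : ∃ ε, GrFact.IsResolution ((CΓ₁ n).susp.shift s)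
    ((GrMod.quot arcsIdeal₁ 0).restrict.shift s) ε := by
  obtain ⟨h, h', e⟩ := CΓ₁_eq n
  rw [e]
  exact exists_isResolution_susp h h' (resolves_arcs₁ n) s

theorem isResolution_CΓ₂ {n : ℕ} (hn : 2 ≤ n) :
    ∃ ε, GrFact.IsResolution (CΓ₂ n) (GrMod.quot (arcsIdeal₂ n) (n + 1 - 2 * n)).restrict ε := by
  obtain ⟨h, h', e⟩ := CΓ₂_eq n
  rw [e]
  exact exists_isResolution h h' (resolves_arcs₂ hn)

/-! ### Finite generation for the graphs made of arcs -/

theorem finite_restrict (M : GrFree (Fin 0 ⊕ Fin 4))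
    (h : Module.Finite (MvPolynomial (Fin 0 ⊕ Fin 4) ℚ) M.carrier) :
    Module.Finite (MvPolynomial (Fin 4) ℚ) M.restrict.carrier := by
  obtain ⟨S, hS⟩ := h.fg_top
  refine ⟨⟨S, ?_⟩⟩
  -- Without internal marks the boundary ring is the whole ring, so generators remain generators
  -- after restriction.
  have hsurj : Function.Surjective (GrFree.incl (Fin 0) (Fin 4)) := by
    intro r
    refine ⟨rename (Sum.elim Fin.elim0 id) r, ?_⟩
    refine (rename_rename _ _ r).trans ?_
    rw [show Sum.inr ∘ Sum.elim Fin.elim0 id = (id : Fin 0 ⊕ Fin 4 → _) from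
      funext fun i => by obtain ⟨i, hi⟩ | i := i; exacts [absurd hi (Nat.not_lt_zero _), rfl]]
    exact rename_id_apply r
  rw [eq_top_iff]
  rintro (x : M.carrier) -
  have hx : x ∈ Submodule.span (MvPolynomial (Fin 0 ⊕ Fin 4) ℚ) (S : Set M.carrier) := hS ▸ trivial
  induction hx using Submodule.span_induction with
  | mem x hx => exact Submodule.subset_span hx
  | zero => exact Submodule.zero_mem _
  | add x y _ _ hx hy => exact Submodule.add_mem _ hx hy
  | smul r x _ hx =>
    obtain ⟨r, rfl⟩ := hsurj r
    exact Submodule.smul_mem _ r hx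

theorem finite_arc_tensor {μ : Type} (n : ℕ) (i j k l : μ) :
    Module.Finite (MvPolynomial μ ℚ)
      ((GraphPiece.arcFact n i j).tensor (GraphPiece.arcFact n k l)).M0.carrier ∧
    Module.Finite (MvPolynomial μ ℚ)
      ((GraphPiece.arcFact n i j).tensor (GraphPiece.arcFact n k l)).M1.carrier := by
  have h : Module.Finite (MvPolynomial μ ℚ)
    ((MvPolynomial μ ℚ ⊗[MvPolynomial μ ℚ] MvPolynomial μ ℚ) ×
      (MvPolynomial μ ℚ ⊗[MvPolynomial μ ℚ] MvPolynomial μ ℚ)) := inferInstance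
  exact ⟨h, h⟩

theorem finite_CΓ₁ (n : ℕ) : Module.Finite (MvPolynomial (Fin 4) ℚ) (CΓ₁ n).M0.carrier ∧
    Module.Finite (MvPolynomial (Fin 4) ℚ) (CΓ₁ n).M1.carrier := by
  obtain ⟨h, h', e⟩ := CΓ₁_eq n
  rw [e]
  have f := finite_arc_tensor (μ := Fin 0 ⊕ Fin 4) n (.inr 0) (.inr 3) (.inr 2) (.inr 1)
  exact ⟨finite_restrict _ f.1, finite_restrict _ f.2⟩

theorem finite_CΓ₂ (n : ℕ) : Module.Finite (MvPolynomial (Fin 4) ℚ) (CΓ₂ n).M0.carrier ∧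
    Module.Finite (MvPolynomial (Fin 4) ℚ) (CΓ₂ n).M1.carrier := by
  obtain ⟨h, h', e⟩ := CΓ₂_eq n
  rw [e]
  have f := finite_arc_tensor (μ := Fin 0 ⊕ Fin 4) n (.inr 0) (.inr 1) (.inr 2) (.inr 3)
  exact ⟨finite_restrict _ f.1, finite_restrict _ f.2⟩

end Square

end MatFact

end

theorem mainTheorem6 (n : ℕ) (hn : 2 ≤ n) :
    ∃ (_ : GrFact.FinDimCohomology (CΓ₁ n)) (_ : GrFact.FinDimCohomology (CΓ₂ n))
      (hΓ : GrFact.FinDimCohomology (CΓ n))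
      (hS : GrFact.FinDimCohomology ((CΓ₂ n).prod
        (GrFact.pi fun i : Fin (n - 2) => (CΓ₁ n).susp.shift (3 - (n : ℤ) + 2 * (i : ℕ))))),
      Nonempty (Hmf.of _ hΓ ≅ Hmf.of _ hS) := by
  have f1 := finite_CΓ₁ n
  have f2 := finite_CΓ₂ n
  obtain ⟨ε, hε⟩ := isResolution_CΓ hn
  obtain ⟨ε₂, hε₂⟩ := isResolution_CΓ₂ hn
  choose ε₁ hε₁ using isResolution_CΓ₁ n
  obtain ⟨f, g, hfg, hgf⟩ := hε.exists_equiv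
    ((hε₂.prod (.pi fun i : Fin (n - 2) => hε₁ (3 - (n : ℤ) + 2 * (i : ℕ)))).trans (sumIso hn))
  have hS : GrFact.FinDimCohomology ((CΓ₂ n).prod
      (GrFact.pi fun i : Fin (n - 2) => (CΓ₁ n).susp.shift (3 - (n : ℤ) + 2 * (i : ℕ)))) :=
    GrFact.finDimCohomology_of_finite _
      -- The suspension interchanges the two modules of `C(Γ₁)`, hence `f1.2` in even parity and
      -- `f1.1` in odd parity.
      (@Module.Finite.prod _ _ _ _ _ _ _ _ f2.1 (@Module.Finite.pi _ _ _ _ _ _ _ fun _ => f1.2))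
      (@Module.Finite.prod _ _ _ _ _ _ _ _ f2.2 (@Module.Finite.pi _ _ _ _ _ _ _ fun _ => f1.1))
  have hΓ := hS.of_homotopic f g hfg
  exact ⟨GrFact.finDimCohomology_of_finite _ f1.1 f1.2,
    GrFact.finDimCohomology_of_finite _ f2.1 f2.2, hΓ, hS, GrFact.hmf_iso hΓ hS f g hfg hgf⟩
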